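/- Let $N\ge 1$, $0<T\le\infty$, $1\le p\le\infty$ and $\frac1{p'}:=1-\frac1p$. Let $u\in L^1(0,T;W^{1,\infty}(\mathbb R^N,\mathbb R^N))$, where $u(t,\cdot)$ is identified with its continuous representative, $\|f\|_{W^{1,\infty}}:=\|f\|_{L^\infty}+\sum_{i=1}^N\|\partial_i f\|_{L^\infty}$ and $\|u\|_{L^1W^{1,\infty}}:=\int_0^T\|u(t,\cdot)\|_{W^{1,\infty}}\,dt$. Let $\rho^0\in L^p(\mathbb R^N)$ with $\rho^0\ge 0$ a.e. Consider families $(\rho_t)_{0\le t<T}$ of locally finite signed Radon measures on $\mathbb R^N$, measurable in $t$, such that $\int_0^b\int_K(1+|u(t,x)|)\,d|\rho_t|(x)\,dt<\infty$ for every $0\le b<T$ and every compact $K\subset\mathbb R^N$. Such a family is a weak solution of $$\partial_t\rho+\operatorname{div}(\rho u)=0,\qquad \rho(0,\cdot)=\rho^0 \qquad (\ast)$$ if $$\int_0^T\int_{\mathbb R^N}\bigl(\partial_t\varphi+u\cdot\nabla\varphi\bigr)\,d\rho_t\,dt=-\int_{\mathbb R^N}\rho^0(x)\,\varphi(0,x)\,dx\qquad\text{for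 all }\varphi\in C^1_c([0,T)\times\mathbb R^N).$$ A function $\rho(t,x)$ is identified with the family $\rho_t=\rho(t,x)\,dx$. Then the following hold. 1. For every $x\in\mathbb R^N$ there is exactly one locally absolutely continuous curve $t\mapsto X(t,x)$, $t\in[0,T)$, with $\frac{d}{dt}X(t,x)=u(t,X(t,x))$ for a.e. $t$ and $X(0,x)=x$, and $X(t,\cdot)$ is continuous for every $t\in[0,T)$. 2. There is a nonnegative $\rho\in L^\infty(0,T;L^p(\mathbb R^N))$ which is a weak solution of $(\ast)$ and satisfies, for every $t\in[0,T)$, $$\rho(t,\cdot)\,dx=X(t,\cdot)_\#(\rho^0\,dx),\qquad \|\rho(t,\cdot)\|_{L^p}\le\exp\Bigl(\tfrac1{p'}\|u\|_{L^1W^{1,\infty}}\Bigr)\|\rho^0\|_{L^p},\qquad \|\rho(t,\cdot)\|_{L^1}=\|\rho^0\|_{L^1},$$ where the last equality is in $[0,\infty]$ (for $p=1$ both sides are finite). 3. If in addition $u$ is $C^1$ on $[0,T)\times\mathbb R^N$, this weak solution is unique: every weak solution $(\rho_t)$ of $(\ast)$ satisfies $\rho_t=\rho(t,\cdot)\,dx$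 for a.e. $t\in(0,T)$. -/

import Mathlib

open MeasureTheory Set
open scoped ENNReal NNReal

noncomputable section

namespace ContinuityEq

/-- The Euclidean space `ℝ^N`. -/
abbrev Space (N : ℕ) : Type := EuclideanSpace ℝ (Fin N)

/-- The time interval `[0, T)`, where `0 < T ≤ ∞`. -/
def timeSet (T : EReal) : Set ℝ := {t : ℝ | 0 ≤ t ∧ (t : EReal) < T}

/-- `g` is the weak (distributional) partial derivative `∂_i f` on `ℝ^N`. -/
structure IsWeakPartial {N : ℕ} (i : Fin N) (f g : Space N → Space N) : Prop where
  locInt_fun : LocallyIntegrable f volume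
  locInt_deriv : LocallyIntegrable g volume
  integral_eq : ∀ φ : Space N → ℝ, ContDiff ℝ (⊤ : ℕ∞) φ → HasCompactSupport φ →
    ∫ x, (fderiv ℝ φ x (EuclideanSpace.single i 1)) • f x = -∫ x, φ x • g x

/-- The norm `‖f‖_{L^∞} + ∑_i ‖∂_i f‖_{L^∞}` of `W^{1,∞}(ℝ^N, ℝ^N)`, with the Euclidean norm on
values. Weak derivatives are unique up to null sets, so each infimum is the norm of the weak
derivative if there is one and `∞` otherwise. -/
def w1infNorm {N : ℕ} (f : Space N → Space N) : ℝ≥0∞ :=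
  eLpNorm f ⊤ volume +
    ∑ i : Fin N, ⨅ (g : Space N → Space N) (_ : IsWeakPartial i f g), eLpNorm g ⊤ volume

/-- The norm of `L^1(0, T; W^{1,∞}(ℝ^N, ℝ^N))`. -/
def l1w1infNorm {N : ℕ} (T : EReal) (u : ℝ → Space N → Space N) : ℝ≥0∞ :=
  ∫⁻ t in timeSet T, w1infNorm (u t)

/-- `u ∈ L^1(0, T; W^{1,∞}(ℝ^N, ℝ^N))`. For almost every `t` the element `u t` of `W^{1,∞}` is given
by its continuous representative. For such functions, measurability in `t` for each fixed `x` is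
the same as joint measurability, and it follows from Bochner measurability. -/
structure MemL1W1inf {N : ℕ} (T : EReal) (u : ℝ → Space N → Space N) : Prop where
  measurable_time : ∀ x, AEStronglyMeasurable (fun t => u t x) (volume.restrict (timeSet T))
  continuous_space : ∀ᵐ t ∂(volume.restrict (timeSet T)), Continuous (u t)
  measurable_norm : AEMeasurable (fun t => w1infNorm (u t)) (volume.restrict (timeSet T))
  norm_lt_top : l1w1infNorm T u < ⊤

/-- `ρ ∈ L^∞(0, T; L^p(ℝ^N))` (jointly measurable, with `‖ρ(t)‖_p` essentially bounded in `t`). -/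
structure MemLinfLp {N : ℕ} (T : EReal) (p : ℝ≥0∞) (ρ : ℝ → Space N → ℝ) : Prop where
  measurable : AEStronglyMeasurable (fun z : ℝ × Space N => ρ z.1 z.2)
    ((volume.restrict (timeSet T)).prod volume)
  bounded : ∃ C : ℝ≥0, ∀ᵐ t ∂(volume.restrict (timeSet T)), eLpNorm (ρ t) p volume ≤ C

/-- `X t x` is the flow of `u` started at time `0`: for every `x`, the curve `t ↦ X t x` is the
locally absolutely continuous (Carathéodory) solution on `[0, T)` of `dX/dt = u(t, X)` for
a.e. `t`, `X(0) = x`, written in integral form. -/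
def IsFlow {N : ℕ} (T : EReal) (u : ℝ → Space N → Space N) (X : ℝ → Space N → Space N) : Prop :=
  ∀ x, ∀ t ∈ timeSet T,
    IntervalIntegrable (fun s => u s (X s x)) volume 0 t ∧
      X t x = x + ∫ s in (0 : ℝ)..t, u s (X s x)

/-- The measure `r dx`, for a nonnegative density `r`. -/
def densityMeasure {N : ℕ} (r : Space N → ℝ) : Measure (Space N) :=
  volume.withDensity fun x => ENNReal.ofReal (r x)

/-- Test functions in `C^1_c([0, T) × ℝ^N)`, as restrictions of functions in
`C^1_c((-∞, T) × ℝ^N)`. -/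
structure IsTestFunction {N : ℕ} (T : EReal) (φ : ℝ × Space N → ℝ) : Prop where
  contDiff : ContDiff ℝ 1 φ
  compact : HasCompactSupport φ
  support : tsupport φ ⊆ {z : ℝ × Space N | (z.1 : EReal) < T}

/-- `t ↦ μ t` is a measurable family of nonnegative measures on `ℝ^N`, and both `μ` and `|u| μ`
have finite mass on the compact subsets of `[0, T) × ℝ^N`. -/
structure IsAdmissibleCurve {N : ℕ} (T : EReal) (u : ℝ → Space N → Space N)
    (μ : ℝ → Measure (Space N)) : Prop where
  measurable : AEMeasurable μ (volume.restrict (timeSet T))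
  mass : ∀ b ∈ timeSet T, ∀ R : ℝ,
    ∫⁻ t in Icc 0 b, μ t (Metric.closedBall 0 R) < ⊤
  flux : ∀ b ∈ timeSet T, ∀ R : ℝ,
    ∫⁻ t in Icc 0 b, ∫⁻ x in Metric.closedBall 0 R, ‖u t x‖ₑ ∂(μ t) < ⊤

/-- The family of (signed, locally finite) Radon measures `ρ_t = μ t - ν t` on `ℝ^N` is a weak
solution of `∂_t ρ + div (ρ u) = 0` on `[0, T) × ℝ^N` with initial datum `ρ0 dx`:
`∫_0^T ∫ (∂_t φ + u · ∇φ) dρ_t dt = - ∫ ρ0 φ(0, ·) dx` for all test functions `φ`.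
The integrand `∂_t φ + u · ∇φ` at `(t, x)` is the derivative of `φ` in the direction
`(1, u t x)`. -/
structure IsWeakSolution {N : ℕ} (T : EReal) (u : ℝ → Space N → Space N) (ρ0 : Space N → ℝ)
    (μ ν : ℝ → Measure (Space N)) : Prop where
  pos : IsAdmissibleCurve T u μ
  neg : IsAdmissibleCurve T u ν
  weak_eq : ∀ φ : ℝ × Space N → ℝ, IsTestFunction T φ →
    ∫ t in timeSet T,
        ((∫ x, fderiv ℝ φ (t, x) (1, u t x) ∂(μ t)) - ∫ x, fderiv ℝ φ (t, x) (1, u t x) ∂(ν t))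
      = -∫ x, ρ0 x * φ (0, x)

end ContinuityEq

end

/-!
Almost every `u t` is bounded by and Lipschitz with constant `m t = ‖u(t)‖_{W^{1,∞}}`, as one sees by
mollification, and `m` is integrable (`MemL1W1inf.exists_isLipschitzField`). Picard iteration and
Gronwall's inequality with the integrable coefficient `m` therefore give a unique flow `X`, with
injective maps that are Lipschitz in space (`IsLipschitzField.flow`, `IsLipschitzField.eq_flow`).

The divergence of `u t` is at most `m t` in the weak sense. Hence the flow maps Lebesgue measure to
at most `exp (∫ m)` times Lebesgue measure (`IsLipschitzField.map_flow_le`). The flow is only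
Lipschitz, and the proof avoids the change of variables formula: over a short time step a mollified
function is expanded to second order along the displacement and its gradient is tested against the
weak divergence (`IsLipschitzField.integral_comp_flow_le_step`); the steps are then summed up by a
discrete Gronwall argument. So `X(t)_# dx = w(t, ·) dx` with `w ≤ exp (∫ m)`, and
`ρ(t) = (ρ⁰ ∘ X(t)⁻¹) w(t)` is the transported density. The `L^p` bound follows from
`‖r w‖_{L^p(dx)} ≤ (sup w)^(1 - 1/p) ‖r‖_{L^p(w dx)}` with `r = ρ⁰ ∘ X(t)⁻¹`
(`IsLipschitzField.exists_transported_density`). That `ρ` is a weak solution is the fundamental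
theorem of calculus along the curves `t ↦ φ (t, X(t, x))`, integrated against `ρ⁰ dx`
(`IsLipschitzField.isWeakSolution`).

Uniqueness is by duality. For a Lipschitz `ψ` with compact support in `[0, T) × ℝ^N`, the function
`χ(t, x) = -∫_t^T ψ(τ, X(t, τ, x)) dτ` solves `∂_t χ + u · ∇χ = ψ`, but is only Lipschitz in `x`. A
mollification of `χ` in space and time is an admissible test function, and it solves the dual
equation up to an error that is uniformly small because `u` is continuous
(`IsLipschitzBump.exists_testFunction`). Two weak solutions with the same datum thus have the same
integral against `ψ` (`IsLipschitzBump.setIntegral_eq`). Products of smooth functions of time and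
plateau functions, which approximate the indicators of a countable `π`-system of open sets, then
identify the measures at almost every time (`IsWeakSolution.ae_eq_add`).
-/

/-! ### Absolutely continuous functions and Gronwall's inequality -/

namespace ContinuityEq

theorem absolutelyContinuousOnInterval_of_dist_le {X Y : Type*} [PseudoMetricSpace X]
    [PseudoMetricSpace Y] {f : ℝ → X} {g : ℝ → Y} {a b : ℝ}
    (hg : AbsolutelyContinuousOnInterval g a b)
    (h : ∀ x ∈ uIcc a b, ∀ y ∈ uIcc a b, dist (f x) (f y) ≤ dist (g x) (g y)) :
    AbsolutelyContinuousOnInterval f a b := by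
  rw [absolutelyContinuousOnInterval_iff] at hg ⊢
  intro ε hε
  obtain ⟨δ, hδ, H⟩ := hg ε hε
  refine ⟨δ, hδ, fun E hE hlen => lt_of_le_of_lt (Finset.sum_le_sum fun i hi => ?_) (H E hE hlen)⟩
  exact h _ (hE.1 i hi).1 _ (hE.1 i hi).2

theorem integral_eq_sub_of_absolutelyContinuous {f f' : ℝ → ℝ} {a b : ℝ}
    (hf : AbsolutelyContinuousOnInterval f a b)
    (h : ∀ᵐ x, x ∈ uIcc a b → HasDerivAt f (f' x) x) :
    ∫ x in a..b, f' x = f b - f a := by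
  rw [← hf.integral_deriv_eq_sub]
  apply intervalIntegral.integral_congr_ae
  filter_upwards [h] with x hx hxab
  exact (hx (uIoc_subset_uIcc hxab)).deriv.symm

theorem absolutelyContinuousOnInterval_contDiff_comp {f g : ℝ → ℝ} {a b : ℝ}
    (hg : ContDiff ℝ 1 g) (hf : AbsolutelyContinuousOnInterval f a b) :
    AbsolutelyContinuousOnInterval (fun t => g (f t)) a b := by
  obtain ⟨R, hR⟩ := 
    (isCompact_uIcc.image_of_continuousOn hf.continuousOn).isBounded.subset_closedBall 0
  obtain ⟨K, hKL⟩ := hg.contDiffOn.exists_lipschitzOnWith (by decide)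
    (convex_closedBall (0 : ℝ) R) (isCompact_closedBall 0 R)
  refine absolutelyContinuousOnInterval_of_dist_le (hf.const_mul (K : ℝ)) fun x hx y hy => ?_
  have := hKL.dist_le_mul _ (hR (mem_image_of_mem _ hx)) _
    (hR (mem_image_of_mem _ hy))
  refine this.trans (le_of_eq ?_)
  simp only [Real.dist_eq, ← mul_sub, abs_mul, NNReal.abs_eq]

theorem absolutelyContinuousOnInterval_primitive {m : ℝ → ℝ} (hm : Integrable m) (s a b : ℝ) :
    AbsolutelyContinuousOnInterval (fun t => ∫ τ in s..t, m τ) a b := by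
  refine absolutelyContinuousOnInterval_of_dist_le
    ((hm.intervalIntegrable (a := a) (b := b)).absolutelyContinuousOnInterval_intervalIntegral
      (left_mem_uIcc)) fun x _ y _ => le_of_eq ?_
  have h : ∀ y z, IntervalIntegrable m volume y z := fun _ _ => hm.intervalIntegrable
  rw [Real.dist_eq, Real.dist_eq, intervalIntegral.integral_interval_sub_left (h _ _) (h _ _),
    intervalIntegral.integral_interval_sub_left (h _ _) (h _ _)]

theorem ae_hasDerivAt_primitive {F : Type*} [NormedAddCommGroup F] [NormedSpace ℝ F]
    [CompleteSpace F] {m : ℝ → F} (hm : Integrable m) (s : ℝ) :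
    ∀ᵐ t, HasDerivAt (fun t => ∫ τ in s..t, m τ) (m t) t :=
  (LocallyIntegrable.ae_hasDerivAt_integral hm.locallyIntegrable).mono fun _ h => h s

/-- The chain rule `∫ g'(M) m = g(M(t)) - g(0)` for the primitive `M` of an integrable `m`. -/
theorem integral_deriv_comp_primitive {m : ℝ → ℝ} (hm : Integrable m) {g g' : ℝ → ℝ}
    (hg : ∀ x, HasDerivAt g (g' x) x) (hg' : Continuous g') (s t : ℝ) :
    ∫ τ in s..t, g' (∫ r in s..τ, m r) * m τ = g (∫ r in s..t, m r) - g 0 := by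
  have hAC := absolutelyContinuousOnInterval_primitive hm s s t
  have hgc : ContDiff ℝ 1 g := by
    rw [contDiff_one_iff_deriv]
    exact ⟨fun x => (hg x).differentiableAt, by
      rwa [show deriv g = g' from funext fun x => (hg x).deriv]⟩
  have hcomp : AbsolutelyContinuousOnInterval (fun τ => g (∫ r in s..τ, m r)) s t :=
    absolutelyContinuousOnInterval_contDiff_comp hgc hAC
  rw [integral_eq_sub_of_absolutelyContinuous hcomp
    (f' := fun τ => g' (∫ r in s..τ, m r) * m τ), intervalIntegral.integral_same]
  filter_upwards [ae_hasDerivAt_primitive hm s] with τ hτ _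
  exact (hg _).comp τ hτ

/-- **Gronwall's inequality** with an integrable coefficient. -/
theorem gronwall_integrable {m a : ℝ → ℝ} (hm : Integrable m) (hm0 : ∀ t, 0 ≤ m t) {s t c : ℝ}
    (hst : s ≤ t) (ha : ContinuousOn a (Icc s t))
    (h : ∀ τ ∈ Icc s t, a τ ≤ c + ∫ r in s..τ, m r * a r) :
    a t ≤ c * Real.exp (∫ r in s..t, m r) := by
  set A : ℝ → ℝ := fun τ => ∫ r in s..τ, m r * a r with hA
  set M : ℝ → ℝ := fun τ => ∫ r in s..τ, m r with hM
  have hma : IntervalIntegrable (fun r => m r * a r) volume s t :=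
    hm.intervalIntegrable.mul_continuousOn (by rwa [uIcc_of_le hst])
  have hMAC := absolutelyContinuousOnInterval_primitive hm s s t
  have hAAC : AbsolutelyContinuousOnInterval A s t :=
    hma.absolutelyContinuousOnInterval_intervalIntegral left_mem_uIcc
  have hE : AbsolutelyContinuousOnInterval (fun τ => Real.exp (-M τ)) s t :=
    absolutelyContinuousOnInterval_contDiff_comp (g := fun x => Real.exp (-x))
      (Real.contDiff_exp.comp contDiff_neg) hMAC
  have hsum : AbsolutelyContinuousOnInterval (fun τ => Real.exp (-M τ) * (c + A τ)) s t := by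
    refine hE.fun_mul ?_
    exact absolutelyContinuousOnInterval_of_dist_le hAAC fun x _ y _ => by simp
  have hder : ∀ᵐ τ, τ ∈ uIcc s t → HasDerivAt (fun τ => Real.exp (-M τ) * (c + A τ))
      (Real.exp (-M τ) * -m τ * (c + A τ) + Real.exp (-M τ) * (m τ * a τ)) τ := by
    filter_upwards [ae_hasDerivAt_primitive hm s, hma.ae_hasDerivAt_integral] with τ h1 h2 hτ
    exact (h1.neg.exp).mul ((h2 hτ s left_mem_uIcc).const_add c)
  -- `exp (-M) * (c + A)` is nonincreasing
  have key := integral_eq_sub_of_absolutelyContinuous hsum hder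
  have hle : ∫ τ in s..t, (Real.exp (-M τ) * -m τ * (c + A τ) + Real.exp (-M τ) * (m τ * a τ))
      ≤ 0 := by
    rw [intervalIntegral.integral_of_le hst]
    refine integral_nonpos_of_ae ?_
    filter_upwards [ae_restrict_mem measurableSet_Ioc] with τ hτ
    have h1 := h τ (Ioc_subset_Icc_self hτ)
    have h2 : 0 ≤ Real.exp (-M τ) * m τ := mul_nonneg (Real.exp_pos _).le (hm0 τ)
    have h3 := mul_le_mul_of_nonneg_left h1 h2
    simp only [Pi.zero_apply, hA] at h3 ⊢
    linarith
  have hs : Real.exp (-M s) * (c + A s) = c := by simp [hM, hA]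
  rw [key, hs, sub_nonpos, Real.exp_neg] at hle
  have h1 := h t (right_mem_Icc.2 hst)
  have h2 := (inv_mul_le_iff₀ (Real.exp_pos (M t))).1 hle
  calc a t ≤ c + A t := h1
    _ ≤ _ := by rw [mul_comm]; exact h2

theorem gronwall_integrable_backward {m a : ℝ → ℝ} (hm : Integrable m) (hm0 : ∀ t, 0 ≤ m t)
    {s t c : ℝ} (hst : s ≤ t) (ha : ContinuousOn a (Icc s t))
    (h : ∀ τ ∈ Icc s t, a τ ≤ c + ∫ r in τ..t, m r * a r) :
    a s ≤ c * Real.exp (∫ r in s..t, m r) := by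
  have key := gronwall_integrable (m := fun r => m (-r)) (a := fun r => a (-r)) (c := c)
    hm.comp_neg (fun t => hm0 _) (neg_le_neg hst) (ha.comp continuous_neg.continuousOn
      fun τ hτ => ⟨le_neg.2 hτ.2, neg_le.2 hτ.1⟩) fun τ hτ => by
      rw [intervalIntegral.integral_comp_neg (fun r => m r * a r), neg_neg]
      exact h _ ⟨le_neg.2 hτ.2, neg_le.2 hτ.1⟩
  rw [intervalIntegral.integral_comp_neg] at key
  simpa using key

end ContinuityEq

/-! ### The flow of a Lipschitz vector field that is integrable in time -/

namespace ContinuityEq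

/-- A time-dependent vector field on `E` that is bounded by `m t` and `m t`-Lipschitz at every time
`t`, where `m` is integrable on the whole time axis. -/
structure IsLipschitzField {E : Type*} [NormedAddCommGroup E] [MeasurableSpace E]
    (v : ℝ → E → E) (m : ℝ → ℝ) : Prop where
  measurable : ∀ x, Measurable fun t => v t x
  lipschitz : ∀ t x y, ‖v t x - v t y‖ ≤ m t * ‖x - y‖
  bound : ∀ t x, ‖v t x‖ ≤ m t
  integrable : Integrable m

namespace IsLipschitzField

set_option linter.unusedSectionVars false

variable {E : Type*} [NormedAddCommGroup E] [NormedSpace ℝ E] [CompleteSpace E]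
  [SecondCountableTopology E] [MeasurableSpace E] [BorelSpace E]
  {v : ℝ → E → E} {m : ℝ → ℝ}

theorem nonneg (hv : IsLipschitzField v m) (t : ℝ) : 0 ≤ m t :=
  (norm_nonneg _).trans (hv.bound t 0)

theorem continuous (hv : IsLipschitzField v m) (t : ℝ) : Continuous (v t) :=
  (LipschitzWith.of_dist_le_mul (K := .mk (m t) (hv.nonneg t)) fun x y => by
    simpa only [dist_eq_norm, NNReal.coe_mk] using hv.lipschitz t x y).continuous

theorem measurable_uncurry (hv : IsLipschitzField v m) :
    Measurable fun z : ℝ × E => v z.1 z.2 :=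
  (measurable_uncurry_of_continuous_of_measurable (u := fun x t => v t x)
    (fun t => hv.continuous t) hv.measurable).comp measurable_swap

theorem integrable_comp (hv : IsLipschitzField v m) {y : ℝ → E} (hy : Measurable y) :
    Integrable fun τ => v τ (y τ) :=
  hv.integrable.mono'
    (hv.measurable_uncurry.comp (measurable_id.prodMk hy)).aestronglyMeasurable
    (Filter.Eventually.of_forall fun _ => hv.bound _ _)

theorem norm_integral_le (hv : IsLipschitzField v m) (y : ℝ → E) (s t : ℝ) :
    ‖∫ τ in s..t, v τ (y τ)‖ ≤ |∫ τ in s..t, m τ| := by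
  rw [intervalIntegral.norm_intervalIntegral_eq, intervalIntegral.abs_intervalIntegral_eq]
  exact (norm_integral_le_of_norm_le hv.integrable.integrableOn
    (Filter.Eventually.of_forall fun τ => hv.bound τ _)).trans (le_abs_self _)

theorem abs_integral_le (hv : IsLipschitzField v m) (s t : ℝ) :
    |∫ τ in s..t, m τ| ≤ ∫ τ, m τ := by
  rw [intervalIntegral.abs_intervalIntegral_eq, abs_of_nonneg
    (integral_nonneg fun τ => hv.nonneg τ)]
  exact setIntegral_le_integral hv.integrable (Filter.Eventually.of_forall hv.nonneg)

theorem integral_nonneg_of_le (hv : IsLipschitzField v m) {s t : ℝ} (h : s ≤ t) :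
    0 ≤ ∫ τ in s..t, m τ :=
  intervalIntegral.integral_nonneg h fun τ _ => hv.nonneg τ

theorem exp_integral_le (hv : IsLipschitzField v m) (s t : ℝ) :
    Real.exp (∫ τ in s..t, m τ) ≤ Real.exp (∫ τ, m τ) :=
  Real.exp_le_exp.2 ((le_abs_self _).trans (hv.abs_integral_le s t))

theorem continuous_integral (hv : IsLipschitzField v m) (s : ℝ) :
    Continuous fun t => ∫ τ in s..t, m τ :=
  intervalIntegral.continuous_primitive (fun _ _ => hv.integrable.intervalIntegrable) s

theorem norm_integral_sub_le (hv : IsLipschitzField v m) {y z : ℝ → E} (hy : Measurable y)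
    (hz : Measurable z) {s t : ℝ} (hst : s ≤ t) {a : ℝ → ℝ}
    (ha : IntervalIntegrable (fun τ => m τ * a τ) volume s t)
    (h : ∀ τ ∈ Icc s t, ‖y τ - z τ‖ ≤ a τ) :
    ‖(∫ τ in s..t, v τ (y τ)) - ∫ τ in s..t, v τ (z τ)‖ ≤ ∫ τ in s..t, m τ * a τ := by
  rw [← intervalIntegral.integral_sub (hv.integrable_comp hy).intervalIntegrable
    (hv.integrable_comp hz).intervalIntegrable]
  refine intervalIntegral.norm_integral_le_of_norm_le hst
    (Filter.Eventually.of_forall fun τ hτ => ?_) ha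
  exact (hv.lipschitz _ _ _).trans
    (mul_le_mul_of_nonneg_left (h τ (Ioc_subset_Icc_self hτ)) (hv.nonneg τ))

/-- Stability of integral curves on `[s, t]` with respect to the initial position. -/
theorem norm_sub_le_of_integral_eq (hv : IsLipschitzField v m) {y z : ℝ → E} {s t : ℝ} {x x' : E}
    (hst : s ≤ t) (hy : Continuous y) (hz : Continuous z)
    (hy' : ∀ τ ∈ Icc s t, y τ = x + ∫ r in s..τ, v r (y r))
    (hz' : ∀ τ ∈ Icc s t, z τ = x' + ∫ r in s..τ, v r (z r)) :
    ‖y t - z t‖ ≤ ‖x - x'‖ * Real.exp (∫ r in s..t, m r) := by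
  have hc : Continuous fun τ => ‖y τ - z τ‖ := (hy.sub hz).norm
  refine gronwall_integrable (a := fun τ => ‖y τ - z τ‖) hv.integrable hv.nonneg hst
    hc.continuousOn fun τ hτ => ?_
  have h := hv.norm_integral_sub_le hy.measurable hz.measurable hτ.1
    (a := fun τ => ‖y τ - z τ‖)
    (hv.integrable.intervalIntegrable.mul_continuousOn hc.continuousOn) fun _ _ => le_rfl
  simp only [hy' τ hτ, hz' τ hτ]
  rw [add_sub_add_comm]
  exact (norm_add_le _ _).trans (by gcongr)

/-- The Picard operator with base time `s` and initial position `x`, on bounded continuous curves.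
Before time `s` the curves are constant. -/
noncomputable def picard (hv : IsLipschitzField v m) (s : ℝ) (x : E)
    (y : BoundedContinuousFunction ℝ E) : BoundedContinuousFunction ℝ E :=
  BoundedContinuousFunction.ofNormedAddCommGroup
    (fun t => x + ∫ τ in s..max s t, v τ (y τ))
    (continuous_const.add ((intervalIntegral.continuous_primitive
      (fun _ _ => (hv.integrable_comp y.continuous.measurable).intervalIntegrable) s).comp
        (continuous_const.max continuous_id)))
    (‖x‖ + ∫ τ, m τ)
    fun _ => (norm_add_le _ _).trans
      (add_le_add le_rfl ((hv.norm_integral_le _ _ _).trans (hv.abs_integral_le _ _)))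

theorem picard_apply (hv : IsLipschitzField v m) (s : ℝ) (x : E)
    (y : BoundedContinuousFunction ℝ E) (t : ℝ) :
    hv.picard s x y t = x + ∫ τ in s..max s t, v τ (y τ) := rfl

open scoped Nat in
/-- The factorial makes some iterate of the Picard operator a contraction on the whole time axis,
however large `∫ m` is. -/
theorem norm_iterate_picard_sub_le (hv : IsLipschitzField v m) (s : ℝ) (x : E)
    (y z : BoundedContinuousFunction ℝ E) (k : ℕ) (t : ℝ) :
    ‖(hv.picard s x)^[k] y t - (hv.picard s x)^[k] z t‖
      ≤ (∫ τ in s..max s t, m τ) ^ k / k ! * ‖y - z‖ := by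
  induction k generalizing t with
  | zero => simpa using (y - z).norm_coe_le_norm t
  | succ k ih =>
    rw [Function.iterate_succ_apply', Function.iterate_succ_apply', picard_apply, picard_apply,
      add_sub_add_left_eq_sub]
    have hst : s ≤ max s t := le_max_left _ _
    have hcont : Continuous fun τ => (∫ r in s..τ, m r) ^ k / k ! * ‖y - z‖ :=
      (((hv.continuous_integral s).pow k).div_const _).mul_const _
    refine (hv.norm_integral_sub_le (BoundedContinuousFunction.continuous _).measurable
      (BoundedContinuousFunction.continuous _).measurable hst
      (a := fun τ => (∫ r in s..τ, m r) ^ k / k ! * ‖y - z‖)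
      (hv.integrable.intervalIntegrable.mul_continuousOn hcont.continuousOn) fun τ hτ => ?_).trans ?_
    · simpa [max_eq_right hτ.1] using ih τ
    · have hd : ∀ w : ℝ, HasDerivAt (fun w : ℝ => w ^ (k + 1) / (k + 1)! * ‖y - z‖)
          (w ^ k / k ! * ‖y - z‖) w := fun w => by
        have := ((hasDerivAt_pow (k + 1) w).div_const ((k + 1)! : ℝ)).mul_const ‖y - z‖
        refine this.congr_deriv ?_
        rw [Nat.factorial_succ]
        push_cast
        have h1 : (k ! : ℝ) ≠ 0 := by positivity
        have h2 : (k + 1 : ℝ) ≠ 0 := by positivity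
        field_simp
      have := integral_deriv_comp_primitive hv.integrable hd (by fun_prop) s (max s t)
      simp only [mul_comm (m _)]
      rw [this]
      simp

theorem exists_integral_curve (hv : IsLipschitzField v m) (s : ℝ) (x : E) :
    ∃ y : ℝ → E, Continuous y ∧ ∀ t, y t = x + ∫ τ in s..max s t, v τ (y τ) := by
  obtain ⟨n, hn⟩ := ((FloorSemiring.tendsto_pow_div_factorial_atTop (∫ τ, m τ)).eventually
    (gt_mem_nhds zero_lt_one)).exists
  have h0 : 0 ≤ ∫ τ, m τ := integral_nonneg fun τ => hv.nonneg τ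
  have hC : ContractingWith (.mk ((∫ τ, m τ) ^ n / n.factorial) (by positivity))
      (hv.picard s x)^[n] := by
    refine ⟨hn, LipschitzWith.of_dist_le_mul fun y z => ?_⟩
    rw [dist_eq_norm, dist_eq_norm, NNReal.coe_mk,
      BoundedContinuousFunction.norm_le (by positivity)]
    intro t
    refine (hv.norm_iterate_picard_sub_le s x y z n t).trans ?_
    have h1 : 0 ≤ ∫ τ in s..max s t, m τ := hv.integral_nonneg_of_le (le_max_left _ _)
    have h2 : ∫ τ in s..max s t, m τ ≤ ∫ τ, m τ :=
      (le_abs_self _).trans (hv.abs_integral_le _ _)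
    gcongr
  have hfix := hC.isFixedPt_fixedPoint_iterate
  refine ⟨_, BoundedContinuousFunction.continuous (hC.fixedPoint _), fun t => ?_⟩
  conv_lhs => rw [← hfix]
  rfl

/-- `hv.flow s t x` is the position at time `t` of the integral curve of `v` that rests at `x` until
time `s` and follows `v` from then on. -/
noncomputable def flow (hv : IsLipschitzField v m) (s t : ℝ) (x : E) : E :=
  (hv.exists_integral_curve s x).choose t

theorem continuous_flow_time (hv : IsLipschitzField v m) (s : ℝ) (x : E) :
    Continuous fun t => hv.flow s t x :=
  (hv.exists_integral_curve s x).choose_spec.1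

theorem flow_eq_max (hv : IsLipschitzField v m) (s t : ℝ) (x : E) :
    hv.flow s t x = x + ∫ τ in s..max s t, v τ (hv.flow s τ x) :=
  (hv.exists_integral_curve s x).choose_spec.2 t

theorem flow_eq (hv : IsLipschitzField v m) {s t : ℝ} (hst : s ≤ t) (x : E) :
    hv.flow s t x = x + ∫ τ in s..t, v τ (hv.flow s τ x) := by
  conv_lhs => rw [hv.flow_eq_max, max_eq_right hst]

theorem flow_of_le (hv : IsLipschitzField v m) {s t : ℝ} (hst : t ≤ s) (x : E) :
    hv.flow s t x = x := by
  rw [hv.flow_eq_max, max_eq_left hst, intervalIntegral.integral_same, add_zero]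

theorem norm_flow_sub_self_le (hv : IsLipschitzField v m) (s t : ℝ) (x : E) :
    ‖hv.flow s t x - x‖ ≤ ∫ τ in s..max s t, m τ := by
  rw [hv.flow_eq_max, add_sub_cancel_left]
  exact (hv.norm_integral_le _ _ _).trans
    (abs_of_nonneg (hv.integral_nonneg_of_le (le_max_left _ _))).le

theorem norm_flow_sub_self_le' (hv : IsLipschitzField v m) (s t : ℝ) (x : E) :
    ‖hv.flow s t x - x‖ ≤ ∫ τ, m τ :=
  (hv.norm_flow_sub_self_le s t x).trans ((le_abs_self _).trans (hv.abs_integral_le _ _))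

/-- Integral curves are unique. -/
theorem eq_flow (hv : IsLipschitzField v m) {y : ℝ → E} {s t : ℝ} {x : E} (hst : s ≤ t)
    (hy : Continuous y) (hy' : ∀ τ ∈ Icc s t, y τ = x + ∫ r in s..τ, v r (y r)) :
    y t = hv.flow s t x := by
  have h := hv.norm_sub_le_of_integral_eq hst hy (hv.continuous_flow_time s x) hy'
    fun τ hτ => hv.flow_eq hτ.1 x
  rw [sub_self, norm_zero, zero_mul] at h
  exact sub_eq_zero.1 (norm_le_zero_iff.1 h)

theorem norm_flow_sub_le (hv : IsLipschitzField v m) (s t : ℝ) (x x' : E) :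
    ‖hv.flow s t x - hv.flow s t x'‖ ≤ Real.exp (∫ τ, m τ) * ‖x - x'‖ := by
  rcases le_total s t with hst | hst
  · refine (hv.norm_sub_le_of_integral_eq hst (hv.continuous_flow_time s x)
      (hv.continuous_flow_time s x') (fun τ hτ => hv.flow_eq hτ.1 x)
      fun τ hτ => hv.flow_eq hτ.1 x').trans ?_
    rw [mul_comm]
    exact mul_le_mul_of_nonneg_right (hv.exp_integral_le s t) (norm_nonneg _)
  · rw [hv.flow_of_le hst, hv.flow_of_le hst]
    exact le_mul_of_one_le_left (norm_nonneg _)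
      (Real.one_le_exp (integral_nonneg fun τ => hv.nonneg τ))

theorem continuous_flow_space (hv : IsLipschitzField v m) (s t : ℝ) :
    Continuous (hv.flow s t) :=
  (LipschitzWith.of_dist_le_mul (K := .mk _ (Real.exp_pos (∫ τ, m τ)).le) fun x y => by
    simpa only [dist_eq_norm, NNReal.coe_mk] using hv.norm_flow_sub_le s t x y).continuous

/-- Integral curves that meet at time `t` agree before, by Gronwall's inequality backwards in time. -/
theorem flow_injective (hv : IsLipschitzField v m) (s t : ℝ) :
    Function.Injective (hv.flow s t) := by
  intro x x' hxx
  rcases le_total s t with hst | hst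
  · have hc : Continuous fun τ => ‖hv.flow s τ x - hv.flow s τ x'‖ :=
      ((hv.continuous_flow_time s x).sub (hv.continuous_flow_time s x')).norm
    have h := gronwall_integrable_backward (c := 0)
      (a := fun τ => ‖hv.flow s τ x - hv.flow s τ x'‖) hv.integrable hv.nonneg hst
      hc.continuousOn fun τ hτ => by
        have h1 : ∀ z, hv.flow s τ z = hv.flow s t z - ∫ r in τ..t, v r (hv.flow s r z) := by
          intro z
          have hi := fun a b => (hv.integrable_comp
            (hv.continuous_flow_time s z).measurable).intervalIntegrable (a := a) (b := b)
          rw [hv.flow_eq hτ.1, hv.flow_eq hst,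
            ← intervalIntegral.integral_add_adjacent_intervals (hi s τ) (hi τ t)]
          abel
        simp only [h1 x, h1 x', hxx]
        rw [sub_sub_sub_cancel_left, norm_sub_rev, zero_add]
        exact hv.norm_integral_sub_le (hv.continuous_flow_time s x).measurable
          (hv.continuous_flow_time s x').measurable hτ.2
          (hv.integrable.intervalIntegrable.mul_continuousOn hc.continuousOn) fun _ _ => le_rfl
    rw [zero_mul] at h
    simpa [hv.flow_of_le le_rfl, sub_eq_zero] using h
  · simpa [hv.flow_of_le hst] using hxx

theorem flow_flow (hv : IsLipschitzField v m) {s r t : ℝ} (hsr : s ≤ r) (hrt : r ≤ t) (x : E) :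
    hv.flow r t (hv.flow s r x) = hv.flow s t x := by
  refine (hv.eq_flow hrt (hv.continuous_flow_time s x) fun τ hτ => ?_).symm
  have hi := fun a b => (hv.integrable_comp
    (hv.continuous_flow_time s x).measurable).intervalIntegrable (a := a) (b := b)
  rw [hv.flow_eq (hsr.trans hτ.1), hv.flow_eq hsr, add_assoc,
    intervalIntegral.integral_add_adjacent_intervals (hi s r) (hi r τ)]

theorem norm_flow_sub_flow_time_le (hv : IsLipschitzField v m) (s t t' : ℝ) (x : E) :
    ‖hv.flow s t x - hv.flow s t' x‖ ≤ |∫ τ in max s t'..max s t, m τ| := by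
  have hi := fun a b => (hv.integrable_comp
    (hv.continuous_flow_time s x).measurable).intervalIntegrable (a := a) (b := b)
  rw [hv.flow_eq_max, hv.flow_eq_max s t', add_sub_add_left_eq_sub,
    intervalIntegral.integral_interval_sub_left (hi _ _) (hi _ _)]
  exact hv.norm_integral_le _ _ _

theorem norm_flow_sub_flow_base_le (hv : IsLipschitzField v m) (s s' t : ℝ) (x : E) :
    ‖hv.flow s t x - hv.flow s' t x‖ ≤ Real.exp (∫ τ, m τ) * |∫ τ in s'..s, m τ| := by
  wlog hss : s ≤ s' generalizing s s'
  · rw [norm_sub_rev, intervalIntegral.integral_symm, abs_neg]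
    exact this s' s (le_of_not_ge hss)
  have h1 : 1 ≤ Real.exp (∫ τ, m τ) := Real.one_le_exp (integral_nonneg fun τ => hv.nonneg τ)
  rw [intervalIntegral.integral_symm, abs_neg, abs_of_nonneg (hv.integral_nonneg_of_le hss)]
  rcases le_total s' t with ht | ht
  · rw [← hv.flow_flow hss ht]
    refine (hv.norm_flow_sub_le _ _ _ _).trans ?_
    gcongr
    simpa [max_eq_right hss] using hv.norm_flow_sub_self_le s s' x
  · rw [hv.flow_of_le ht]
    refine (hv.norm_flow_sub_self_le s t x).trans ?_
    refine le_trans ?_ (le_mul_of_one_le_left (hv.integral_nonneg_of_le hss) h1)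
    rw [← intervalIntegral.integral_add_adjacent_intervals
      (hv.integrable.intervalIntegrable (a := s) (b := max s t))
      (hv.integrable.intervalIntegrable (a := max s t) (b := s'))]
    exact le_add_of_nonneg_right (hv.integral_nonneg_of_le (max_le hss ht))

/-- Joint continuity of the flow in the two times and the position. -/
theorem continuous_flow (hv : IsLipschitzField v m) :
    Continuous fun z : ℝ × ℝ × E => hv.flow z.1 z.2.1 z.2.2 := by
  rw [continuous_iff_continuousAt]
  rintro ⟨s₀, t₀, x₀⟩
  rw [ContinuousAt, tendsto_iff_norm_sub_tendsto_zero]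
  have hM := hv.continuous_integral
  set K := Real.exp (∫ τ, m τ)
  have hb : Continuous fun z : ℝ × ℝ × E => K * ‖z.2.2 - x₀‖ +
      (K * |∫ τ in s₀..z.1, m τ| + |∫ τ in max s₀ t₀..max s₀ z.2.1, m τ|) := by
    refine (continuous_const.mul (by fun_prop)).add ((continuous_const.mul
      ((hM s₀).comp continuous_fst).abs).add ?_)
    exact ((hM (max s₀ t₀)).comp (continuous_const.max (continuous_fst.comp continuous_snd))).abs
  refine squeeze_zero (fun _ => norm_nonneg _) (fun z => ?_)
    (show Filter.Tendsto _ _ (nhds 0) by simpa using hb.tendsto (s₀, t₀, x₀))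
  calc ‖hv.flow z.1 z.2.1 z.2.2 - hv.flow s₀ t₀ x₀‖
      = ‖(hv.flow z.1 z.2.1 z.2.2 - hv.flow z.1 z.2.1 x₀) +
          ((hv.flow z.1 z.2.1 x₀ - hv.flow s₀ z.2.1 x₀) +
            (hv.flow s₀ z.2.1 x₀ - hv.flow s₀ t₀ x₀))‖ := by congr 1; abel
    _ ≤ _ := (norm_add_le _ _).trans (add_le_add (hv.norm_flow_sub_le _ _ _ _)
        ((norm_add_le _ _).trans (add_le_add (hv.norm_flow_sub_flow_base_le _ _ _ _)
          (hv.norm_flow_sub_flow_time_le _ _ _ _))))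

end IsLipschitzField
end ContinuityEq

/-! ### Lipschitz representatives of `W^{1,∞}` functions -/

namespace ContinuityEq

open scoped ContDiff Convolution

theorem norm_le_of_eLpNorm_top {N : ℕ} {f : Space N → Space N} (hf : Continuous f) {c : ℝ}
    (hc : 0 ≤ c) (h : eLpNorm f ⊤ volume ≤ ENNReal.ofReal c) (x : Space N) : ‖f x‖ ≤ c := by
  have hae : ∀ᵐ x, ‖f x‖ ≤ c := by
    filter_upwards [ae_le_eLpNormEssSup (f := f) (μ := volume)] with x hx
    rw [eLpNorm_exponent_top] at h
    have := hx.trans h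
    rwa [← ofReal_norm, ENNReal.ofReal_le_ofReal_iff hc] at this
  have hd : Dense {x | ‖f x‖ ≤ c} := Measure.dense_of_ae hae
  have hcl : IsClosed {x | ‖f x‖ ≤ c} := isClosed_le hf.norm continuous_const
  have hx : x ∈ closure {x | ‖f x‖ ≤ c} := hd x
  rwa [hcl.closure_eq] at hx

/-- Near-optimal weak partial derivatives of a function of finite `W^{1,∞}` norm, together with
pointwise a.e. bounds. -/
theorem exists_weakPartial {N : ℕ} {f : Space N → Space N} (h : w1infNorm f ≠ ⊤) {δ : ℝ}
    (hδ : 0 < δ) :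
    ∃ (g : Fin N → Space N → Space N) (G : Fin N → ℝ), (∀ i, IsWeakPartial i f (g i)) ∧
      (∀ i, 0 ≤ G i) ∧ (∀ i, ∀ᵐ x, ‖g i x‖ ≤ G i) ∧ ∑ i, G i ≤ (w1infNorm f).toReal + N * δ := by
  set I : Fin N → ℝ≥0∞ := fun i =>
    ⨅ (g : Space N → Space N) (_ : IsWeakPartial i f g), eLpNorm g ⊤ volume with hI
  have hsum : ∑ i, I i ≤ w1infNorm f := le_add_self
  have hfin : ∀ i, I i ≠ ⊤ := fun i => ne_top_of_le_ne_top h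
    ((Finset.single_le_sum (f := I) (fun _ _ => zero_le) (Finset.mem_univ i)).trans hsum)
  have hex : ∀ i, ∃ g, IsWeakPartial i f g ∧ eLpNorm g ⊤ volume < I i + ENNReal.ofReal δ := by
    intro i
    have : I i < I i + ENNReal.ofReal δ :=
      ENNReal.lt_add_right (hfin i) (by simpa using hδ)
    obtain ⟨g, hg⟩ := iInf_lt_iff.1 this
    obtain ⟨hg', hlt⟩ := iInf_lt_iff.1 hg
    exact ⟨g, hg', hlt⟩
  choose g hg hlt using hex
  refine ⟨g, fun i => (I i).toReal + δ, hg, fun i => by positivity, fun i => ?_, ?_⟩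
  · filter_upwards [ae_le_eLpNormEssSup (f := g i) (μ := volume)] with x hx
    rw [← eLpNorm_exponent_top] at hx
    have h1 := hx.trans (hlt i).le
    rw [← ofReal_norm, ← ENNReal.ofReal_toReal (hfin i),
      ← ENNReal.ofReal_add ENNReal.toReal_nonneg hδ.le,
      ENNReal.ofReal_le_ofReal_iff (by positivity)] at h1
    exact h1
  · rw [Finset.sum_add_distrib, Finset.sum_const, Finset.card_univ, Fintype.card_fin, nsmul_eq_mul,
      ← ENNReal.toReal_sum fun i _ => hfin i]
    gcongr

/-- A nonnegative test function sees each weak partial derivative only through its sup norm. -/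
theorem norm_integral_fderiv_smul_le {N : ℕ} {i : Fin N} {f g : Space N → Space N} {G : ℝ}
    (hg : IsWeakPartial i f g) (hG : ∀ᵐ x, ‖g x‖ ≤ G) {φ : Space N → ℝ}
    (hφ : ContDiff ℝ ∞ φ) (hc : HasCompactSupport φ) (h0 : ∀ x, 0 ≤ φ x) :
    ‖∫ x, (fderiv ℝ φ x (EuclideanSpace.single i 1)) • f x‖ ≤ G * ∫ x, φ x := by
  rw [hg.integral_eq φ hφ hc, norm_neg, ← integral_const_mul]
  refine norm_integral_le_of_norm_le
    ((hφ.continuous.integrable_of_hasCompactSupport hc).const_mul G) ?_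
  filter_upwards [hG] with x hx
  rw [norm_smul, Real.norm_of_nonneg (h0 x), mul_comm]
  exact mul_le_mul_of_nonneg_right hx (h0 x)

theorem integrable_fderiv_smul {N : ℕ} {f : Space N → Space N} (hf : Continuous f)
    {φ : Space N → ℝ} (hφ : ContDiff ℝ ∞ φ) (hc : HasCompactSupport φ) (h : Space N) :
    Integrable fun x => (fderiv ℝ φ x h) • f x := by
  have h1 : Continuous (fderiv ℝ φ) := hφ.continuous_fderiv (by simp)
  refine Continuous.integrable_of_hasCompactSupport (by fun_prop) ?_
  exact ((hc.fderiv ℝ).comp_left (g := fun A : Space N →L[ℝ] ℝ => A h) rfl).smul_right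

theorem sum_apply_single {N : ℕ} (h : Space N) :
    ∑ i, h i • EuclideanSpace.single i (1 : ℝ) = h := by
  ext j
  simp [Finset.sum_apply, Pi.single_apply]

/-- The weak divergence of `f` is bounded by the `W^{1,∞}` norm. -/
theorem abs_integral_fderiv_apply_le {N : ℕ} {f : Space N → Space N} (hf : Continuous f)
    (hfin : w1infNorm f ≠ ⊤) {φ : Space N → ℝ} (hφ : ContDiff ℝ ∞ φ) (hc : HasCompactSupport φ)
    (h0 : ∀ x, 0 ≤ φ x) :
    |∫ x, fderiv ℝ φ x (f x)| ≤ (w1infNorm f).toReal * ∫ x, φ x := by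
  have hφ0 : 0 ≤ ∫ x, φ x := integral_nonneg h0
  have key : ∀ δ > 0, |∫ x, fderiv ℝ φ x (f x)| ≤ ((w1infNorm f).toReal + N * δ) * ∫ x, φ x := by
    intro δ hδ
    obtain ⟨g, G, hg, hG0, hG, hGs⟩ := exists_weakPartial hfin hδ
    have hi := fun i => integrable_fderiv_smul hf hφ hc (EuclideanSpace.single i (1 : ℝ))
    have heq : ∀ x, fderiv ℝ φ x (f x) =
        ∑ i, EuclideanSpace.proj (𝕜 := ℝ) i
          ((fderiv ℝ φ x (EuclideanSpace.single i (1 : ℝ))) • f x) := by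
      intro x
      conv_lhs => rw [← sum_apply_single (f x)]
      simp [map_sum, mul_comm]
    simp_rw [heq]
    rw [integral_finsetSum _ fun i _ => (EuclideanSpace.proj (𝕜 := ℝ) i).integrable_comp (hi i)]
    refine (Finset.abs_sum_le_sum_abs _ _).trans ?_
    refine le_trans (Finset.sum_le_sum fun i _ => ?_)
      ((Finset.sum_mul Finset.univ G (∫ x, φ x)).symm.le.trans
        (mul_le_mul_of_nonneg_right hGs hφ0))
    rw [ContinuousLinearMap.integral_comp_comm _ (hi i)]
    exact (PiLp.norm_apply_le _ i).trans (norm_integral_fderiv_smul_le (hg i) (hG i) hφ hc h0)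
  have hlim : Filter.Tendsto (fun δ : ℝ => ((w1infNorm f).toReal + N * δ) * ∫ x, φ x)
      (nhdsWithin 0 (Ioi 0)) (nhds ((w1infNorm f).toReal * ∫ x, φ x)) := by
    have : Continuous fun δ : ℝ => ((w1infNorm f).toReal + N * δ) * ∫ x, φ x := by fun_prop
    simpa using (this.tendsto 0).mono_left nhdsWithin_le_nhds
  exact ge_of_tendsto hlim (by filter_upwards [self_mem_nhdsWithin] with δ hδ using key δ hδ)

/-- The bound on the weak derivative in an arbitrary direction. -/
theorem norm_integral_fderiv_smul_direction_le {N : ℕ} {f : Space N → Space N}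
    (hf : Continuous f) (hfin : w1infNorm f ≠ ⊤) {φ : Space N → ℝ} (hφ : ContDiff ℝ ∞ φ)
    (hc : HasCompactSupport φ) (h0 : ∀ x, 0 ≤ φ x) (h : Space N) :
    ‖∫ x, (fderiv ℝ φ x h) • f x‖ ≤ (w1infNorm f).toReal * ‖h‖ * ∫ x, φ x := by
  have hφ0 : 0 ≤ ∫ x, φ x := integral_nonneg h0
  have key : ∀ δ > 0, ‖∫ x, (fderiv ℝ φ x h) • f x‖
      ≤ ((w1infNorm f).toReal + N * δ) * ‖h‖ * ∫ x, φ x := by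
    intro δ hδ
    obtain ⟨g, G, hg, hG0, hG, hGs⟩ := exists_weakPartial hfin hδ
    have hi := fun i => integrable_fderiv_smul hf hφ hc (EuclideanSpace.single i (1 : ℝ))
    have heq : ∀ x, (fderiv ℝ φ x h) • f x =
        ∑ i, h i • ((fderiv ℝ φ x (EuclideanSpace.single i (1 : ℝ))) • f x) := by
      intro x
      conv_lhs => rw [← sum_apply_single h]
      simp only [map_sum, map_smul, Finset.sum_smul, smul_assoc]
    simp_rw [heq]
    rw [integral_finsetSum _ fun i _ => Integrable.fun_smul (h i) (hi i)]
    refine (norm_sum_le _ _).trans ?_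
    have : ∀ i ∈ Finset.univ,
        ‖∫ x, h i • ((fderiv ℝ φ x (EuclideanSpace.single i (1 : ℝ))) • f x)‖
          ≤ G i * (‖h‖ * ∫ x, φ x) := by
      intro i _
      rw [integral_smul, norm_smul]
      calc ‖h i‖ * _ ≤ ‖h‖ * (G i * ∫ x, φ x) :=
            mul_le_mul (PiLp.norm_apply_le h i)
              (norm_integral_fderiv_smul_le (hg i) (hG i) hφ hc h0) (norm_nonneg _) (norm_nonneg _)
        _ = _ := by ring
    refine (Finset.sum_le_sum this).trans ?_
    rw [← Finset.sum_mul, mul_assoc]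
    exact mul_le_mul_of_nonneg_right hGs (by positivity)
  have hlim : Filter.Tendsto (fun δ : ℝ => ((w1infNorm f).toReal + N * δ) * ‖h‖ * ∫ x, φ x)
      (nhdsWithin 0 (Ioi 0)) (nhds ((w1infNorm f).toReal * ‖h‖ * ∫ x, φ x)) := by
    have : Continuous fun δ : ℝ => ((w1infNorm f).toReal + N * δ) * ‖h‖ * ∫ x, φ x := by fun_prop
    simpa using (this.tendsto 0).mono_left nhdsWithin_le_nhds
  exact ge_of_tendsto hlim (by filter_upwards [self_mem_nhdsWithin] with δ hδ using key δ hδ)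

/-- A continuous function in `W^{1,∞}` is Lipschitz: its mollifications are, with the same
constant. -/
theorem norm_sub_le_w1infNorm {N : ℕ} {f : Space N → Space N} (hf : Continuous f)
    (hfin : w1infNorm f ≠ ⊤) (x y : Space N) :
    ‖f x - f y‖ ≤ (w1infNorm f).toReal * ‖x - y‖ := by
  have hmoll : ∀ (b : ContDiffBump (0 : Space N)) (x y : Space N),
      ‖(b.normed volume ⋆[ContinuousLinearMap.lsmul ℝ ℝ, volume] f) x -
        (b.normed volume ⋆[ContinuousLinearMap.lsmul ℝ ℝ, volume] f) y‖
        ≤ (w1infNorm f).toReal * ‖x - y‖ := by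
    intro b x y
    set η := b.normed volume with hη
    have hηs : ContDiff ℝ ∞ η := b.contDiff_normed
    have hηc : HasCompactSupport η := b.hasCompactSupport_normed
    have hder := fun z => hηc.hasFDerivAt_convolution_left (ContinuousLinearMap.lsmul ℝ ℝ)
      (hηs.of_le (by simp)) hf.locallyIntegrable z (μ := volume) (g := f)
    refine Convex.norm_image_sub_le_of_norm_hasFDerivWithin_le (s := univ)
      (fun z _ => (hder z).hasFDerivWithinAt) (fun z _ => ?_) convex_univ (mem_univ y) (mem_univ x)
    refine ContinuousLinearMap.opNorm_le_bound _ ENNReal.toReal_nonneg fun h => ?_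
    have hex : ConvolutionExists (fderiv ℝ η) f
        ((ContinuousLinearMap.lsmul ℝ ℝ).precompL (Space N)) volume :=
      (hηc.fderiv ℝ).convolutionExists_left _ (hηs.continuous_fderiv (by simp))
        hf.locallyIntegrable
    rw [convolution_def, ContinuousLinearMap.integral_apply (hex z)]
    set φ : Space N → ℝ := fun w => η (z - w) with hφ
    have hφs : ContDiff ℝ ∞ φ := hηs.comp (contDiff_const.sub contDiff_id)
    have hφc : HasCompactSupport φ := hηc.comp_homeomorph (Homeomorph.subLeft z)
    have hφd : ∀ w, fderiv ℝ φ w h = -fderiv ℝ η (z - w) h := by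
      intro w
      have h1 : HasFDerivAt φ ((fderiv ℝ η (z - w)).comp
          (-ContinuousLinearMap.id ℝ (Space N))) w :=
        ((hηs.differentiable (by simp)) (z - w)).hasFDerivAt.comp w
          ((hasFDerivAt_id w).const_sub z)
      rw [h1.fderiv]
      simp
    have h2 := norm_integral_fderiv_smul_direction_le hf hfin hφs hφc
      (fun w => b.nonneg_normed _) h
    have h3 : ∫ w, φ w = 1 := by
      rw [hφ, integral_sub_left_eq_self (fun w => η w) volume z]
      exact b.integral_normed
    rw [h3, mul_one] at h2
    refine le_trans (le_of_eq ?_) h2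
    simp_rw [hφd, neg_smul]
    rw [integral_neg, norm_neg, ← integral_sub_left_eq_self _ volume z]
    simp [ContinuousLinearMap.precompL_apply]
  let b : ℕ → ContDiffBump (0 : Space N) := fun n =>
    ⟨1 / (n + 1 : ℝ) / 2, 1 / (n + 1 : ℝ), by positivity, half_lt_self (by positivity)⟩
  have hlim := fun z => ContDiffBump.convolution_tendsto_right_of_continuous (μ := volume)
    (φ := b) (l := Filter.atTop) tendsto_one_div_add_atTop_nhds_zero_nat hf z
  exact le_of_tendsto ((hlim x).sub (hlim y)).norm (Filter.Eventually.of_forall fun n =>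
    hmoll (b n) x y)

theorem measurableSet_timeSet (T : EReal) : MeasurableSet (timeSet T) :=
  measurableSet_Ici.inter (measurable_coe_real_ereal measurableSet_Iio)

/-- An element of `L^1(0, T; W^{1,∞})` agrees at almost every time with a Lipschitz field on the
whole time axis, whose divergence is controlled by the same integrable function. -/
theorem MemL1W1inf.exists_isLipschitzField {N : ℕ} {T : EReal} {u : ℝ → Space N → Space N}
    (hu : MemL1W1inf T u) :
    ∃ (v : ℝ → Space N → Space N) (m : ℝ → ℝ), IsLipschitzField v m ∧
      (∀ᵐ t ∂(volume.restrict (timeSet T)), v t = u t) ∧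
      ∫ t, m t = (l1w1infNorm T u).toReal ∧
      ∀ t (φ : Space N → ℝ), ContDiff ℝ ∞ φ → HasCompactSupport φ → (∀ x, 0 ≤ φ x) →
        |∫ x, fderiv ℝ φ x (v t x)| ≤ m t * ∫ x, φ x := by
  classical
  set μ := volume.restrict (timeSet T) with hμ
  have hD := fun n : ℕ => (hu.measurable_time (TopologicalSpace.denseSeq (Space N) n)).ae_eq_mk
  have hfin : ∀ᵐ t ∂μ, w1infNorm (u t) < ⊤ :=
    ae_lt_top' hu.measurable_norm hu.norm_lt_top.ne
  have hall : ∀ᵐ t ∂μ, t ∈ timeSet T ∧ Continuous (u t) ∧ w1infNorm (u t) < ⊤ ∧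
      w1infNorm (u t) = hu.measurable_norm.mk _ t ∧
      ∀ n, u t (TopologicalSpace.denseSeq (Space N) n) =
        (hu.measurable_time (TopologicalSpace.denseSeq (Space N) n)).mk _ t := by
    filter_upwards [ae_restrict_mem (measurableSet_timeSet T), hu.continuous_space, hfin,
      hu.measurable_norm.ae_eq_mk, ae_all_iff.2 hD] with t h1 h2 h3 h4 h5
    exact ⟨h1, h2, h3, h4, h5⟩
  -- off the measurable set `S` of good times the field is set to `0`
  obtain ⟨S, hSae, hSm, hS⟩ := hall.exists_measurable_mem
  refine ⟨fun t x => if t ∈ S then u t x else 0,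
    S.indicator fun t => (w1infNorm (u t)).toReal, ⟨?_, ?_, ?_, ?_⟩, ?_, ?_, ?_⟩
  · have hdense : ∀ n, Measurable fun t =>
        if t ∈ S then u t (TopologicalSpace.denseSeq (Space N) n) else 0 := by
      intro n
      have : (fun t => if t ∈ S then u t (TopologicalSpace.denseSeq (Space N) n) else 0) =
          S.indicator ((hu.measurable_time (TopologicalSpace.denseSeq (Space N) n)).mk _) := by
        ext1 t
        by_cases ht : t ∈ S
        · simp [ht, (hS t ht).2.2.2.2 n]
        · simp [ht]
      rw [this]
      exact (AEStronglyMeasurable.stronglyMeasurable_mk _).measurable.indicator hSm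
    -- measurability at every `x` from a dense sequence, on which the null sets are controlled
    intro x
    obtain ⟨a, ha, hax⟩ := mem_closure_iff_seq_limit.1
      ((TopologicalSpace.denseRange_denseSeq (Space N)) x)
    choose k hk using ha
    refine measurable_of_tendsto_metrizable (fun j => hdense (k j)) ?_
    rw [tendsto_pi_nhds]
    intro t
    by_cases ht : t ∈ S
    · simp only [ht, if_true, hk]
      exact ((hS t ht).2.1.tendsto x).comp hax
    · simp [ht]
  · intro t x y
    by_cases ht : t ∈ S
    · simpa [ht] using norm_sub_le_w1infNorm (hS t ht).2.1 (hS t ht).2.2.1.ne x y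
    · simp [ht]
  · intro t x
    by_cases ht : t ∈ S
    · simp only [ht, if_true, indicator_of_mem]
      refine norm_le_of_eLpNorm_top (hS t ht).2.1 ENNReal.toReal_nonneg ?_ x
      rw [ENNReal.ofReal_toReal (hS t ht).2.2.1.ne]
      exact le_self_add
    · simp [ht]
  · have hST : S ⊆ timeSet T := fun t ht => (hS t ht).1
    rw [integrable_indicator_iff hSm]
    exact (integrable_toReal_of_lintegral_ne_top hu.measurable_norm
      hu.norm_lt_top.ne).mono_measure (Measure.restrict_mono hST le_rfl)
  · filter_upwards [hSae] with t ht
    ext1 x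
    simp [ht]
  · have hSμ : ∀ᵐ t ∂μ, S.indicator (fun t => (w1infNorm (u t)).toReal) t =
        (w1infNorm (u t)).toReal := by
      filter_upwards [hSae] with t ht using indicator_of_mem ht _
    have hST : S ⊆ timeSet T := fun t ht => (hS t ht).1
    rw [← setIntegral_eq_integral_of_forall_compl_eq_zero (s := timeSet T)
      fun t ht => indicator_of_notMem (fun h => ht (hST h)) _,
      integral_congr_ae hSμ, integral_toReal hu.measurable_norm hfin]
    rfl
  · intro t φ hφ hc h0
    by_cases ht : t ∈ S
    · simpa [ht] using abs_integral_fderiv_apply_le (hS t ht).2.1 (hS t ht).2.2.1.ne hφ hc h0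
    · simp [ht]

end ContinuityEq

/-! ### One step of the Liouville estimate -/

namespace ContinuityEq

open scoped ContDiff Convolution

/-- A discrete Gronwall argument: an almost-exponential bound with quadratic error on short intervals
improves to an exponential bound. The subdivision has equal increments of `∫ m`. -/
theorem le_exp_mul_of_forall_le {I m : ℝ → ℝ} (hm : Integrable m) (hm0 : ∀ t, 0 ≤ m t)
    {s t a b : ℝ} (hst : s ≤ t) (ha : 0 ≤ a) (hb : 0 ≤ b)
    (h : ∀ r r', s ≤ r → r ≤ r' → r' ≤ t → I r ≤ Real.exp (∫ τ in r..r', m τ) * I r' +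
      (a * (∫ τ in r..r', m τ) + b * (∫ τ in r..r', m τ) ^ 2)) :
    I s ≤ Real.exp (∫ τ in s..t, m τ) * (I t + a * ∫ τ in s..t, m τ) := by
  set L := ∫ τ in s..t, m τ with hL
  have hL0 : 0 ≤ L := intervalIntegral.integral_nonneg hst fun τ _ => hm0 τ
  have hii : ∀ x y, IntervalIntegrable m volume x y := fun _ _ => hm.intervalIntegrable
  have hcont : Continuous fun r => ∫ τ in r..t, m τ := by
    simp_rw [intervalIntegral.integral_symm t]
    exact (intervalIntegral.continuous_primitive hii t).neg
  have key : ∀ n : ℕ, 0 < n →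
      I s ≤ Real.exp L * (I t + (a * L + b * L ^ 2 / n)) := by
    intro n hn
    have hn' : (0 : ℝ) < n := by exact_mod_cast hn
    set l := L / n with hl
    have hl0 : 0 ≤ l := by positivity
    have hstep : ∀ k : ℕ, k ≤ n → ∃ r ∈ Icc s t, ∫ τ in r..t, m τ = k * l ∧
        I r ≤ Real.exp (k * l) * (I t + k * (a * l + b * l ^ 2)) := by
      intro k
      induction k with
      | zero => exact fun _ => ⟨t, right_mem_Icc.2 hst, by simp⟩
      | succ k ih =>
        intro hk
        obtain ⟨r, hr, hrm, hrI⟩ := ih (by omega)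
        have hkl : ((k + 1 : ℕ) : ℝ) * l ≤ L := by
          rw [hl, mul_div_assoc', div_le_iff₀ hn', mul_comm]
          exact mul_le_mul_of_nonneg_left (by exact_mod_cast hk) hL0
        obtain ⟨r', hr', hrm'⟩ := intermediate_value_Icc' hr.1 hcont.continuousOn
          (show ((k + 1 : ℕ) : ℝ) * l ∈ Icc (∫ τ in r..t, m τ) (∫ τ in s..t, m τ) from
            ⟨by rw [hrm]; push_cast; nlinarith, hkl⟩)
        have hinc : ∫ τ in r'..r, m τ = l := by
          have := intervalIntegral.integral_add_adjacent_intervals (hii r' r) (hii r t)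
          simp only [hrm'] at this
          rw [hrm] at this
          push_cast at this
          linarith
        refine ⟨r', ⟨hr'.1, hr'.2.trans hr.2⟩, hrm', ?_⟩
        have h1 := h r' r hr'.1 hr'.2 hr.2
        rw [hinc] at h1
        have h2 : 1 ≤ Real.exp (((k + 1 : ℕ) : ℝ) * l) := Real.one_le_exp (by positivity)
        have h3 : Real.exp (((k + 1 : ℕ) : ℝ) * l) = Real.exp l * Real.exp (k * l) := by
          rw [← Real.exp_add]; push_cast; ring_nf
        have h4 := mul_le_mul_of_nonneg_left hrI (Real.exp_pos l).le
        have h5 : a * l + b * l ^ 2 ≤ Real.exp (((k + 1 : ℕ) : ℝ) * l) * (a * l + b * l ^ 2) :=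
          le_mul_of_one_le_left (by positivity) h2
        rw [h3] at h5 ⊢
        push_cast
        nlinarith
    obtain ⟨r, hr, hrm, hrI⟩ := hstep n le_rfl
    have hnl : (n : ℝ) * l = L := by rw [hl]; field_simp
    rw [hnl] at hrm hrI
    have hzero : ∫ τ in s..r, m τ = 0 := by
      have := intervalIntegral.integral_add_adjacent_intervals (hii s r) (hii r t)
      rw [hrm] at this
      linarith
    have h1 := h s r le_rfl hr.1 hr.2
    rw [hzero] at h1
    simp only [Real.exp_zero, one_mul, mul_zero, ne_eq, OfNat.ofNat_ne_zero, not_false_eq_true,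
      zero_pow, add_zero] at h1
    refine h1.trans (hrI.trans (le_of_eq ?_))
    congr 2
    rw [hl]
    field_simp
  have hlim : Filter.Tendsto (fun n : ℕ => Real.exp L * (I t + (a * L + b * L ^ 2 / n)))
      Filter.atTop (nhds (Real.exp L * (I t + (a * L + 0)))) :=
    (((tendsto_const_div_atTop_nhds_zero_nat _).const_add _).const_add _).const_mul _
  rw [add_zero] at hlim
  exact ge_of_tendsto hlim (by filter_upwards [Filter.eventually_gt_atTop 0] with n hn using key n hn)

variable {N : ℕ} {v : ℝ → Space N → Space N} {m : ℝ → ℝ}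

/-- The displacement `∫ v(τ, x) dτ` of an explicit Euler step depends
continuously on `x`. -/
theorem IsLipschitzField.continuous_displacement (hv : IsLipschitzField v m) (s t : ℝ) :
    Continuous fun x => ∫ τ in s..t, v τ x := by
  refine intervalIntegral.continuous_of_dominated_interval (bound := m) (fun x =>
    (hv.measurable x).aestronglyMeasurable) (fun x => Filter.Eventually.of_forall fun τ _ =>
      hv.bound τ x) hv.integrable.intervalIntegrable
    (Filter.Eventually.of_forall fun τ _ => hv.continuous τ)

/-- Consistency of the Euler step: the flow started at `x - w` moves by the displacement at `x` up to
an error of second order. -/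
theorem IsLipschitzField.norm_flow_sub_displacement_le (hv : IsLipschitzField v m) {s t : ℝ}
    (hst : s ≤ t) (x w : Space N) :
    ‖hv.flow s t (x - w) - (x - w + ∫ τ in s..t, v τ x)‖
      ≤ (∫ τ in s..t, m τ) * (‖w‖ + ∫ τ in s..t, m τ) := by
  rw [hv.flow_eq hst, add_sub_add_left_eq_sub]
  refine (hv.norm_integral_sub_le (a := fun _ => ‖w‖ + ∫ τ in s..t, m τ)
    (hv.continuous_flow_time s _).measurable measurable_const hst
    (hv.integrable.intervalIntegrable.mul_const _) fun τ hτ => ?_).trans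
      (intervalIntegral.integral_mul_const _ _).le
  have h1 := hv.norm_flow_sub_self_le s τ (x - w)
  rw [max_eq_right hτ.1] at h1
  have h2 : ∫ r in s..τ, m r ≤ ∫ r in s..t, m r := by
    rw [← intervalIntegral.integral_add_adjacent_intervals
      (hv.integrable.intervalIntegrable (a := s) (b := τ))
      (hv.integrable.intervalIntegrable (a := τ) (b := t))]
    exact le_add_of_nonneg_right (hv.integral_nonneg_of_le hτ.2)
  calc ‖hv.flow s τ (x - w) - x‖ = ‖(-w) + (hv.flow s τ (x - w) - (x - w))‖ := by
        congr 1; abel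
    _ ≤ ‖w‖ + ∫ τ in s..t, m τ := by
        refine (norm_add_le _ _).trans ?_
        rw [norm_neg]
        linarith

/-- The bound on the weak divergence, integrated in time. -/
theorem IsLipschitzField.integral_fderiv_displacement_le (hv : IsLipschitzField v m)
    (hdiv : ∀ t (φ : Space N → ℝ), ContDiff ℝ ∞ φ → HasCompactSupport φ → (∀ x, 0 ≤ φ x) →
      |∫ x, fderiv ℝ φ x (v t x)| ≤ m t * ∫ x, φ x)
    {s t : ℝ} (hst : s ≤ t) {h : Space N → ℝ} (hh : ContDiff ℝ ∞ h) (hc : HasCompactSupport h)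
    (h0 : ∀ x, 0 ≤ h x) :
    ∫ x, fderiv ℝ h x (∫ τ in s..t, v τ x) ≤ (∫ τ in s..t, m τ) * ∫ x, h x := by
  have hD : Continuous (fderiv ℝ h) := hh.continuous_fderiv (by simp)
  have hDi : Integrable fun x => ‖fderiv ℝ h x‖ :=
    (hD.integrable_of_hasCompactSupport (hc.fderiv ℝ)).norm
  have hjoint : Integrable (fun z : Space N × ℝ => fderiv ℝ h z.1 (v z.2 z.1))
      (volume.prod (volume.restrict (Ioc s t))) := by
    refine (hDi.mul_prod (hv.integrable.restrict (s := Ioc s t))).mono' ?_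
      (Filter.Eventually.of_forall fun z => ?_)
    · have h1 : Measurable fun z : Space N × ℝ => fderiv ℝ h z.1 := hD.measurable.comp measurable_fst
      have h2 : Measurable fun z : Space N × ℝ => v z.2 z.1 :=
        hv.measurable_uncurry.comp measurable_swap
      exact (isBoundedBilinearMap_apply (𝕜 := ℝ) (E := Space N) (F := ℝ)).continuous.measurable.comp
        (h1.prodMk h2) |>.aestronglyMeasurable
    · exact (ContinuousLinearMap.le_opNorm _ _).trans
        (mul_le_mul_of_nonneg_left (hv.bound _ _) (norm_nonneg _))
  have heq : ∀ x, fderiv ℝ h x (∫ τ in s..t, v τ x) = ∫ τ in Ioc s t, fderiv ℝ h x (v τ x) := by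
    intro x
    rw [intervalIntegral.integral_of_le hst, ContinuousLinearMap.integral_comp_comm]
    exact (hv.integrable_comp (y := fun _ => x) measurable_const).restrict
  simp_rw [heq]
  rw [integral_integral_swap hjoint, intervalIntegral.integral_of_le hst, ← integral_mul_const]
  refine integral_mono hjoint.integral_prod_right (hv.integrable.restrict.mul_const _) fun τ => ?_
  exact (le_abs_self _).trans (hdiv τ h hh hc h0)

/-- One step of the Liouville estimate. The transported function is mollified, so that it can be
expanded to second order along the displacement and tested against the weak divergence. -/
theorem IsLipschitzField.integral_comp_flow_le_step (hv : IsLipschitzField v m)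
    (hdiv : ∀ t (φ : Space N → ℝ), ContDiff ℝ ∞ φ → HasCompactSupport φ → (∀ x, 0 ≤ φ x) →
      |∫ x, fderiv ℝ φ x (v t x)| ≤ m t * ∫ x, φ x)
    {g : Space N → ℝ} {K R : ℝ} (hK : ∀ x y, |g x - g y| ≤ K * ‖x - y‖) (hK0 : 0 ≤ K)
    (hg0 : ∀ x, 0 ≤ g x) (hR : ∀ x, R < ‖x‖ → g x = 0)
    (b : ContDiffBump (0 : Space N)) (hb : b.rOut ≤ 1) {s t : ℝ} (hst : s ≤ t) :
    ∫ x, g (hv.flow s t x) ≤ Real.exp (∫ τ in s..t, m τ) * (∫ x, g x) +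
      (volume.real (Metric.closedBall (0 : Space N) (R + (∫ τ, m τ) + 1)) * (K * b.rOut) *
          (∫ τ in s..t, m τ) +
        volume.real (Metric.closedBall (0 : Space N) (R + (∫ τ, m τ) + 1)) *
          (K + K * ∫ w, ‖fderiv ℝ (b.normed volume) w‖) * (∫ τ in s..t, m τ) ^ 2) := by
  set η := b.normed volume with hη
  set l := ∫ τ in s..t, m τ with hl
  set A := ∫ τ, m τ with hA
  have hl0 : 0 ≤ l := hv.integral_nonneg_of_le hst
  have hlA : l ≤ A := (le_abs_self _).trans (hv.abs_integral_le s t)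
  have hηs : ContDiff ℝ ∞ η := b.contDiff_normed
  have hηc : HasCompactSupport η := b.hasCompactSupport_normed
  have hη1 : ∫ w, η w = 1 := b.integral_normed
  have hη0 : ∀ w, 0 ≤ η w := fun w => b.nonneg_normed w
  have hηi : Integrable η := b.integrable_normed
  have hηr : ∀ w, b.rOut < ‖w‖ → η w = 0 := fun w hw => by
    rw [← Function.notMem_support, hη, b.support_normed_eq, Metric.mem_ball, dist_zero_right]
    exact hw.le.not_gt
  have hDηr : ∀ w, b.rOut < ‖w‖ → fderiv ℝ η w = 0 := fun w hw => by
    have : w ∉ tsupport η := by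
      rw [hη, b.tsupport_normed_eq, Metric.mem_closedBall, dist_zero_right]
      exact hw.not_ge
    exact Function.notMem_support.1 fun h => this (support_fderiv_subset ℝ h)
  have hgc : Continuous g := (LipschitzWith.of_dist_le_mul (K := .mk K hK0) fun x y => by
    simpa only [dist_eq_norm, NNReal.coe_mk, Real.norm_eq_abs] using hK x y).continuous
  have hsupp : ∀ {k : Space N → ℝ} {r : ℝ}, (∀ x, r < ‖x‖ → k x = 0) → HasCompactSupport k := by
    intro k r hk
    refine HasCompactSupport.of_support_subset_isCompact (isCompact_closedBall 0 r) fun x hx => ?_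
    rw [Metric.mem_closedBall, dist_zero_right]
    by_contra h
    exact hx (hk x (not_le.1 h))
  have hgcs : HasCompactSupport g := hsupp hR
  set k : Space N → ℝ := fun x => g (hv.flow s t x) with hk
  have hkc : Continuous k := hgc.comp (hv.continuous_flow_space s t)
  have hkR : ∀ x, R + A < ‖x‖ → k x = 0 := fun x hx => hR _ (by
    have h1 := hv.norm_flow_sub_self_le' s t x
    have h2 := norm_sub_norm_le x (hv.flow s t x)
    rw [norm_sub_rev] at h2
    linarith)
  have hkcs : HasCompactSupport k := hsupp hkR
  set V : Space N → Space N := fun x => ∫ τ in s..t, v τ x with hV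
  have hVl : ∀ x, ‖V x‖ ≤ l := fun x =>
    (hv.norm_integral_le (fun _ => x) s t).trans (abs_of_nonneg hl0).le
  set L := ContinuousLinearMap.lsmul ℝ ℝ (E := ℝ) with hLdef
  set h : Space N → ℝ := η ⋆[L, volume] g with hh
  set q : Space N → ℝ := η ⋆[L, volume] k with hq
  have hhx : ∀ x, h x = ∫ w, η w * g (x - w) := fun x => rfl
  have hqx : ∀ x, q x = ∫ w, η w * k (x - w) := fun x => rfl
  have hint : ∀ {k : Space N → ℝ}, Continuous k → Integrable fun w => η w * k w := by
    intro k hk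
    exact (hηs.continuous.mul hk).integrable_of_hasCompactSupport hηc.mul_right
  have hhs : ContDiff ℝ ∞ h := hηc.contDiff_convolution_left L hηs hgc.locallyIntegrable
  have hhc : HasCompactSupport h := hηc.convolution L hgcs
  have hqc : HasCompactSupport q := hηc.convolution L hkcs
  have hqcont : Continuous q :=
    (hηc.contDiff_convolution_left (n := (⊤ : ℕ∞)) L hηs hkc.locallyIntegrable).continuous
  have hh0 : ∀ x, 0 ≤ h x := fun x => integral_nonneg fun w => mul_nonneg (hη0 w) (hg0 _)
  have hhint : ∫ x, h x = ∫ x, g x := by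
    rw [hh, integral_convolution L hηi (hgc.integrable_of_hasCompactSupport hgcs), hη1]
    simp [hLdef]
  have hqint : ∫ x, q x = ∫ x, k x := by
    rw [hq, integral_convolution L hηi (hkc.integrable_of_hasCompactSupport hkcs), hη1]
    simp [hLdef]
  have hDη : Continuous (fderiv ℝ η) := hηs.continuous_fderiv (by simp)
  have hDηc : HasCompactSupport (fderiv ℝ η) := hηc.fderiv ℝ
  -- the derivative of the mollification, in the form in which the derivative falls on the kernel
  have hder : ∀ x, HasFDerivAt h (fderiv ℝ h x) x := fun x =>
    (hhs.differentiable (by simp) x).hasFDerivAt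
  have hDh : ∀ x y, fderiv ℝ h x y = ∫ w, fderiv ℝ η w y * g (x - w) := by
    intro x y
    have h1 := hηc.hasFDerivAt_convolution_left L (hηs.of_le (by simp)) hgc.locallyIntegrable x
      (μ := volume)
    have hex : ConvolutionExists (fderiv ℝ η) g (L.precompL (Space N)) volume :=
      hDηc.convolutionExists_left _ hDη hgc.locallyIntegrable
    rw [h1.fderiv, convolution_def, ContinuousLinearMap.integral_apply (hex x)]
    rfl
  have hDint : ∀ x y, Integrable fun w => fderiv ℝ η w y * g (x - w) := by
    intro x y
    refine Continuous.integrable_of_hasCompactSupport (by fun_prop) ?_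
    exact (hDηc.comp_left (g := fun B : Space N →L[ℝ] ℝ => B y) rfl).mul_right
  set C := ∫ w, ‖fderiv ℝ η w‖ with hC
  have hC0 : 0 ≤ C := integral_nonneg fun w => norm_nonneg _
  have hDLip : ∀ x x', ‖fderiv ℝ h x - fderiv ℝ h x'‖ ≤ K * C * ‖x - x'‖ := by
    intro x x'
    refine ContinuousLinearMap.opNorm_le_bound _ (by positivity) fun y => ?_
    rw [sub_apply, hDh, hDh, ← integral_sub (hDint x y) (hDint x' y)]
    have : K * C * ‖x - x'‖ * ‖y‖ = ∫ w, ‖fderiv ℝ η w‖ * (K * ‖x - x'‖ * ‖y‖) := by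
      rw [integral_mul_const]; ring
    rw [this]
    refine norm_integral_le_of_norm_le
      ((hDη.norm.integrable_of_hasCompactSupport hDηc.norm).mul_const _)
      (Filter.Eventually.of_forall fun w => ?_)
    rw [← mul_sub, norm_mul]
    have h1 := hK (x - w) (x' - w)
    rw [sub_sub_sub_cancel_right] at h1
    calc _ ≤ (‖fderiv ℝ η w‖ * ‖y‖) * (K * ‖x - x'‖) :=
          mul_le_mul (ContinuousLinearMap.le_opNorm _ _) h1 (abs_nonneg _) (by positivity)
      _ = _ := by ring
  -- second-order expansion along the displacement, as `fderiv ℝ h` is Lipschitz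
  have hTaylor : ∀ x, h (x + V x) ≤ h x + fderiv ℝ h x (V x) + K * C * l ^ 2 := by
    intro x
    have h1 := Convex.norm_image_sub_le_of_norm_hasFDerivWithin_le' (f := h) (C := K * C * l)
      (s := Metric.closedBall x l) (φ := fderiv ℝ h x) (x := x) (y := x + V x)
      (fun z _ => (hder z).hasFDerivWithinAt) (fun z hz => ?_) (convex_closedBall x l)
      (Metric.mem_closedBall_self hl0) (by simpa using hVl x)
    · rw [add_sub_cancel_left] at h1
      have h2 := (le_abs_self _).trans h1
      have h3 : K * C * l * ‖V x‖ ≤ K * C * l * l :=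
        mul_le_mul_of_nonneg_left (hVl x) (by positivity)
      nlinarith
    · refine (hDLip z x).trans (mul_le_mul_of_nonneg_left ?_ (by positivity))
      rwa [← dist_eq_norm]
  -- mollification commutes with the step up to a small error
  have hcomm : ∀ x, q x ≤ h (x + V x) + K * (l * (b.rOut + l)) := by
    intro x
    have h1 : ∫ w, η w * (K * (l * (b.rOut + l))) = K * (l * (b.rOut + l)) := by
      rw [integral_mul_const, hη1, one_mul]
    rw [hqx, hhx, ← h1, ← integral_add (hint (by fun_prop)) (hηi.mul_const _)]
    refine integral_mono (hint (by fun_prop)) ((hint (by fun_prop)).add (hηi.mul_const _))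
      fun w => ?_
    simp only
    rw [← mul_add]
    by_cases hw : ‖w‖ ≤ b.rOut
    · refine mul_le_mul_of_nonneg_left ?_ (hη0 w)
      have h2 := (le_abs_self _).trans (hK (hv.flow s t (x - w)) (x + V x - w))
      have h3 := hv.norm_flow_sub_displacement_le hst x w
      rw [show x - w + ∫ τ in s..t, v τ x = x + V x - w by simp only [hV]; abel] at h3
      have h4 : K * ‖hv.flow s t (x - w) - (x + V x - w)‖ ≤ K * (l * (b.rOut + l)) := by
        refine mul_le_mul_of_nonneg_left (h3.trans ?_) hK0
        exact mul_le_mul_of_nonneg_left (by linarith) hl0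
      simp only [hk]
      linarith
    · rw [hηr w (not_le.1 hw), zero_mul, zero_mul]
  set B := Metric.closedBall (0 : Space N) (R + A + 1) with hB
  have hpt : ∀ x, q x ≤ (h x + fderiv ℝ h x (V x)) +
      B.indicator (fun _ => K * b.rOut * l + (K + K * C) * l ^ 2) x := by
    intro x
    by_cases hx : x ∈ B
    · rw [indicator_of_mem hx]
      have h1 := hcomm x
      have h2 := hTaylor x
      nlinarith
    · have hx' : R + A + 1 < ‖x‖ := by
        rw [hB, Metric.mem_closedBall, dist_zero_right] at hx
        exact not_le.1 hx
      have hsub : ∀ w : Space N, ‖w‖ ≤ b.rOut → R + A < ‖x - w‖ := fun w hw => by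
        have := norm_sub_norm_le x w
        linarith
      have hq0 : q x = 0 := by
        rw [hqx]
        refine integral_eq_zero_of_ae (Filter.Eventually.of_forall fun w => ?_)
        by_cases hw : ‖w‖ ≤ b.rOut
        · simp [hkR _ (hsub w hw)]
        · simp [hηr w (not_le.1 hw)]
      have hD0 : fderiv ℝ h x (V x) = 0 := by
        rw [hDh]
        refine integral_eq_zero_of_ae (Filter.Eventually.of_forall fun w => ?_)
        by_cases hw : ‖w‖ ≤ b.rOut
        · have hA0 : 0 ≤ A := hl0.trans hlA
          simp [hR (x - w) (by linarith [hsub w hw])]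
        · simp [hDηr w (not_le.1 hw)]
      rw [hq0, hD0, indicator_of_notMem hx]
      simpa using hh0 x
  have hVc : Continuous V := hv.continuous_displacement s t
  have hDhc : Continuous (fderiv ℝ h) := hhs.continuous_fderiv (by simp)
  have hDV : Integrable fun x => fderiv ℝ h x (V x) := by
    refine Continuous.integrable_of_hasCompactSupport (by fun_prop) ?_
    refine (hhc.fderiv ℝ).mono fun x hx => ?_
    intro h0
    exact hx (by simp [h0])
  have hhi : Integrable h := hhs.continuous.integrable_of_hasCompactSupport hhc
  have hBi : Integrable (B.indicator (fun _ : Space N => K * b.rOut * l + (K + K * C) * l ^ 2)) :=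
    (integrable_indicator_iff measurableSet_closedBall).2
      (integrableOn_const (isCompact_closedBall _ _).measure_lt_top.ne)
  have hfin := integral_mono (hqcont.integrable_of_hasCompactSupport hqc)
    ((hhi.add hDV).add hBi) hpt
  rw [integral_add' (hhi.add hDV) hBi, integral_add' hhi hDV, hqint, hhint,
    integral_indicator measurableSet_closedBall, setIntegral_const, smul_eq_mul] at hfin
  have hdivh := hv.integral_fderiv_displacement_le hdiv hst hhs hhc hh0
  rw [hhint] at hdivh
  have hg' : 0 ≤ ∫ x, g x := integral_nonneg hg0
  have hexp : (1 + l) * ∫ x, g x ≤ Real.exp l * ∫ x, g x :=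
    mul_le_mul_of_nonneg_right (by linarith [Real.add_one_le_exp l]) hg'
  calc ∫ x, k x ≤ (∫ x, g x) + (∫ x, fderiv ℝ h x (V x)) +
        volume.real B * (K * b.rOut * l + (K + K * C) * l ^ 2) := hfin
    _ ≤ (1 + l) * (∫ x, g x) + volume.real B * (K * b.rOut * l + (K + K * C) * l ^ 2) := by
        linarith
    _ ≤ Real.exp l * (∫ x, g x) + volume.real B * (K * b.rOut * l + (K + K * C) * l ^ 2) := by
        linarith
    _ = _ := by ring

end ContinuityEq

/-! ### Plateau functions and the Liouville estimate -/

namespace ContinuityEq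

open scoped ContDiff Convolution

section Plateau

/-- Lipschitz functions with values in `[0, 1]`, vanishing outside `U`, that increase to the indicator
function of `U` as `n → ∞` when `U` is open and not the whole space. For `U = univ` they are zero, as
`infDist x ∅ = 0`. -/
noncomputable def plateau {X : Type*} [PseudoMetricSpace X] (U : Set X) (n : ℕ) (x : X) : ℝ :=
  min 1 (n * Metric.infDist x Uᶜ)

variable {X : Type*} [PseudoMetricSpace X] {U : Set X}

theorem plateau_nonneg (U : Set X) (n : ℕ) (x : X) : 0 ≤ plateau U n x :=
  le_min zero_le_one (mul_nonneg n.cast_nonneg Metric.infDist_nonneg)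

theorem plateau_le_one (U : Set X) (n : ℕ) (x : X) : plateau U n x ≤ 1 := min_le_left _ _

theorem plateau_of_notMem {x : X} (hx : x ∉ U) (n : ℕ) : plateau U n x = 0 := by
  simp [plateau, Metric.infDist_zero_of_mem (show x ∈ Uᶜ from hx)]

theorem plateau_le_indicator (U : Set X) (n : ℕ) (x : X) :
    plateau U n x ≤ U.indicator (fun _ => 1) x := by
  by_cases hx : x ∈ U
  · simpa [hx] using plateau_le_one U n x
  · simp [hx, plateau_of_notMem hx]

theorem abs_plateau_sub_le (U : Set X) (n : ℕ) (x y : X) :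
    |plateau U n x - plateau U n y| ≤ n * dist x y := by
  refine (abs_min_sub_min_le_max _ _ _ _).trans ?_
  rw [sub_self, abs_zero, max_eq_right (abs_nonneg _), ← mul_sub, abs_mul, Nat.abs_cast]
  refine mul_le_mul_of_nonneg_left ?_ n.cast_nonneg
  have := (Metric.lipschitz_infDist_pt Uᶜ).dist_le_mul x y
  simpa [Real.dist_eq] using this

theorem continuous_plateau (U : Set X) (n : ℕ) : Continuous (plateau U n) :=
  continuous_const.min (continuous_const.mul (Metric.continuous_infDist_pt _))

theorem tendsto_plateau (hU : IsOpen U) (hne : Uᶜ.Nonempty) (x : X) :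
    Filter.Tendsto (fun n => plateau U n x) Filter.atTop (nhds (U.indicator (fun _ => 1) x)) := by
  by_cases hx : x ∈ U
  · rw [indicator_of_mem hx]
    have hpos : 0 < Metric.infDist x Uᶜ :=
      (hU.isClosed_compl.notMem_iff_infDist_pos hne).1 (by simpa using hx)
    refine tendsto_const_nhds.congr' ?_
    have h1 : Filter.Tendsto (fun n : ℕ => (n : ℝ) * Metric.infDist x Uᶜ) Filter.atTop
        Filter.atTop := tendsto_natCast_atTop_atTop.atTop_mul_const hpos
    filter_upwards [h1.eventually_ge_atTop 1] with n hn
    exact (min_eq_left hn).symm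
  · rw [indicator_of_notMem hx]
    simp_rw [plateau_of_notMem hx]
    exact tendsto_const_nhds

end Plateau

variable {N : ℕ} {v : ℝ → Space N → Space N} {m : ℝ → ℝ}

/-- The integrated Liouville estimate: the flow compresses volume at most by `exp (∫ m)`. -/
theorem IsLipschitzField.integral_comp_flow_le (hv : IsLipschitzField v m)
    (hdiv : ∀ t (φ : Space N → ℝ), ContDiff ℝ ∞ φ → HasCompactSupport φ → (∀ x, 0 ≤ φ x) →
      |∫ x, fderiv ℝ φ x (v t x)| ≤ m t * ∫ x, φ x)
    {g : Space N → ℝ} {K R : ℝ} (hK : ∀ x y, |g x - g y| ≤ K * ‖x - y‖) (hK0 : 0 ≤ K)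
    (hg0 : ∀ x, 0 ≤ g x) (hR : ∀ x, R < ‖x‖ → g x = 0) {s t : ℝ} (hst : s ≤ t) :
    ∫ x, g (hv.flow s t x) ≤ Real.exp (∫ τ in s..t, m τ) * ∫ x, g x := by
  set A := ∫ τ, m τ with hA
  set K' := K * Real.exp A with hK'
  set W := volume.real (Metric.closedBall (0 : Space N) (R + A + A + 1)) with hW
  have hK'0 : 0 ≤ K' := by positivity
  have hW0 : 0 ≤ W := measureReal_nonneg
  -- the subdivision is refined at a fixed mollification radius `ε`, which goes to zero afterwards
  have key : ∀ ε ∈ Ioc (0 : ℝ) 1, ∫ x, g (hv.flow s t x) ≤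
      Real.exp (∫ τ in s..t, m τ) * ((∫ x, g x) + W * (K' * ε) * ∫ τ in s..t, m τ) := by
    intro ε hε
    let b : ContDiffBump (0 : Space N) := ⟨ε / 2, ε, half_pos hε.1, half_lt_self hε.1⟩
    have hL0 : 0 ≤ ∫ w, ‖fderiv ℝ (b.normed volume) w‖ := integral_nonneg fun _ => norm_nonneg _
    have h := le_exp_mul_of_forall_le (I := fun r => ∫ x, g (hv.flow r t x)) hv.integrable
      hv.nonneg hst (a := W * (K' * ε)) (b := W * (K' + K' * ∫ w, ‖fderiv ℝ (b.normed volume) w‖))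
      (mul_nonneg hW0 (mul_nonneg hK'0 hε.1.le)) (by positivity) fun r r' _ hrr' hr't => by
        have hstep := hv.integral_comp_flow_le_step hdiv (g := fun x => g (hv.flow r' t x))
          (K := K') (R := R + A) (fun x y => (hK _ _).trans ?_) hK'0 (fun x => hg0 _)
          (fun x hx => hR _ ?_) b hε.2 hrr'
        · simpa only [hv.flow_flow hrr' hr't] using hstep
        · rw [hK', mul_assoc]
          exact mul_le_mul_of_nonneg_left (hv.norm_flow_sub_le r' t x y) hK0
        · have h1 := hv.norm_flow_sub_self_le' r' t x
          have h2 := norm_sub_norm_le x (hv.flow r' t x)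
          rw [norm_sub_rev] at h2
          linarith
    simpa only [hv.flow_of_le le_rfl] using h
  have hlim : Filter.Tendsto (fun ε : ℝ => Real.exp (∫ τ in s..t, m τ) *
      ((∫ x, g x) + W * (K' * ε) * ∫ τ in s..t, m τ)) (nhdsWithin 0 (Ioi 0))
      (nhds (Real.exp (∫ τ in s..t, m τ) * ∫ x, g x)) := by
    have : Continuous fun ε : ℝ => Real.exp (∫ τ in s..t, m τ) *
      ((∫ x, g x) + W * (K' * ε) * ∫ τ in s..t, m τ) := by fun_prop
    simpa using (this.tendsto 0).mono_left nhdsWithin_le_nhds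
  refine ge_of_tendsto hlim ?_
  filter_upwards [Ioc_mem_nhdsGT (zero_lt_one (α := ℝ))] with ε hε using key ε hε

theorem nonempty_compl_of_subset_ball (hN : 0 < N) {U : Set (Space N)} {R : ℝ}
    (hU : U ⊆ Metric.ball 0 R) : Uᶜ.Nonempty := by
  have : Nonempty (Fin N) := ⟨⟨0, hN⟩⟩
  obtain ⟨x, hx⟩ := NormedSpace.exists_lt_norm ℝ (Space N) R
  exact ⟨x, fun h => absurd (hU h) (by simpa using hx.le)⟩

/-- The flow map pushes Lebesgue measure to at most `exp (∫ m)` times Lebesgue measure. -/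
theorem IsLipschitzField.map_flow_le (hv : IsLipschitzField v m) (hN : 0 < N)
    (hdiv : ∀ t (φ : Space N → ℝ), ContDiff ℝ ∞ φ → HasCompactSupport φ → (∀ x, 0 ≤ φ x) →
      |∫ x, fderiv ℝ φ x (v t x)| ≤ m t * ∫ x, φ x)
    {s t : ℝ} (hst : s ≤ t) :
    (volume : Measure (Space N)).map (hv.flow s t) ≤
      ENNReal.ofReal (Real.exp (∫ τ in s..t, m τ)) • volume := by
  set C := Real.exp (∫ τ in s..t, m τ) with hC
  set F := hv.flow s t with hF
  have hFc : Continuous F := hv.continuous_flow_space s t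
  have hopen : ∀ U : Set (Space N), IsOpen U → volume (F ⁻¹' U) ≤ ENNReal.ofReal C * volume U := by
    intro U hU
    set O : ℕ → Set (Space N) := fun n => U ∩ Metric.ball 0 n with hO
    have hOU : U = ⋃ n, O n := by
      rw [hO, ← inter_iUnion, Metric.iUnion_ball_nat, inter_univ]
    have hmono : Monotone O := fun i j hij =>
      inter_subset_inter_right _ (Metric.ball_subset_ball (by exact_mod_cast hij))
    have hball : ∀ n, volume (F ⁻¹' (O n)) ≤ ENNReal.ofReal C * volume U := by
      intro n
      have hOo : IsOpen (O n) := hU.inter Metric.isOpen_ball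
      have hne : (O n)ᶜ.Nonempty := nonempty_compl_of_subset_ball hN inter_subset_right
      have hzero : ∀ k x, (n : ℝ) < ‖x‖ → plateau (O n) k x = 0 := fun k x hx =>
        plateau_of_notMem (fun h => absurd h.2 (by simpa using hx.le)) k
      have hcs : ∀ k, HasCompactSupport (plateau (O n) k) := fun k =>
        HasCompactSupport.of_support_subset_isCompact (isCompact_closedBall 0 (n : ℝ))
          fun x hx => by
            rw [Metric.mem_closedBall, dist_zero_right]
            by_contra h
            exact hx (hzero k x (not_le.1 h))
      have hpint : ∀ k, Integrable (plateau (O n) k) := fun k =>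
        (continuous_plateau _ k).integrable_of_hasCompactSupport (hcs k)
      have hqint : ∀ k, Integrable fun x => plateau (O n) k (F x) := fun k => by
        refine ((continuous_plateau _ k).comp hFc).integrable_of_hasCompactSupport
          (HasCompactSupport.of_support_subset_isCompact
            (isCompact_closedBall 0 (n + ∫ τ, m τ)) fun x hx => ?_)
        rw [Metric.mem_closedBall, dist_zero_right]
        by_contra h
        refine hx (hzero k _ ?_)
        have h1 := hv.norm_flow_sub_self_le' s t x
        have h2 := norm_sub_norm_le x (F x)
        rw [norm_sub_rev] at h2
        linarith
      have hk : ∀ k, ∫⁻ x, ENNReal.ofReal (plateau (O n) k (F x)) ≤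
          ENNReal.ofReal C * volume U := by
        intro k
        have h1 := hv.integral_comp_flow_le hdiv (g := plateau (O n) k) (K := k) (R := n)
          (fun x y => by simpa only [dist_eq_norm] using abs_plateau_sub_le (O n) k x y)
          k.cast_nonneg (plateau_nonneg _ k) (hzero k) hst
        rw [← ofReal_integral_eq_lintegral_ofReal (hqint k)
          (Filter.Eventually.of_forall fun x => plateau_nonneg _ k _)]
        refine (ENNReal.ofReal_le_ofReal h1).trans ?_
        rw [ENNReal.ofReal_mul (Real.exp_pos _).le, ofReal_integral_eq_lintegral_ofReal (hpint k)
          (Filter.Eventually.of_forall fun x => plateau_nonneg _ k _)]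
        refine mul_le_mul_right ?_ _
        calc ∫⁻ x, ENNReal.ofReal (plateau (O n) k x) ≤ ∫⁻ x, (O n).indicator (fun _ => 1) x := by
              refine lintegral_mono fun x => ?_
              by_cases hx : x ∈ O n
              · simpa [hx] using plateau_le_one (O n) k x
              · simp [hx, plateau_of_notMem hx]
          _ = volume (O n) := by
              rw [lintegral_indicator hOo.measurableSet, setLIntegral_one]
          _ ≤ volume U := measure_mono inter_subset_left
      have hlim : ∀ x, Filter.liminf (fun k => ENNReal.ofReal (plateau (O n) k (F x)))
          Filter.atTop = (F ⁻¹' (O n)).indicator (fun _ => 1) x := by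
        intro x
        have h1 := (ENNReal.continuous_ofReal.tendsto _).comp (tendsto_plateau hOo hne (F x))
        refine h1.liminf_eq.trans ?_
        by_cases hx : F x ∈ O n
        · simp [hx]
        · simp [hx]
      calc volume (F ⁻¹' (O n))
          = ∫⁻ x, Filter.liminf (fun k => ENNReal.ofReal (plateau (O n) k (F x)))
              Filter.atTop := by
            simp_rw [hlim]
            rw [lintegral_indicator (hOo.preimage hFc).measurableSet, setLIntegral_one]
        _ ≤ Filter.liminf (fun k => ∫⁻ x, ENNReal.ofReal (plateau (O n) k (F x)))
              Filter.atTop := lintegral_liminf_le fun k =>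
                (ENNReal.measurable_ofReal.comp
                  ((continuous_plateau _ k).comp hFc).measurable)
        _ ≤ ENNReal.ofReal C * volume U :=
            Filter.liminf_le_of_frequently_le' (Filter.Eventually.of_forall hk).frequently
    rw [hOU, preimage_iUnion, (monotone_iff_forall_lt.2 fun i j hij =>
      preimage_mono (hmono hij.le)).measure_iUnion, ← hOU]
    exact iSup_le hball
  -- open sets suffice, by outer regularity of Lebesgue measure
  refine Measure.le_iff.2 fun B hB => ?_
  rw [Measure.map_apply hFc.measurable hB, Measure.smul_apply, smul_eq_mul,
    Set.measure_eq_iInf_isOpen B, ENNReal.mul_iInf_of_ne (by simp [hC, Real.exp_pos]) ENNReal.ofReal_ne_top]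
  refine le_iInf fun U => ?_
  rw [ENNReal.mul_iInf_of_ne (by simp [hC, Real.exp_pos]) ENNReal.ofReal_ne_top]
  refine le_iInf fun hBU => ?_
  rw [ENNReal.mul_iInf_of_ne (by simp [hC, Real.exp_pos]) ENNReal.ofReal_ne_top]
  exact le_iInf fun hU => (measure_mono (preimage_mono hBU)).trans (hopen U hU)

end ContinuityEq

/-! ### The transported density -/

namespace ContinuityEq

open scoped ContDiff
open ProbabilityTheory (Kernel IsFiniteKernel)

theorem map_withDensity_comp {α β : Type*} [MeasurableSpace α] [MeasurableSpace β] {μ : Measure α}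
    {F : α → β} (hF : Measurable F) {r : β → ℝ≥0∞} (hr : Measurable r) :
    (μ.withDensity fun x => r (F x)).map F = (μ.map F).withDensity r := by
  ext s hs
  rw [Measure.map_apply hF hs, withDensity_apply _ (hF hs), withDensity_apply _ hs,
    setLIntegral_map hs hr hF]

/-- Multiplication by a density bounded by `C` loses at most the factor `C ^ (1 - 1/p)` in `L^p`,
compared with the norm for the weighted measure. -/
theorem eLpNorm_mul_toReal_le {α : Type*} [MeasurableSpace α] {μ : Measure α} {r : α → ℝ}
    {w : α → ℝ≥0∞} (hr : Measurable r) (hw : Measurable w) {C : ℝ≥0∞} (hC : C ≠ ⊤)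
    (hwC : ∀ᵐ x ∂μ, w x ≤ C) {p : ℝ≥0∞} (hp : 1 ≤ p) :
    eLpNorm (fun x => r x * (w x).toReal) p μ ≤
      C ^ (1 - p⁻¹).toReal * eLpNorm r p (μ.withDensity w) := by
  have hnorm : ∀ᵐ x ∂μ, ‖r x * (w x).toReal‖ₑ = ‖r x‖ₑ * w x := by
    filter_upwards [hwC] with x hx
    have hx' : w x ≠ ⊤ := ne_top_of_le_ne_top hC hx
    rw [enorm_mul, Real.enorm_of_nonneg ENNReal.toReal_nonneg, ENNReal.ofReal_toReal hx']
  rcases eq_or_ne p ⊤ with rfl | hpt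
  · have h1 : (1 - (⊤ : ℝ≥0∞)⁻¹).toReal = 1 := by simp
    rw [h1, ENNReal.rpow_one, eLpNorm_exponent_top, eLpNorm_exponent_top]
    refine essSup_le_of_ae_le _ ?_
    have h2 := (ae_withDensity_iff hw).1
      (ae_le_eLpNormEssSup (f := r) (μ := μ.withDensity w))
    filter_upwards [hnorm, h2, hwC] with x hx1 hx2 hx3
    rw [hx1, mul_comm]
    by_cases hx0 : w x = 0
    · simp [hx0]
    · exact mul_le_mul' hx3 (hx2 hx0)
  · have hp0 : p ≠ 0 := (zero_lt_one.trans_le hp).ne'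
    have hq1 : 1 ≤ p.toReal := by
      rw [← ENNReal.toReal_one]; exact ENNReal.toReal_mono hpt hp
    have hq0 : 0 < p.toReal := by linarith
    rw [eLpNorm_eq_lintegral_rpow_enorm_toReal hp0 hpt,
      eLpNorm_eq_lintegral_rpow_enorm_toReal hp0 hpt]
    have hexp : (1 - p⁻¹).toReal = (p.toReal - 1) * (1 / p.toReal) := by
      rw [ENNReal.toReal_sub_of_le (ENNReal.inv_le_one.2 hp) ENNReal.one_ne_top,
        ENNReal.toReal_inv, ENNReal.toReal_one]
      field_simp
    rw [hexp, ENNReal.rpow_mul, ← ENNReal.mul_rpow_of_nonneg _ _ (by positivity)]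
    refine ENNReal.rpow_le_rpow ?_ (by positivity)
    rw [lintegral_withDensity_eq_lintegral_mul _ hw (by fun_prop),
      ← lintegral_const_mul _ (by fun_prop)]
    refine lintegral_mono_ae ?_
    filter_upwards [hnorm, hwC] with x hx1 hx3
    rw [hx1, ENNReal.mul_rpow_of_nonneg _ _ hq0.le, Pi.mul_apply, ← mul_assoc, mul_comm]
    refine mul_le_mul_left ?_ _
    by_cases hx0 : w x = 0
    · simp [hx0, hq0]
    · calc w x ^ p.toReal = w x ^ (p.toReal - 1) * w x ^ (1 : ℝ) := by
            rw [← ENNReal.rpow_add _ _ hx0 (ne_top_of_le_ne_top hC hx3), sub_add_cancel]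
        _ ≤ C ^ (p.toReal - 1) * w x := by
            rw [ENNReal.rpow_one]
            exact mul_le_mul_left (ENNReal.rpow_le_rpow hx3 (by linarith)) _

theorem measurable_map_measure {α β γ : Type*} [MeasurableSpace α] [MeasurableSpace β]
    [MeasurableSpace γ] (μ : Measure β) [SFinite μ] {F : α → β → γ}
    (hF : Measurable fun z : α × β => F z.1 z.2) : Measurable fun a => μ.map (F a) := by
  refine Measure.measurable_of_measurable_coe _ fun s hs => ?_
  have h : ∀ a, μ.map (F a) s = μ (Prod.mk a ⁻¹' ((fun z : α × β => F z.1 z.2) ⁻¹' s)) := fun a => by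
    have hFa : Measurable (F a) := hF.comp measurable_prodMk_left
    rw [Measure.map_apply hFa hs]
    rfl
  simp_rw [h]
  exact measurable_measure_prodMk_left (hF hs)

variable {N : ℕ} {v : ℝ → Space N → Space N} {m : ℝ → ℝ}

theorem IsLipschitzField.measurable_flow (hv : IsLipschitzField v m) (s : ℝ) :
    Measurable fun z : ℝ × Space N => hv.flow s z.1 z.2 :=
  (hv.continuous_flow.comp (continuous_const.prodMk continuous_id)).measurable

/-- A jointly measurable inverse of the flow, left inverse on each time slice. -/
theorem IsLipschitzField.exists_measurable_leftInverse (hv : IsLipschitzField v m) (s : ℝ) :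
    ∃ Y : ℝ × Space N → Space N, Measurable Y ∧ ∀ t x, Y (t, hv.flow s t x) = x := by
  set G : ℝ × Space N → ℝ × Space N := fun z => (z.1, hv.flow s z.1 z.2) with hG
  have hGc : Continuous G :=
    continuous_fst.prodMk (hv.continuous_flow.comp (continuous_const.prodMk continuous_id))
  have hGi : Function.Injective G := by
    rintro ⟨t, x⟩ ⟨t', x'⟩ h
    obtain ⟨rfl, h2⟩ := Prod.mk.inj h
    exact Prod.ext rfl (hv.flow_injective s t h2)
  obtain ⟨Y, hY, hYG⟩ := (hGc.measurableEmbedding hGi).exists_measurable_extend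
    (measurable_snd : Measurable (Prod.snd : ℝ × Space N → Space N)) fun _ => ⟨0⟩
  exact ⟨Y, hY, fun t x => congr_fun hYG (t, x)⟩

/-- A jointly measurable density of the images of Lebesgue measure under the flow. It is the
kernel Radon-Nikodym derivative with respect to an equivalent finite measure, rescaled. -/
theorem IsLipschitzField.exists_measurable_density (hv : IsLipschitzField v m) (s : ℝ)
    (hac : ∀ t, s ≤ t → (volume : Measure (Space N)).map (hv.flow s t) ≪ volume) :
    ∃ w : ℝ × Space N → ℝ≥0∞, Measurable w ∧
      ∀ t, s ≤ t → (volume : Measure (Space N)).map (hv.flow s t) =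
        volume.withDensity fun y => w (t, y) := by
  obtain ⟨Y, hY, hYX⟩ := hv.exists_measurable_leftInverse s
  -- `γ = g dx` is a finite measure equivalent to Lebesgue measure, with `g > 0`
  obtain ⟨g, hg0, hgm, hg1⟩ :=
    exists_pos_lintegral_lt_of_sigmaFinite (volume : Measure (Space N)) one_ne_zero
  set γ : Measure (Space N) := volume.withDensity fun x => (g x : ℝ≥0∞) with hγ
  have hgm' : Measurable fun x => (g x : ℝ≥0∞) := hgm.coe_nnreal_ennreal
  have : IsFiniteMeasure γ := isFiniteMeasure_withDensity (hg1.trans ENNReal.one_lt_top).ne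
  have hXm := fun t => (hv.continuous_flow_space s t).measurable
  let κ : Kernel ℝ (Space N) := ⟨fun t => γ.map (hv.flow s t),
    measurable_map_measure γ (hv.measurable_flow s)⟩
  have hκa : ∀ t, κ t = γ.map (hv.flow s t) := fun t => rfl
  have : IsFiniteKernel κ := ⟨⟨γ univ, measure_lt_top _ _, fun t => by
    rw [hκa, Measure.map_apply (hXm t) MeasurableSet.univ, preimage_univ]⟩⟩
  let η : Kernel ℝ (Space N) := Kernel.const ℝ γ
  have hγvol : γ ≪ volume := withDensity_absolutelyContinuous _ _
  have hvolγ : volume ≪ γ :=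
    withDensity_absolutelyContinuous' hgm'.aemeasurable
      (Filter.Eventually.of_forall fun x => by simpa using (hg0 x).ne')
  refine ⟨fun z => (g (Y z) : ℝ≥0∞)⁻¹ * ((g z.2 : ℝ≥0∞) * κ.rnDeriv η z.1 z.2), ?_, fun t ht => ?_⟩
  · exact (hgm'.comp hY).inv.mul ((hgm'.comp measurable_snd).mul (Kernel.measurable_rnDeriv κ η))
  · have hκη : κ t ≪ η t := by
      rw [hκa, Kernel.const_apply]
      exact (hγvol.map (hXm t)).trans ((hac t ht).trans hvolγ)
    have h1 : γ.map (hv.flow s t) =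
        volume.withDensity fun y => (g y : ℝ≥0∞) * κ.rnDeriv η t y := by
      rw [← hκa, ← Kernel.withDensity_rnDeriv_eq hκη,
        Kernel.withDensity_apply _ (Kernel.measurable_rnDeriv κ η), Kernel.const_apply, hγ,
        ← withDensity_mul _ hgm' (Kernel.measurable_rnDeriv_right κ η t)]
      rfl
    have hYt : Measurable fun y => (g (Y (t, y)) : ℝ≥0∞)⁻¹ :=
      (hgm'.comp (hY.comp measurable_prodMk_left)).inv
    have h2 : (volume : Measure (Space N)) =
        γ.withDensity fun x => (g (Y (t, hv.flow s t x)) : ℝ≥0∞)⁻¹ := by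
      simp_rw [hYX]
      rw [hγ, withDensity_inv_same hgm' (Filter.Eventually.of_forall fun x => by
        simpa using (hg0 x).ne') (Filter.Eventually.of_forall fun x => by simp)]
    have h3 := map_withDensity_comp (μ := γ) (hXm t)
      (r := fun y => (g (Y (t, y)) : ℝ≥0∞)⁻¹) hYt
    have hgκ : Measurable fun y => (g y : ℝ≥0∞) * κ.rnDeriv η t y :=
      hgm'.mul (Kernel.measurable_rnDeriv_right κ η t)
    rw [← h2, h1, ← withDensity_mul _ hgκ hYt] at h3
    rw [h3]
    congr 1
    ext1 y
    exact mul_comm _ _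

/-- The density `ρ0 ∘ X⁻¹` times the density of the image of Lebesgue measure represents the image
of `ρ0 dx`. -/
theorem densityMeasure_mul_eq_map {X : Space N → Space N} (hX : Measurable X)
    {Y : Space N → Space N} (hY : Measurable Y) (hYX : ∀ x, Y (X x) = x)
    {w : Space N → ℝ≥0∞} (hw : Measurable w) (hwt : ∀ᵐ y, w y ≠ ⊤)
    (hmap : (volume : Measure (Space N)).map X = volume.withDensity w)
    {r : Space N → ℝ} (hr : Measurable r) (hr0 : ∀ x, 0 ≤ r x) :
    densityMeasure (fun y => r (Y y) * (w y).toReal) = (densityMeasure r).map X := by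
  have h1 : densityMeasure (fun y => r (Y y) * (w y).toReal) =
      volume.withDensity (w * fun y => ENNReal.ofReal (r (Y y))) := by
    refine withDensity_congr_ae ?_
    filter_upwards [hwt] with y hy
    rw [ENNReal.ofReal_mul (hr0 _), ENNReal.ofReal_toReal hy, Pi.mul_apply, mul_comm]
  have h2 : densityMeasure r = volume.withDensity fun x => ENNReal.ofReal (r (Y (X x))) := by
    simp_rw [hYX]
    rfl
  have hrY : Measurable fun y => ENNReal.ofReal (r (Y y)) := (hr.comp hY).ennreal_ofReal
  rw [h1, withDensity_mul _ hw hrY, ← hmap, h2,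
    map_withDensity_comp hX (r := fun y => ENNReal.ofReal (r (Y y))) hrY]

theorem eLpNorm_one_eq_densityMeasure {r : Space N → ℝ} (hr0 : ∀ᵐ x, 0 ≤ r x) :
    eLpNorm r 1 volume = densityMeasure r univ := by
  rw [eLpNorm_one_eq_lintegral_enorm, densityMeasure, withDensity_apply _ MeasurableSet.univ,
    setLIntegral_univ]
  refine lintegral_congr_ae ?_
  filter_upwards [hr0] with x hx
  exact Real.enorm_of_nonneg hx

/-- The transported density: jointly measurable, nonnegative, equal to the image of `ρ0 dx` under the
flow at every nonnegative time, and bounded in `L^p`. -/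
theorem IsLipschitzField.exists_transported_density (hv : IsLipschitzField v m) (hN : 0 < N)
    (hdiv : ∀ t (φ : Space N → ℝ), ContDiff ℝ ∞ φ → HasCompactSupport φ → (∀ x, 0 ≤ φ x) →
      |∫ x, fderiv ℝ φ x (v t x)| ≤ m t * ∫ x, φ x)
    {p : ℝ≥0∞} (hp : 1 ≤ p) {ρ0 : Space N → ℝ} (hρ0 : MemLp ρ0 p volume)
    (hpos : ∀ᵐ x, 0 ≤ ρ0 x) :
    ∃ ρ : ℝ → Space N → ℝ, Measurable (fun z : ℝ × Space N => ρ z.1 z.2) ∧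
      (∀ t x, 0 ≤ ρ t x) ∧
      (∀ t, 0 ≤ t → densityMeasure (ρ t) = (densityMeasure ρ0).map (hv.flow 0 t)) ∧
      ∀ t, 0 ≤ t → eLpNorm (ρ t) p volume ≤
        ENNReal.ofReal (Real.exp ((1 - p⁻¹).toReal * ∫ τ, m τ)) * eLpNorm ρ0 p volume := by
  have hle := fun t (ht : 0 ≤ t) => hv.map_flow_le hN hdiv ht
  have hac : ∀ t, 0 ≤ t → (volume : Measure (Space N)).map (hv.flow 0 t) ≪ volume := fun t ht =>
    (Measure.absolutelyContinuous_of_le (hle t ht)).trans Measure.smul_absolutelyContinuous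
  obtain ⟨Y, hY, hYX⟩ := hv.exists_measurable_leftInverse 0
  obtain ⟨w, hw, hmap⟩ := hv.exists_measurable_density 0 hac
  -- a measurable, everywhere nonnegative representative of the initial density
  set r : Space N → ℝ := fun x => max 0 (hρ0.aestronglyMeasurable.mk ρ0 x) with hr
  have hrm : Measurable r :=
    measurable_const.max hρ0.aestronglyMeasurable.stronglyMeasurable_mk.measurable
  have hr0 : ∀ x, 0 ≤ r x := fun x => le_max_left _ _
  have hrae : r =ᵐ[volume] ρ0 := by
    filter_upwards [hρ0.aestronglyMeasurable.ae_eq_mk, hpos] with x h1 h2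
    exact (congrArg (max 0) h1.symm).trans (max_eq_right h2)
  have hdens : densityMeasure r = densityMeasure ρ0 :=
    withDensity_congr_ae (hrae.mono fun x hx => by simp only [hx])
  set C : ℝ≥0∞ := ENNReal.ofReal (Real.exp (∫ τ, m τ)) with hC
  have hwt : ∀ t, Measurable fun y => w (t, y) := fun t => hw.comp measurable_prodMk_left
  have hYt : ∀ t, Measurable fun y => Y (t, y) := fun t => hY.comp measurable_prodMk_left
  have hXm := fun t => (hv.continuous_flow_space 0 t).measurable
  have hwC : ∀ t, 0 ≤ t → ∀ᵐ y, w (t, y) ≤ C := by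
    intro t ht
    refine ae_le_of_forall_setLIntegral_le_of_sigmaFinite (hwt t) fun s hs _ => ?_
    rw [← withDensity_apply _ hs, ← hmap t ht, setLIntegral_const]
    refine (hle t ht s).trans ?_
    rw [Measure.smul_apply, smul_eq_mul]
    exact mul_le_mul_left (ENNReal.ofReal_le_ofReal (hv.exp_integral_le 0 t)) _
  refine ⟨fun t y => r (Y (t, y)) * (w (t, y)).toReal, (hrm.comp hY).mul hw.ennreal_toReal,
    fun t x => mul_nonneg (hr0 _) ENNReal.toReal_nonneg, fun t ht => ?_, fun t ht => ?_⟩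
  · rw [← hdens]
    exact densityMeasure_mul_eq_map (hXm t) (hYt t) (hYX t) (hwt t)
      ((hwC t ht).mono fun y hy => ne_top_of_le_ne_top ENNReal.ofReal_ne_top hy)
      (hmap t ht) hrm hr0
  · refine (eLpNorm_mul_toReal_le (hrm.comp (hYt t)) (hwt t) ENNReal.ofReal_ne_top
      (hwC t ht) hp).trans ?_
    rw [← hmap t ht, eLpNorm_map_measure
      (hrm.comp (hYt t)).aestronglyMeasurable (hXm t).aemeasurable]
    refine mul_le_mul' (le_of_eq ?_) (le_of_eq ?_)
    · rw [ENNReal.ofReal_rpow_of_pos (Real.exp_pos _), ← Real.exp_mul, mul_comm]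
    · refine eLpNorm_congr_ae (Filter.EventuallyEq.trans (Filter.Eventually.of_forall fun x => ?_)
        hrae)
      simp [hYX]

end ContinuityEq

/-! ### The transported density is a weak solution -/

namespace ContinuityEq

variable {N : ℕ} {v : ℝ → Space N → Space N} {m : ℝ → ℝ}

theorem mem_timeSet_of_le {T : EReal} {s t : ℝ} (ht : t ∈ timeSet T) (hs : 0 ≤ s) (hst : s ≤ t) :
    s ∈ timeSet T :=
  ⟨hs, (EReal.coe_le_coe_iff.2 hst).trans_lt ht.2⟩

theorem Icc_subset_timeSet {T : EReal} {b : ℝ} (hb : b ∈ timeSet T) : Icc 0 b ⊆ timeSet T :=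
  fun _ ht => mem_timeSet_of_le hb ht.1 ht.2

theorem ae_eq_of_mem_timeSet {T : EReal} {u : ℝ → Space N → Space N}
    (hvu : ∀ᵐ t ∂(volume.restrict (timeSet T)), v t = u t) :
    ∀ᵐ t, t ∈ timeSet T → v t = u t :=
  (ae_restrict_iff' (measurableSet_timeSet T)).1 hvu

theorem IsLipschitzField.isFlow (hv : IsLipschitzField v m) {T : EReal} {u : ℝ → Space N → Space N}
    (hvu : ∀ᵐ t ∂(volume.restrict (timeSet T)), v t = u t) :
    IsFlow T u (fun t x => hv.flow 0 t x) := by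
  intro x t ht
  have hae : ∀ᵐ s, s ∈ uIoc 0 t → v s (hv.flow 0 s x) = u s (hv.flow 0 s x) := by
    filter_upwards [ae_eq_of_mem_timeSet hvu] with s hs hst
    rw [uIoc_of_le ht.1] at hst
    rw [hs (mem_timeSet_of_le ht hst.1.le hst.2)]
  constructor
  · refine ((hv.integrable_comp (hv.continuous_flow_time 0 x).measurable).intervalIntegrable
      (a := 0) (b := t)).congr_ae ?_
    exact (ae_restrict_iff' measurableSet_uIoc).2 hae
  · rw [← intervalIntegral.integral_congr_ae hae]
    exact hv.flow_eq ht.1 x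

theorem IsLipschitzField.eq_flow_of_isFlow (hv : IsLipschitzField v m) {T : EReal}
    {u Y : ℝ → Space N → Space N} (hvu : ∀ᵐ t ∂(volume.restrict (timeSet T)), v t = u t)
    (hY : IsFlow T u Y) {t : ℝ} (ht : t ∈ timeSet T) : Y t = hv.flow 0 t := by
  ext1 x
  -- a curve defined on the whole line that agrees with `Y` on `[0, t]`
  set w : ℝ → Space N := (Ioc 0 t).indicator fun s => u s (Y s x) with hw
  have hwi : Integrable w := by
    rw [hw, integrable_indicator_iff measurableSet_Ioc]
    exact (intervalIntegrable_iff_integrableOn_Ioc_of_le ht.1).1 (hY x t ht).1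
  set z : ℝ → Space N := fun τ => x + ∫ s in (0 : ℝ)..τ, w s with hz
  have hzc : Continuous z := continuous_const.add
    (intervalIntegral.continuous_primitive (fun _ _ => hwi.intervalIntegrable) 0)
  have hzY : ∀ τ ∈ Icc 0 t, z τ = Y τ x := by
    intro τ hτ
    rw [(hY x τ (mem_timeSet_of_le ht hτ.1 hτ.2)).2]
    simp only [hz]
    congr 1
    refine intervalIntegral.integral_congr_ae (Filter.Eventually.of_forall fun s hs => ?_)
    rw [uIoc_of_le hτ.1] at hs
    exact indicator_of_mem (show s ∈ Ioc 0 t from ⟨hs.1, hs.2.trans hτ.2⟩) _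
  rw [← hzY t (right_mem_Icc.2 ht.1)]
  refine hv.eq_flow ht.1 hzc fun τ hτ => ?_
  simp only [hz]
  congr 1
  refine intervalIntegral.integral_congr_ae ?_
  filter_upwards [ae_eq_of_mem_timeSet hvu] with s hs hsτ
  rw [uIoc_of_le hτ.1] at hsτ
  have hst : s ∈ Icc 0 t := ⟨hsτ.1.le, hsτ.2.trans hτ.2⟩
  rw [hs (mem_timeSet_of_le ht hst.1 hst.2)]
  change w s = u s (z s)
  rw [hzY s hst]
  exact indicator_of_mem (show s ∈ Ioc 0 t from ⟨hsτ.1, hst.2⟩) _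

theorem densityMeasure_closedBall_lt_top {p : ℝ≥0∞} (hp : 1 ≤ p) {ρ0 : Space N → ℝ}
    (hρ0 : MemLp ρ0 p volume) (R : ℝ) : densityMeasure ρ0 (Metric.closedBall 0 R) < ⊤ := by
  rw [densityMeasure, withDensity_apply _ measurableSet_closedBall]
  have := (hρ0.locallyIntegrable hp).integrableOn_isCompact (isCompact_closedBall (0 : Space N) R)
  exact this.lintegral_lt_top

theorem IsLipschitzField.preimage_flow_closedBall_subset (hv : IsLipschitzField v m) (s t R : ℝ) :
    hv.flow s t ⁻¹' Metric.closedBall 0 R ⊆ Metric.closedBall 0 (R + ∫ τ, m τ) := by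
  intro x hx
  rw [mem_preimage, mem_closedBall_zero_iff] at hx
  rw [mem_closedBall_zero_iff]
  have h1 := hv.norm_flow_sub_self_le' s t x
  have h2 := norm_sub_norm_le x (hv.flow s t x)
  rw [norm_sub_rev] at h2
  linarith

theorem IsLipschitzField.isAdmissibleCurve (hv : IsLipschitzField v m) {T : EReal}
    {u : ℝ → Space N → Space N} (hvu : ∀ᵐ t ∂(volume.restrict (timeSet T)), v t = u t)
    {μ0 : Measure (Space N)} [SFinite μ0] (hfin : ∀ R : ℝ, μ0 (Metric.closedBall 0 R) < ⊤)
    {μ : ℝ → Measure (Space N)} (hμ : ∀ t, 0 ≤ t → μ t = μ0.map (hv.flow 0 t)) :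
    IsAdmissibleCurve T u μ := by
  have hball : ∀ t, 0 ≤ t → ∀ R : ℝ,
      μ t (Metric.closedBall 0 R) ≤ μ0 (Metric.closedBall 0 (R + ∫ τ, m τ)) := by
    intro t ht R
    rw [hμ t ht, Measure.map_apply (hv.continuous_flow_space 0 t).measurable
      measurableSet_closedBall]
    exact measure_mono (hv.preimage_flow_closedBall_subset 0 t R)
  refine ⟨?_, fun b hb R => ?_, fun b hb R => ?_⟩
  · refine ⟨fun t => μ0.map (hv.flow 0 t), measurable_map_measure μ0 (hv.measurable_flow 0), ?_⟩
    filter_upwards [ae_restrict_mem (measurableSet_timeSet T)] with t ht using hμ t ht.1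
  · calc ∫⁻ t in Icc 0 b, μ t (Metric.closedBall 0 R)
        ≤ ∫⁻ _ in Icc 0 b, μ0 (Metric.closedBall 0 (R + ∫ τ, m τ)) :=
          setLIntegral_mono' measurableSet_Icc fun t ht => hball t ht.1 R
      _ < ⊤ := by
          rw [setLIntegral_const]
          exact ENNReal.mul_lt_top (hfin _) (by simp)
  · have hae : ∀ᵐ t ∂(volume.restrict (Icc 0 b)),
        ∫⁻ x in Metric.closedBall 0 R, ‖u t x‖ₑ ∂(μ t) ≤
          ENNReal.ofReal (m t) * μ0 (Metric.closedBall 0 (R + ∫ τ, m τ)) := by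
      filter_upwards [ae_restrict_of_ae (ae_eq_of_mem_timeSet hvu),
        ae_restrict_mem measurableSet_Icc] with t ht htb
      rw [← ht (Icc_subset_timeSet hb htb)]
      calc ∫⁻ x in Metric.closedBall 0 R, ‖v t x‖ₑ ∂(μ t)
          ≤ ∫⁻ _ in Metric.closedBall 0 R, ENNReal.ofReal (m t) ∂(μ t) := by
            refine lintegral_mono fun x => ?_
            rw [← ofReal_norm]
            exact ENNReal.ofReal_le_ofReal (hv.bound t x)
        _ ≤ _ := by
            rw [setLIntegral_const]
            exact mul_le_mul' le_rfl (hball t htb.1 R)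
    refine (lintegral_mono_ae hae).trans_lt ?_
    rw [lintegral_mul_const' _ _ (hfin _).ne]
    exact ENNReal.mul_lt_top hv.integrable.restrict.lintegral_lt_top (hfin _)

theorem isAdmissibleCurve_zero (T : EReal) (u : ℝ → Space N → Space N) :
    IsAdmissibleCurve T u fun _ => 0 :=
  ⟨aemeasurable_const, fun _ _ _ => by simp, fun _ _ _ => by simp⟩

/-- A test function vanishes from some time before `T` on. -/
theorem IsTestFunction.exists_time {T : EReal} (hT : 0 < T) {φ : ℝ × Space N → ℝ}
    (hφ : IsTestFunction T φ) :
    ∃ b ∈ timeSet T, ∀ t, b ≤ t → ∀ x, (t, x) ∉ tsupport φ := by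
  rcases (tsupport φ).eq_empty_or_nonempty with he | hne
  · exact ⟨0, ⟨le_rfl, by simpa using hT⟩, by simp [he]⟩
  · obtain ⟨z, hz, hmax⟩ := hφ.compact.isCompact.exists_isMaxOn hne continuous_fst.continuousOn
    have hz' : ((max 0 z.1 : ℝ) : EReal) < T := by
      rcases max_choice 0 z.1 with h | h <;> rw [h]
      · simpa using hT
      · exact hφ.support hz
    obtain ⟨b, hb1, hb2⟩ := EReal.lt_iff_exists_real_btwn.1 hz'
    have hb1' : max 0 z.1 < b := EReal.coe_lt_coe_iff.1 hb1
    refine ⟨b, ⟨(le_max_left _ _).trans hb1'.le, hb2⟩, fun t ht x hx => ?_⟩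
    have h1 : t ≤ z.1 := hmax hx
    exact absurd (h1.trans (le_max_right 0 z.1)) (not_le.2 (hb1'.trans_le ht))

theorem fderiv_eq_zero_of_notMem_tsupport {E : Type*} [NormedAddCommGroup E] [NormedSpace ℝ E]
    {φ : E → ℝ} {z : E} (hz : z ∉ tsupport φ) : fderiv ℝ φ z = 0 :=
  Function.notMem_support.1 fun h => hz (support_fderiv_subset ℝ h)

/-- The weak formulation along a single integral curve: the fundamental theorem of calculus for the
absolutely continuous function `t ↦ φ (t, X t x)`. -/
theorem IsLipschitzField.setIntegral_fderiv_flow (hv : IsLipschitzField v m) {T : EReal}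
    (hT : 0 < T) {φ : ℝ × Space N → ℝ} (hφ : IsTestFunction T φ) (x : Space N) :
    ∫ t in timeSet T, fderiv ℝ φ (t, hv.flow 0 t x) (1, v t (hv.flow 0 t x)) = -φ (0, x) := by
  obtain ⟨b, hb, hbφ⟩ := hφ.exists_time hT
  have hzero : ∀ t ∈ timeSet T \ Ioc 0 b,
      t ≠ 0 → fderiv ℝ φ (t, hv.flow 0 t x) (1, v t (hv.flow 0 t x)) = 0 := by
    intro t ht ht0
    have hbt : b ≤ t := by
      by_contra h
      exact ht.2 ⟨lt_of_le_of_ne ht.1.1 (Ne.symm ht0), (not_le.1 h).le⟩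
    rw [fderiv_eq_zero_of_notMem_tsupport (hbφ t hbt _), zero_apply]
  set w : ℝ → Space N := fun τ => v τ (hv.flow 0 τ x) with hw
  have hwi : Integrable w := hv.integrable_comp (hv.continuous_flow_time 0 x).measurable
  set y : ℝ → Space N := fun t => x + ∫ τ in (0 : ℝ)..t, w τ with hy
  have hyf : ∀ t, 0 ≤ t → y t = hv.flow 0 t x := fun t ht => (hv.flow_eq ht x).symm
  obtain ⟨L, hL⟩ := hφ.contDiff.lipschitzWith_of_hasCompactSupport hφ.compact one_ne_zero
  have hAC : AbsolutelyContinuousOnInterval (fun t => φ (t, y t)) 0 b := by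
    have hG : AbsolutelyContinuousOnInterval
        (fun t => (L : ℝ) * (t + ∫ τ in (0 : ℝ)..t, m τ)) 0 b := by
      refine (AbsolutelyContinuousOnInterval.fun_add ?_
        (absolutelyContinuousOnInterval_primitive hv.integrable 0 0 b)).const_mul (L : ℝ)
      exact LipschitzOnWith.absolutelyContinuousOnInterval (LipschitzWith.id.lipschitzOnWith)
    refine absolutelyContinuousOnInterval_of_dist_le hG fun t _ t' _ => ?_
    wlog htt : t' ≤ t generalizing t t'
    · rw [dist_comm (φ _), dist_comm (_ * _)]
      exact this t' ‹_› t ‹_› (le_of_not_ge htt)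
    have hii : ∀ a c, IntervalIntegrable m volume a c := fun _ _ => hv.integrable.intervalIntegrable
    have hwii : ∀ a c, IntervalIntegrable w volume a c := fun _ _ => hwi.intervalIntegrable
    have hm0 := hv.integral_nonneg_of_le htt
    have hdy : dist (y t) (y t') ≤ ∫ τ in t'..t, m τ := by
      rw [dist_eq_norm, hy]
      simp only [add_sub_add_left_eq_sub]
      rw [intervalIntegral.integral_interval_sub_left (hwii _ _) (hwii _ _)]
      exact (hv.norm_integral_le _ _ _).trans (abs_of_nonneg hm0).le
    refine (hL.dist_le_mul _ _).trans ?_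
    rw [Real.dist_eq, ← mul_sub, abs_mul, NNReal.abs_eq]
    refine mul_le_mul_of_nonneg_left ?_ L.coe_nonneg
    rw [add_sub_add_comm, intervalIntegral.integral_interval_sub_left (hii _ _) (hii _ _),
      abs_of_nonneg (add_nonneg (sub_nonneg.2 htt) hm0), Prod.dist_eq]
    refine max_le ?_ ?_
    · rw [Real.dist_eq, abs_of_nonneg (sub_nonneg.2 htt)]
      linarith
    · have := sub_nonneg.2 htt
      linarith
  have hder : ∀ᵐ t, t ∈ uIcc 0 b → HasDerivAt (fun t => φ (t, y t))
      (fderiv ℝ φ (t, y t) (1, w t)) t := by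
    filter_upwards [ae_hasDerivAt_primitive hwi 0] with t ht _
    have h1 : HasDerivAt (fun t => (t, y t)) (1, w t) t :=
      (hasDerivAt_id t).prodMk (ht.const_add x)
    exact ((hφ.contDiff.differentiable one_ne_zero) (t, y t)).hasFDerivAt.comp_hasDerivAt t h1
  have hint := integral_eq_sub_of_absolutelyContinuous hAC hder
  have hφb : φ (b, y b) = 0 := image_eq_zero_of_notMem_tsupport (hbφ b le_rfl _)
  have hy0 : y 0 = x := by simp [hy]
  rw [hφb, hy0, zero_sub, intervalIntegral.integral_of_le hb.1] at hint
  rw [← hint]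
  have hsub : Ioc 0 b ⊆ timeSet T := Ioc_subset_Icc_self.trans (Icc_subset_timeSet hb)
  refine (setIntegral_eq_of_subset_of_ae_sdiff_eq_zero
    (measurableSet_timeSet T).nullMeasurableSet hsub ?_).trans ?_
  · filter_upwards [Measure.ae_ne volume (0 : ℝ)] with t ht0 ht using hzero t ht ht0
  · refine setIntegral_congr_fun measurableSet_Ioc fun t ht => ?_
    simp only [hyf t ht.1.le, hw]

/-- The image of `ρ0 dx` under the flow is a weak solution. -/
theorem IsLipschitzField.isWeakSolution (hv : IsLipschitzField v m) {T : EReal} (hT : 0 < T)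
    {u : ℝ → Space N → Space N} (hvu : ∀ᵐ t ∂(volume.restrict (timeSet T)), v t = u t)
    {p : ℝ≥0∞} (hp : 1 ≤ p) {ρ0 : Space N → ℝ} (hρ0 : MemLp ρ0 p volume)
    (hpos : ∀ᵐ x, 0 ≤ ρ0 x) {μ : ℝ → Measure (Space N)}
    (hμ : ∀ t, 0 ≤ t → μ t = (densityMeasure ρ0).map (hv.flow 0 t)) :
    IsWeakSolution T u ρ0 μ fun _ => 0 := by
  set μ0 := densityMeasure ρ0 with hμ0
  have hfin := fun R : ℝ => densityMeasure_closedBall_lt_top hp hρ0 R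
  have : SFinite μ0 := by rw [hμ0, densityMeasure]; infer_instance
  refine ⟨hv.isAdmissibleCurve hvu hfin hμ, isAdmissibleCurve_zero T u, fun φ hφ => ?_⟩
  have hDc : Continuous (fderiv ℝ φ) := hφ.contDiff.continuous_fderiv one_ne_zero
  have hΦ : Measurable fun z : ℝ × Space N => fderiv ℝ φ z (1, v z.1 z.2) :=
    (isBoundedBilinearMap_apply (𝕜 := ℝ) (E := ℝ × Space N) (F := ℝ)).continuous.measurable.comp
      (hDc.measurable.prodMk (measurable_const.prodMk hv.measurable_uncurry))
  have hΘ : Measurable fun z : ℝ × Space N =>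
      fderiv ℝ φ (z.1, hv.flow 0 z.1 z.2) (1, v z.1 (hv.flow 0 z.1 z.2)) :=
    hΦ.comp (measurable_fst.prodMk (hv.measurable_flow 0))
  have hinner : ∀ᵐ t ∂(volume.restrict (timeSet T)),
      (∫ x, fderiv ℝ φ (t, x) (1, u t x) ∂(μ t)) -
          ∫ x, fderiv ℝ φ (t, x) (1, u t x) ∂(0 : Measure (Space N)) =
        ∫ x, fderiv ℝ φ (t, hv.flow 0 t x) (1, v t (hv.flow 0 t x)) ∂μ0 := by
    filter_upwards [hvu, ae_restrict_mem (measurableSet_timeSet T)] with t ht htT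
    rw [integral_zero_measure, sub_zero, ← ht, hμ t htT.1, integral_map
      (hv.continuous_flow_space 0 t).measurable.aemeasurable]
    exact (hΦ.comp measurable_prodMk_left).aestronglyMeasurable
  rw [integral_congr_ae hinner]
  obtain ⟨C, hC⟩ := (hφ.compact.fderiv ℝ).exists_bound_of_continuous hDc
  have hC0 : 0 ≤ C := (norm_nonneg _).trans (hC 0)
  obtain ⟨R, hR⟩ := hφ.compact.isCompact.isBounded.subset_closedBall 0
  have hint : Integrable (fun z : ℝ × Space N =>
      fderiv ℝ φ (z.1, hv.flow 0 z.1 z.2) (1, v z.1 (hv.flow 0 z.1 z.2)))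
      ((volume.restrict (timeSet T)).prod μ0) := by
    have h1 : Integrable ((Metric.closedBall (0 : ℝ) R).indicator fun t => C * (1 + m t))
        (volume.restrict (timeSet T)) := by
      refine Integrable.restrict ((integrable_indicator_iff measurableSet_closedBall).2 ?_)
      exact ((integrableOn_const (isCompact_closedBall _ _).measure_lt_top.ne).add
        hv.integrable.integrableOn).const_mul C
    have h2 : Integrable ((Metric.closedBall (0 : Space N) (R + ∫ τ, m τ)).indicator
        fun _ => (1 : ℝ)) μ0 :=
      (integrable_indicator_iff measurableSet_closedBall).2 (integrableOn_const (hfin _).ne)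
    refine (h1.mul_prod h2).mono' hΘ.aestronglyMeasurable
      (Filter.Eventually.of_forall fun z => ?_)
    by_cases hz : (z.1, hv.flow 0 z.1 z.2) ∈ tsupport φ
    · have h3 := hR hz
      rw [mem_closedBall_zero_iff, Prod.norm_def, max_le_iff] at h3
      have h4 : z.2 ∈ Metric.closedBall (0 : Space N) (R + ∫ τ, m τ) :=
        hv.preimage_flow_closedBall_subset 0 z.1 R (mem_closedBall_zero_iff.2 h3.2)
      rw [indicator_of_mem (mem_closedBall_zero_iff.2 h3.1), indicator_of_mem h4, mul_one]
      refine (ContinuousLinearMap.le_opNorm _ _).trans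
        (mul_le_mul (hC _) ?_ (norm_nonneg _) hC0)
      rw [Prod.norm_def]
      refine max_le ?_ ?_
      · simpa using hv.nonneg z.1
      · have := hv.bound z.1 (hv.flow 0 z.1 z.2)
        simp only
        linarith
    · rw [fderiv_eq_zero_of_notMem_tsupport hz, zero_apply, norm_zero]
      refine mul_nonneg (indicator_nonneg (fun t _ => ?_) _) (indicator_nonneg (fun _ _ => ?_) _)
      · have := hv.nonneg t
        positivity
      · exact zero_le_one
  rw [integral_integral_swap hint]
  simp_rw [hv.setIntegral_fderiv_flow hT hφ]
  rw [integral_neg, hμ0, densityMeasure, integral_withDensity_eq_integral_toReal_smul₀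
    hρ0.aestronglyMeasurable.aemeasurable.ennreal_ofReal (by simp)]
  congr 1
  refine integral_congr_ae ?_
  filter_upwards [hpos] with x hx
  rw [ENNReal.toReal_ofReal hx, smul_eq_mul]

end ContinuityEq

/-! ### Approximate solutions of the dual equation -/

namespace ContinuityEq

open scoped ContDiff Convolution

variable {N : ℕ} {v : ℝ → Space N → Space N} {m : ℝ → ℝ}

/-- The function `-∫_t^∞ ψ(τ, X(t, τ, x)) dτ`, which solves the dual transport equation
`∂_t χ + v · ∇χ = ψ` along integral curves, cut off at negative times to have compact support. -/
noncomputable def IsLipschitzField.dualSolution (hv : IsLipschitzField v m)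
    (ψ : ℝ × Space N → ℝ) (z : ℝ × Space N) : ℝ :=
  if 0 ≤ z.1 then -∫ τ in Ioi z.1, ψ (τ, hv.flow z.1 τ z.2) else 0

/-- A Lipschitz function on space-time with constant `L`, supported in `[0, b]` times the closed ball
of radius `R`. -/
structure IsLipschitzBump {N : ℕ} (ψ : ℝ × Space N → ℝ) (L b R : ℝ) : Prop where
  nonneg : 0 ≤ L
  time_nonneg : 0 ≤ b
  lipschitz : ∀ z z', |ψ z - ψ z'| ≤ L * ‖z - z'‖
  support : ∀ z, ψ z ≠ 0 → z.1 ∈ Icc 0 b ∧ ‖z.2‖ ≤ R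

namespace IsLipschitzBump

variable {ψ : ℝ × Space N → ℝ} {L b R : ℝ}

theorem continuous (hψ : IsLipschitzBump ψ L b R) : Continuous ψ :=
  (LipschitzWith.of_dist_le_mul (K := .mk L hψ.nonneg) fun x y => by
    simpa only [dist_eq_norm, NNReal.coe_mk, Real.norm_eq_abs] using hψ.lipschitz x y).continuous

theorem hasCompactSupport (hψ : IsLipschitzBump ψ L b R) : HasCompactSupport ψ := by
  refine HasCompactSupport.of_support_subset_isCompact
    ((isCompact_Icc (a := 0) (b := b)).prod (isCompact_closedBall (0 : Space N) R)) fun z hz => ?_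
  exact ⟨(hψ.support z hz).1, mem_closedBall_zero_iff.2 (hψ.support z hz).2⟩

theorem integrable_flow (hψ : IsLipschitzBump ψ L b R) (hv : IsLipschitzField v m) (t : ℝ)
    (x : Space N) : Integrable fun τ => ψ (τ, hv.flow t τ x) := by
  refine (hψ.continuous.comp (continuous_id.prodMk
    (hv.continuous_flow_time t x))).integrable_of_hasCompactSupport
    (HasCompactSupport.of_support_subset_isCompact (isCompact_Icc (a := 0) (b := b))
      fun τ hτ => (hψ.support _ hτ).1)

theorem abs_dualSolution_le (hψ : IsLipschitzBump ψ L b R) (hv : IsLipschitzField v m) {B : ℝ}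
    (hB : ∀ z, |ψ z| ≤ B) (z : ℝ × Space N) : |hv.dualSolution ψ z| ≤ b * B := by
  have hB0 : 0 ≤ B := (abs_nonneg _).trans (hB z)
  unfold IsLipschitzField.dualSolution
  split_ifs
  · rw [abs_neg, ← Real.norm_eq_abs]
    have hi : Integrable ((Icc 0 b).indicator fun _ : ℝ => B) :=
      (integrable_indicator_iff measurableSet_Icc).2 (integrableOn_const (by simp))
    refine (norm_integral_le_of_norm_le hi.integrableOn
      (Filter.Eventually.of_forall fun τ => ?_)).trans
      ((setIntegral_le_integral hi (Filter.Eventually.of_forall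
        (indicator_nonneg fun _ _ => hB0))).trans (le_of_eq ?_))
    · by_cases hτ : ψ (τ, hv.flow z.1 τ z.2) = 0
      · rw [hτ, norm_zero]
        exact indicator_nonneg (fun _ _ => hB0) _
      · rw [indicator_of_mem (hψ.support _ hτ).1]
        exact hB _
    · rw [integral_indicator measurableSet_Icc, setIntegral_const]
      simp [hψ.time_nonneg]
  · rw [abs_zero]
    exact mul_nonneg hψ.time_nonneg hB0

theorem abs_dualSolution_sub_le (hψ : IsLipschitzBump ψ L b R) (hv : IsLipschitzField v m) (t : ℝ)
    (x y : Space N) : |hv.dualSolution ψ (t, x) - hv.dualSolution ψ (t, y)| ≤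
      b * (L * Real.exp (∫ τ, m τ)) * ‖x - y‖ := by
  set c := L * Real.exp (∫ τ, m τ) * ‖x - y‖ with hc
  have hc0 : 0 ≤ c := by have := hψ.nonneg; positivity
  have hb := hψ.time_nonneg
  unfold IsLipschitzField.dualSolution
  simp only
  split_ifs
  · rw [neg_sub_neg, ← integral_sub (hψ.integrable_flow hv t y).integrableOn
      (hψ.integrable_flow hv t x).integrableOn, ← Real.norm_eq_abs]
    have hi : Integrable ((Icc 0 b).indicator fun _ : ℝ => c) :=
      (integrable_indicator_iff measurableSet_Icc).2 (integrableOn_const (by simp))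
    refine (norm_integral_le_of_norm_le hi.integrableOn
      (Filter.Eventually.of_forall fun τ => ?_)).trans
      ((setIntegral_le_integral hi (Filter.Eventually.of_forall
        (indicator_nonneg fun _ _ => hc0))).trans (le_of_eq ?_))
    · by_cases hτ : τ ∈ Icc 0 b
      · rw [indicator_of_mem hτ]
        refine (hψ.lipschitz _ _).trans ?_
        rw [Prod.mk_sub_mk, sub_self, Prod.norm_mk, norm_zero, max_eq_right (norm_nonneg _),
          hc, mul_assoc, norm_sub_rev x y]
        exact mul_le_mul_of_nonneg_left (hv.norm_flow_sub_le t τ y x) hψ.nonneg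
      · have h0 : ∀ z, ψ (τ, z) = 0 := fun z => by
          by_contra h
          exact hτ (hψ.support _ h).1
        rw [h0, h0, indicator_of_notMem hτ, sub_zero, norm_zero]
    · rw [integral_indicator measurableSet_Icc, setIntegral_const, hc]
      simp only [measureReal_def, Real.volume_Icc, sub_zero, ENNReal.toReal_ofReal hb, smul_eq_mul]
      ring
  · rw [sub_zero, abs_zero]
    have := hψ.nonneg
    positivity

theorem dualSolution_eq_zero (hψ : IsLipschitzBump ψ L b R) (hv : IsLipschitzField v m)
    {z : ℝ × Space N} (hz : z.1 < 0 ∨ b ≤ z.1 ∨ R + ∫ τ, m τ < ‖z.2‖) :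
    hv.dualSolution ψ z = 0 := by
  unfold IsLipschitzField.dualSolution
  split_ifs with h
  · rw [neg_eq_zero]
    refine setIntegral_eq_zero_of_forall_eq_zero fun τ hτ => ?_
    by_contra hne
    obtain ⟨h1, h2⟩ := hψ.support _ hne
    rcases hz with hz | hz | hz
    · exact absurd h (not_le.2 hz)
    · exact absurd (hz.trans_lt hτ) (not_lt.2 h1.2)
    · have h3 := hv.preimage_flow_closedBall_subset z.1 τ R (mem_closedBall_zero_iff.2 h2)
      exact absurd (mem_closedBall_zero_iff.1 h3) (not_le.2 hz)
  · rfl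

/-- The dual transport equation, integrated along an integral curve. -/
theorem dualSolution_flow_sub (hψ : IsLipschitzBump ψ L b R) (hv : IsLipschitzField v m)
    {s t : ℝ} (hs : 0 ≤ s) (hst : s ≤ t) (y : Space N) :
    hv.dualSolution ψ (t, hv.flow s t y) - hv.dualSolution ψ (s, y) =
      ∫ τ in s..t, ψ (τ, hv.flow s τ y) := by
  unfold IsLipschitzField.dualSolution
  simp only
  rw [if_pos hs, if_pos (hs.trans hst), ← Ioc_union_Ioi_eq_Ioi hst,
    setIntegral_union (Ioc_disjoint_Ioi le_rfl) measurableSet_Ioi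
      (hψ.integrable_flow hv s y).integrableOn (hψ.integrable_flow hv s y).integrableOn,
    intervalIntegral.integral_of_le hst]
  have : ∫ τ in Ioi t, ψ (τ, hv.flow t τ (hv.flow s t y)) = ∫ τ in Ioi t, ψ (τ, hv.flow s τ y) :=
    setIntegral_congr_fun measurableSet_Ioi fun τ hτ => by
      simp only [hv.flow_flow hst (le_of_lt hτ)]
  rw [this]
  ring

theorem measurable_dualSolution (hψ : IsLipschitzBump ψ L b R) (hv : IsLipschitzField v m) :
    Measurable (hv.dualSolution ψ) := by
  refine Measurable.ite (measurableSet_le measurable_const measurable_fst) ?_ measurable_const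
  have h1 : Measurable fun q : (ℝ × Space N) × ℝ => ψ (q.2, hv.flow q.1.1 q.2 q.1.2) :=
    (hψ.continuous.comp (continuous_snd.prodMk (hv.continuous_flow.comp
      ((continuous_fst.comp continuous_fst).prodMk (continuous_snd.prodMk
        (continuous_snd.comp continuous_fst)))))).measurable
  have h2 : Measurable fun q : (ℝ × Space N) × ℝ =>
      if q.1.1 < q.2 then ψ (q.2, hv.flow q.1.1 q.2 q.1.2) else 0 :=
    Measurable.ite (measurableSet_lt (measurable_fst.comp measurable_fst) measurable_snd) h1
      measurable_const
  have h3 := (h2.stronglyMeasurable.integral_prod_right' (ν := volume)).measurable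
  have h4 : ∀ z : ℝ × Space N, ∫ τ in Ioi z.1, ψ (τ, hv.flow z.1 τ z.2) =
      ∫ τ, if z.1 < τ then ψ (τ, hv.flow z.1 τ z.2) else 0 := by
    intro z
    rw [← integral_indicator measurableSet_Ioi]
    rfl
  simp_rw [h4]
  exact h3.neg

theorem locallyIntegrable_dualSolution (hψ : IsLipschitzBump ψ L b R)
    (hv : IsLipschitzField v m) : LocallyIntegrable (hv.dualSolution ψ) volume := by
  obtain ⟨B, hB⟩ := hψ.hasCompactSupport.exists_bound_of_continuous hψ.continuous
  refine (locallyIntegrable_const (b * B)).mono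
    (hψ.measurable_dualSolution hv).aestronglyMeasurable (Filter.Eventually.of_forall fun z => ?_)
  rw [Real.norm_eq_abs, Real.norm_eq_abs]
  exact (hψ.abs_dualSolution_le hv hB z).trans (le_abs_self _)

/-- The dual solution over a short time step in a direction `U` close to the values of `u` along the
integral curve changes at the rate `ψ`, up to the oscillation of `u` and `ψ`. -/
theorem abs_dualSolution_step_le (hψ : IsLipschitzBump ψ L b R) (hv : IsLipschitzField v m)
    {T : EReal} {u : ℝ → Space N → Space N} (hvu : ∀ᵐ t ∂(volume.restrict (timeSet T)), v t = u t)
    {s h c d : ℝ} {y U : Space N} {z : ℝ × Space N} (hs : 0 ≤ s) (hh : 0 ≤ h)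
    (hsh : s + h ∈ timeSet T)
    (hc : ∀ τ ∈ Icc s (s + h), ‖U - u τ (hv.flow s τ y)‖ ≤ c)
    (hd : ∀ τ ∈ Icc s (s + h), ‖(τ, hv.flow s τ y) - z‖ ≤ d) :
    |hv.dualSolution ψ (s + h, y + h • U) - hv.dualSolution ψ (s, y) - h * ψ z| ≤
      h * (b * (L * Real.exp (∫ τ, m τ)) * c + L * d) := by
  have hle : s ≤ s + h := by linarith
  have hwi : IntervalIntegrable (fun τ => v τ (hv.flow s τ y)) volume s (s + h) :=
    (hv.integrable_comp (hv.continuous_flow_time s y).measurable).intervalIntegrable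
  have hψi : IntervalIntegrable (fun τ => ψ (τ, hv.flow s τ y)) volume s (s + h) :=
    (hψ.integrable_flow hv s y).intervalIntegrable
  have h1 : ‖(y + h • U) - hv.flow s (s + h) y‖ ≤ c * h := by
    have h2 : (y + h • U) - hv.flow s (s + h) y =
        ∫ τ in s..(s + h), (U - v τ (hv.flow s τ y)) := by
      rw [hv.flow_eq hle, intervalIntegral.integral_sub intervalIntegrable_const hwi,
        intervalIntegral.integral_const, add_sub_cancel_left, add_sub_add_left_eq_sub]
    have h3 : ‖∫ τ in s..(s + h), (U - v τ (hv.flow s τ y))‖ ≤ c * |s + h - s| := by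
      refine intervalIntegral.norm_integral_le_of_norm_le_const_ae ?_
      filter_upwards [ae_eq_of_mem_timeSet hvu] with τ hτ hτs
      rw [uIoc_of_le hle] at hτs
      rw [hτ (mem_timeSet_of_le hsh (hs.trans hτs.1.le) hτs.2)]
      exact hc τ (Ioc_subset_Icc_self hτs)
    rw [add_sub_cancel_left, abs_of_nonneg hh] at h3
    rwa [h2]
  have h4 := hψ.abs_dualSolution_sub_le hv (s + h) (y + h • U) (hv.flow s (s + h) y)
  have h5 := hψ.dualSolution_flow_sub hv hs hle y
  have h6 : |(∫ τ in s..(s + h), ψ (τ, hv.flow s τ y)) - h * ψ z| ≤ L * d * h := by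
    have h7 : (∫ τ in s..(s + h), ψ (τ, hv.flow s τ y)) - h * ψ z =
        ∫ τ in s..(s + h), (ψ (τ, hv.flow s τ y) - ψ z) := by
      rw [intervalIntegral.integral_sub hψi intervalIntegrable_const,
        intervalIntegral.integral_const, add_sub_cancel_left, smul_eq_mul]
    have h8 : ‖∫ τ in s..(s + h), (ψ (τ, hv.flow s τ y) - ψ z)‖ ≤ L * d * |s + h - s| := by
      refine intervalIntegral.norm_integral_le_of_norm_le_const fun τ hτ => ?_
      rw [uIoc_of_le hle] at hτ
      exact (hψ.lipschitz _ _).trans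
        (mul_le_mul_of_nonneg_left (hd τ (Ioc_subset_Icc_self hτ)) hψ.nonneg)
    rw [add_sub_cancel_left, abs_of_nonneg hh] at h8
    rwa [h7]
  have hK0 : 0 ≤ b * (L * Real.exp (∫ τ, m τ)) :=
    mul_nonneg hψ.time_nonneg (mul_nonneg hψ.nonneg (Real.exp_pos _).le)
  have h9 := h4.trans (mul_le_mul_of_nonneg_left h1 hK0)
  rw [show hv.dualSolution ψ (s + h, y + h • U) - hv.dualSolution ψ (s, y) - h * ψ z =
    (hv.dualSolution ψ (s + h, y + h • U) - hv.dualSolution ψ (s + h, hv.flow s (s + h) y)) +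
      ((∫ τ in s..(s + h), ψ (τ, hv.flow s τ y)) - h * ψ z) by rw [← h5]; ring]
  refine (abs_add_le _ _).trans ((add_le_add h9 h6).trans (le_of_eq ?_))
  ring

/-- Test functions that almost solve the dual transport equation `∂_t φ + u · ∇φ = ψ`, for continuous
`u`. They are mollifications in space and time of the dual solution, shifted in time so that only
its values at positive times enter. -/
theorem exists_testFunction (hψ : IsLipschitzBump ψ L b R) (hv : IsLipschitzField v m)
    {T : EReal} {u : ℝ → Space N → Space N} (hvu : ∀ᵐ t ∂(volume.restrict (timeSet T)), v t = u t)
    (hu : ContinuousOn (fun z : ℝ × Space N => u z.1 z.2) (timeSet T ×ˢ univ))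
    (hb : b ∈ timeSet T) {κ : ℝ} (hκ : 0 < κ) :
    ∃ φ : ℝ × Space N → ℝ, IsTestFunction T φ ∧
      (∀ t x, b < t ∨ R + (∫ τ, m τ) + 1 < ‖x‖ → fderiv ℝ φ (t, x) = 0) ∧
      ∀ t ∈ Icc 0 b, ∀ x, |fderiv ℝ φ (t, x) (1, u t x) - ψ (t, x)| ≤ κ := by
  set A := ∫ τ, m τ with hA
  set K := b * (L * Real.exp A) with hK
  have hL := hψ.nonneg
  have hb0 := hψ.time_nonneg
  have hK0 : 0 ≤ K := by positivity
  have hA0 : 0 ≤ A := integral_nonneg fun τ => hv.nonneg τ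
  obtain ⟨b', hbb', hb'T⟩ := EReal.lt_iff_exists_real_btwn.1 hb.2
  have hbb : b < b' := EReal.coe_lt_coe_iff.1 hbb'
  have hb' : b' ∈ timeSet T := ⟨hb0.trans hbb.le, hb'T⟩
  -- uniform continuity of `u` on a compact set that contains all curves in question
  have hQ : IsCompact (Icc 0 b' ×ˢ Metric.closedBall (0 : Space N) (R + A + 3)) :=
    isCompact_Icc.prod (isCompact_closedBall _ _)
  have huc := hQ.uniformContinuousOn_of_continuous (hu.mono
    (prod_mono (Icc_subset_timeSet hb') (subset_univ _)))
  set c := κ / (2 * (K + 1)) with hc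
  have hc0 : 0 < c := by positivity
  obtain ⟨δ, hδ, hδu⟩ := Metric.uniformContinuousOn_iff.1 huc c hc0
  set d := min 1 (min (δ / 2) (κ / (2 * (L + 1)))) with hd
  have hd0 : 0 < d := lt_min one_pos (lt_min (by positivity) (by positivity))
  have hbound : K * c + L * d ≤ κ := by
    have h1 : K * c ≤ κ / 2 := by
      rw [hc, mul_div_assoc', div_le_div_iff₀ (by positivity) (by positivity)]
      nlinarith
    have h2 : L * d ≤ κ / 2 := by
      refine (mul_le_mul_of_nonneg_left
        ((min_le_right _ _).trans (min_le_right _ _)) hL).trans ?_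
      rw [mul_div_assoc', div_le_div_iff₀ (by positivity) (by positivity)]
      nlinarith
    linarith
  set ε := min (1 / 2) (min (d / 4) ((b' - b) / 4)) with hε
  have hε0 : 0 < ε := lt_min (by norm_num) (lt_min (by positivity) (by linarith))
  have hε1 : ε ≤ 1 / 2 := min_le_left _ _
  have hεd : 4 * ε ≤ d := by
    have := (min_le_right (1 / 2) (min (d / 4) ((b' - b) / 4))).trans (min_le_left _ _)
    linarith
  have hεb : 4 * ε ≤ b' - b := by
    have := (min_le_right (1 / 2) (min (d / 4) ((b' - b) / 4))).trans (min_le_right _ _)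
    linarith
  -- the mollification
  let B : ContDiffBump (0 : ℝ × Space N) := ⟨ε / 2, ε, half_pos hε0, half_lt_self hε0⟩
  set η := B.normed volume with hη
  have hηs : ContDiff ℝ ∞ η := B.contDiff_normed
  have hηc : HasCompactSupport η := B.hasCompactSupport_normed
  have hη1 : ∫ w, η w = 1 := B.integral_normed
  have hη0 : ∀ w, 0 ≤ η w := fun w => B.nonneg_normed w
  have hηi : Integrable η := B.integrable_normed
  have hηr : ∀ w, ε < ‖w‖ → η w = 0 := fun w hw => by
    rw [← Function.notMem_support, hη, B.support_normed_eq, mem_ball_zero_iff]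
    exact hw.le.not_gt
  set χ := hv.dualSolution ψ with hχ
  have hχl := hψ.locallyIntegrable_dualSolution hv
  set M : ℝ × Space N → ℝ := η ⋆[ContinuousLinearMap.lsmul ℝ ℝ, volume] χ with hM
  have : (volume : Measure (ℝ × Space N)).IsAddHaarMeasure := by
    rw [Measure.volume_eq_prod]
    infer_instance
  have hMs : ContDiff ℝ ∞ M :=
    hηc.contDiff_convolution_left (ContinuousLinearMap.lsmul ℝ ℝ) hηs hχl
  -- for `t ≥ 0` the shifted kernel only sees times in `[t + ε, t + 3 ε]`, away from the cut-off at `0`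
  set e : ℝ × Space N := (2 * ε, 0) with he
  set φ : ℝ × Space N → ℝ := fun z => M (z + e) with hφ
  have hφs : ContDiff ℝ ∞ φ := hMs.comp (contDiff_id.add contDiff_const)
  have hφx : ∀ z, φ z = ∫ w, η w * χ (z + e - w) := fun z => rfl
  have hφint : ∀ z, Integrable fun w => η w * χ (z + e - w) := fun z =>
    hηc.convolutionExists_left (ContinuousLinearMap.lsmul ℝ ℝ) hηs.continuous hχl (z + e)
  -- support of the mollification
  have hφ0 : ∀ z : ℝ × Space N, z.1 < -(3 * ε) ∨ b - ε ≤ z.1 ∨ R + A + ε < ‖z.2‖ → φ z = 0 := by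
    intro z hz
    rw [hφx]
    refine integral_eq_zero_of_ae (Filter.Eventually.of_forall fun w => ?_)
    by_cases hw : ‖w‖ ≤ ε
    · rw [Prod.norm_def, max_le_iff, Real.norm_eq_abs, abs_le] at hw
      have : χ (z + e - w) = 0 := by
        refine hψ.dualSolution_eq_zero hv ?_
        simp only [Prod.fst_sub, Prod.fst_add, Prod.snd_sub, Prod.snd_add, he, add_zero]
        rcases hz with hz | hz | hz
        · left; linarith [hw.1.1]
        · right; left; linarith [hw.1.2]
        · right; right
          have := norm_sub_norm_le z.2 w.2
          linarith [hw.2]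
      simp [this]
    · simp [hηr w (not_le.1 hw)]
  have hsupp : tsupport φ ⊆ Icc (-(3 * ε)) b ×ˢ Metric.closedBall 0 (R + A + ε) := by
    refine closure_minimal (fun z hz => ?_) (isClosed_Icc.prod Metric.isClosed_closedBall)
    refine ⟨⟨?_, ?_⟩, ?_⟩
    · by_contra h
      exact hz (hφ0 z (Or.inl (not_le.1 h)))
    · by_contra h
      exact hz (hφ0 z (Or.inr (Or.inl (by linarith [not_le.1 h]))))
    · rw [mem_closedBall_zero_iff]
      by_contra h
      exact hz (hφ0 z (Or.inr (Or.inr (not_le.1 h))))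
  have hφD0 : ∀ t x, b < t ∨ R + A + 1 < ‖x‖ → fderiv ℝ φ (t, x) = 0 := by
    intro t x h
    refine fderiv_eq_zero_of_notMem_tsupport fun hz => ?_
    have h1 := hsupp hz
    rcases h with h | h
    · exact absurd h1.1.2 (not_le.2 h)
    · have h2 := mem_closedBall_zero_iff.1 h1.2
      simp only at h2
      linarith
  refine ⟨φ, ⟨hφs.of_le (by simp), ?_, ?_⟩, hφD0, fun t ht x => ?_⟩
  · exact (isCompact_Icc.prod (isCompact_closedBall _ _)).of_isClosed_subset
      (isClosed_tsupport φ) hsupp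
  · intro z hz
    exact (EReal.coe_le_coe_iff.2 (hsupp hz).1.2).trans_lt hb.2
  by_cases hx : R + A + 1 < ‖x‖
  · have : ψ (t, x) = 0 := by
      by_contra h
      have := (hψ.support _ h).2
      simp only at this
      linarith
    rw [hφD0 t x (Or.inr hx), this]
    simpa using hκ.le
  -- the derivative of the mollification as a limit of forward difference quotients
  have hx' := not_lt.1 hx
  set U := u t x with hU
  have hder : HasDerivAt (fun h : ℝ => φ ((t, x) + h • ((1, U) : ℝ × Space N)))
      (fderiv ℝ φ (t, x) (1, U)) 0 :=
    ((hφs.differentiable (by simp)) (t, x)).hasFDerivAt.hasLineDerivAt _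
  have hslope := hder.tendsto_slope_zero_right
  -- a time step over which the curves move by at most `ε`
  have hMc := (isCompact_Icc (a := 0) (b := b')).uniformContinuousOn_of_continuous
    (hv.continuous_integral 0).continuousOn
  obtain ⟨h₀, hh₀, hh₀M⟩ := Metric.uniformContinuousOn_iff.1 hMc ε hε0
  refine le_of_tendsto ((hslope.sub_const (ψ (t, x))).abs) ?_
  filter_upwards [Ioo_mem_nhdsGT (lt_min hε0 hh₀)] with h hh
  have hhpos : 0 < h := hh.1
  have hhε : h < ε := hh.2.trans_le (min_le_left _ _)
  have hhh₀ : h < h₀ := hh.2.trans_le (min_le_right _ _)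
  rw [zero_add, zero_smul, add_zero, smul_eq_mul]
  have hmain : |φ ((t, x) + h • ((1, U) : ℝ × Space N)) - φ (t, x) - h * ψ (t, x)| ≤ h * κ := by
    have h1 : φ ((t, x) + h • ((1, U) : ℝ × Space N)) - φ (t, x) - h * ψ (t, x) =
        ∫ w, η w * (χ ((t, x) + h • ((1, U) : ℝ × Space N) + e - w) - χ ((t, x) + e - w) -
          h * ψ (t, x)) := by
      have h2 : Integrable fun w => η w * χ ((t, x) + h • ((1, U) : ℝ × Space N) + e - w) -
          η w * χ ((t, x) + e - w) := (hφint _).sub (hφint _)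
      simp_rw [mul_sub]
      rw [integral_sub h2 (hηi.mul_const _),
        integral_sub (hφint _) (hφint _), integral_mul_const, hη1, one_mul, hφx, hφx]
    have h2 : h * κ = ∫ w, η w * (h * κ) := by rw [integral_mul_const, hη1, one_mul]
    rw [h1, h2, ← Real.norm_eq_abs]
    refine norm_integral_le_of_norm_le (hηi.mul_const _) (Filter.Eventually.of_forall fun w => ?_)
    rw [norm_mul, Real.norm_of_nonneg (hη0 w)]
    by_cases hw : ‖w‖ ≤ ε
    · refine mul_le_mul_of_nonneg_left ?_ (hη0 w)
      rw [Prod.norm_def, max_le_iff, Real.norm_eq_abs, abs_le] at hw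
      obtain ⟨⟨hw1, hw2⟩, hw3⟩ := hw
      set s := t + 2 * ε - w.1 with hs
      set y := x - w.2 with hy
      have hs0 : 0 ≤ s := by linarith [ht.1]
      have hsb : s + h ≤ b' := by linarith [ht.2]
      have e1 : (t, x) + h • ((1, U) : ℝ × Space N) + e - w = (s + h, y + h • U) := by
        ext1
        · simp [he, hs]; ring
        · simp only [he, hy, Prod.snd_sub, Prod.snd_add, Prod.smul_snd, add_zero]; abel
      have e2 : (t, x) + e - w = (s, y) := by
        ext1
        · simp [he, hs]
        · simp [he, hy]
      have hclose : ∀ τ ∈ Icc s (s + h), ‖(τ, hv.flow s τ y) - (t, x)‖ ≤ d := by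
        intro τ hτ
        have h3 : ‖hv.flow s τ y - y‖ ≤ ε := by
          refine (hv.norm_flow_sub_self_le s τ y).trans ?_
          rw [max_eq_right hτ.1]
          have h4 := hh₀M τ ⟨hs0.trans hτ.1, hτ.2.trans hsb⟩ s ⟨hs0, by linarith⟩ (by
            rw [Real.dist_eq, abs_of_nonneg (by linarith [hτ.1])]
            linarith [hτ.2])
          rw [Real.dist_eq, intervalIntegral.integral_interval_sub_left
            hv.integrable.intervalIntegrable hv.integrable.intervalIntegrable] at h4
          exact (le_abs_self _).trans h4.le
        rw [Prod.mk_sub_mk, Prod.norm_mk]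
        refine max_le ?_ ?_
        · rw [Real.norm_eq_abs, abs_le]
          constructor <;> linarith [hτ.1, hτ.2]
        · calc ‖hv.flow s τ y - x‖ = ‖(hv.flow s τ y - y) - w.2‖ := by
                rw [hy]; congr 1; abel
            _ ≤ ε + ε := (norm_sub_le _ _).trans (add_le_add h3 hw3)
            _ ≤ d := by linarith
      refine le_trans ?_ (mul_le_mul_of_nonneg_left hbound hhpos.le)
      rw [e1, e2]
      refine hψ.abs_dualSolution_step_le hv hvu hs0 hhpos.le
        (mem_timeSet_of_le hb' (by linarith) hsb) (fun τ hτ => ?_) hclose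
      have h5 := hclose τ hτ
      have h6 : ‖hv.flow s τ y - x‖ ≤ d := (norm_snd_le _).trans h5
      have h7 : d ≤ 1 := min_le_left _ _
      have h8 := hδu (t, x) ⟨⟨ht.1, by linarith [ht.2]⟩, mem_closedBall_zero_iff.2
          (by simp only; linarith)⟩ (τ, hv.flow s τ y)
        ⟨⟨hs0.trans hτ.1, hτ.2.trans hsb⟩, mem_closedBall_zero_iff.2 (by
          have := norm_sub_norm_le (hv.flow s τ y) x
          simp only
          linarith)⟩ (by
          rw [dist_comm, dist_eq_norm]
          exact h5.trans_lt (((min_le_right _ _).trans (min_le_left _ _)).trans_lt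
            (half_lt_self hδ)))
      rw [dist_eq_norm] at h8
      exact h8.le
    · rw [hηr w (not_le.1 hw), zero_mul, zero_mul]
  have h3 : h⁻¹ * (φ ((t, x) + h • ((1, U) : ℝ × Space N)) - φ (t, x)) - ψ (t, x) =
      h⁻¹ * (φ ((t, x) + h • ((1, U) : ℝ × Space N)) - φ (t, x) - h * ψ (t, x)) := by
    field_simp
  rw [h3, abs_mul, abs_of_pos (inv_pos.2 hhpos), inv_mul_le_iff₀ hhpos]
  exact hmain

end IsLipschitzBump

end ContinuityEq

/-! ### Testing measure-valued solutions -/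

namespace ContinuityEq

open scoped ContDiff
open ProbabilityTheory (Kernel IsFiniteKernel)

/-- A measurable function on space-time that is bounded by `C` and vanishes outside `(-∞, b]` times
the closed ball of radius `R`. -/
structure IsLocalIntegrand {N : ℕ} (F : ℝ × Space N → ℝ) (C b R : ℝ) : Prop where
  measurable : Measurable F
  bound : ∀ z, |F z| ≤ C
  support : ∀ t x, b < t ∨ R < ‖x‖ → F (t, x) = 0

variable {N : ℕ} {T : EReal} {u : ℝ → Space N → Space N} {μ : ℝ → Measure (Space N)}

theorem IsAdmissibleCurve.ae_closedBall_lt_top (hμ : IsAdmissibleCurve T u μ) :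
    ∀ᵐ t ∂(volume.restrict (timeSet T)), ∀ R : ℝ, μ t (Metric.closedBall 0 R) < ⊤ := by
  have h1 : ∀ (q : ℚ) (n : ℕ), (q : ℝ) ∈ timeSet T →
      ∀ᵐ t ∂(volume.restrict (timeSet T)), t ∈ Icc 0 (q : ℝ) →
        μ t (Metric.closedBall 0 n) < ⊤ := by
    intro q n hq
    have hm : AEMeasurable (fun t => μ t (Metric.closedBall 0 n))
        (volume.restrict (Icc 0 (q : ℝ))) :=
      ((Measure.measurable_coe measurableSet_closedBall).comp_aemeasurable hμ.measurable).mono_set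
        (Icc_subset_timeSet hq)
    exact ae_restrict_of_ae ((ae_restrict_iff' measurableSet_Icc).1
      (ae_lt_top' hm (hμ.mass q hq n).ne))
  have h2 : ∀ᵐ t ∂(volume.restrict (timeSet T)), ∀ (q : ℚ) (n : ℕ), (q : ℝ) ∈ timeSet T →
      t ∈ Icc 0 (q : ℝ) → μ t (Metric.closedBall 0 n) < ⊤ :=
    ae_all_iff.2 fun q => ae_all_iff.2 fun n => Filter.eventually_imp_distrib_left.2 (h1 q n)
  filter_upwards [h2, ae_restrict_mem (measurableSet_timeSet T)] with t ht htT R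
  obtain ⟨q, hq1, hq2⟩ := EReal.lt_iff_exists_rat_btwn.1 htT.2
  obtain ⟨n, hn⟩ := exists_nat_ge R
  have hq3 : t < q := by exact_mod_cast hq1
  exact (measure_mono (Metric.closedBall_subset_closedBall hn)).trans_lt
    (ht q n ⟨htT.1.trans hq3.le, hq2⟩ ⟨htT.1, hq3.le⟩)

namespace IsLocalIntegrand

variable {F G : ℝ × Space N → ℝ} {C C' b R : ℝ}

theorem sub (hF : IsLocalIntegrand F C b R) (hG : IsLocalIntegrand G C' b R) {c : ℝ}
    (hc : ∀ z, |F z - G z| ≤ c) : IsLocalIntegrand (fun z => F z - G z) c b R where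
  measurable := hF.measurable.sub hG.measurable
  bound := hc
  support t x h := by simp only [hF.support t x h, hG.support t x h, sub_zero]

theorem abs_le_indicator (hF : IsLocalIntegrand F C b R) (t : ℝ) (x : Space N) :
    ‖F (t, x)‖ ≤ (Metric.closedBall 0 R).indicator (fun _ => C) x := by
  by_cases hx : ‖x‖ ≤ R
  · rw [indicator_of_mem (mem_closedBall_zero_iff.2 hx)]
    exact hF.bound _
  · rw [indicator_of_notMem (fun h => hx (mem_closedBall_zero_iff.1 h)),
      hF.support t x (Or.inr (not_le.1 hx)), norm_zero]

theorem integrable (hF : IsLocalIntegrand F C b R) (t : ℝ) {ν : Measure (Space N)}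
    (hν : ν (Metric.closedBall 0 R) < ⊤) : Integrable (fun x => F (t, x)) ν :=
  ((integrable_indicator_iff measurableSet_closedBall).2 (integrableOn_const hν.ne)).mono'
    (hF.measurable.comp measurable_prodMk_left).aestronglyMeasurable
    (Filter.Eventually.of_forall (hF.abs_le_indicator t))

theorem norm_integral_le (hF : IsLocalIntegrand F C b R) (t : ℝ) {ν : Measure (Space N)}
    (hν : ν (Metric.closedBall 0 R) < ⊤) :
    ‖∫ x, F (t, x) ∂ν‖ ≤ C * (ν (Metric.closedBall 0 R)).toReal := by
  refine (norm_integral_le_of_norm_le ((integrable_indicator_iff measurableSet_closedBall).2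
    (integrableOn_const hν.ne)) (Filter.Eventually.of_forall (hF.abs_le_indicator t))).trans
    (le_of_eq ?_)
  rw [integral_indicator measurableSet_closedBall, setIntegral_const, smul_eq_mul, mul_comm,
    measureReal_def]

/-- Measurability in time of the integrals against a measurable family of measures. On the ball that
matters the family is normalised to a finite kernel first. -/
theorem aestronglyMeasurable_integral (hF : IsLocalIntegrand F C b R)
    (hμ : IsAdmissibleCurve T u μ) :
    AEStronglyMeasurable (fun t => ∫ x, F (t, x) ∂(μ t)) (volume.restrict (timeSet T)) := by
  obtain ⟨μ', hμ', hμμ'⟩ := hμ.measurable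
  set S := Metric.closedBall (0 : Space N) R with hS
  have hSm : MeasurableSet S := measurableSet_closedBall
  have hmS : Measurable fun t => μ' t S := (Measure.measurable_coe hSm).comp hμ'
  have hmc : Measurable fun t => (1 + μ' t S)⁻¹ := (measurable_const.add hmS).inv
  let κ : Kernel ℝ (Space N) := ⟨fun t => (1 + μ' t S)⁻¹ • (μ' t).restrict S, by
    refine Measure.measurable_of_measurable_coe _ fun s hs => ?_
    simp only [Measure.smul_apply, Measure.restrict_apply hs, smul_eq_mul]
    exact hmc.mul ((Measure.measurable_coe (hs.inter hSm)).comp hμ')⟩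
  have hκt : ∀ t, κ t = (1 + μ' t S)⁻¹ • (μ' t).restrict S := fun t => rfl
  have hκ : IsFiniteKernel κ := ⟨1, ENNReal.one_lt_top, fun t => by
    rw [hκt, Measure.smul_apply, Measure.restrict_apply_univ, smul_eq_mul, mul_comm,
      ← div_eq_mul_inv]
    exact ENNReal.div_le_of_le_mul (by rw [one_mul]; exact le_add_self)⟩
  have hmeas : StronglyMeasurable fun t => ((1 + μ' t S)⁻¹.toReal)⁻¹ * ∫ x, F (t, x) ∂(κ t) :=
    hmc.ennreal_toReal.inv.stronglyMeasurable.mul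
      (hF.measurable.stronglyMeasurable.integral_kernel_prod_right')
  refine hmeas.aestronglyMeasurable.congr ?_
  filter_upwards [hμμ', hμ.ae_closedBall_lt_top] with t ht hfin
  have hS1 : μ' t S < ⊤ := ht ▸ hfin R
  have h1 : ((1 + μ' t S)⁻¹).toReal ≠ 0 :=
    ENNReal.toReal_ne_zero.2 ⟨ENNReal.inv_ne_zero.2 (by simp [hS1.ne]), by simp⟩
  rw [hκt, integral_smul_measure, smul_eq_mul, inv_mul_cancel_left₀ h1, ht]
  refine setIntegral_eq_integral_of_forall_compl_eq_zero fun x hx => hF.support t x (Or.inr ?_)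
  exact not_le.1 fun h => hx (mem_closedBall_zero_iff.2 h)

theorem integrable_mass (hμ : IsAdmissibleCurve T u μ) (hb : b ∈ timeSet T) (R : ℝ) :
    IntegrableOn (fun t => (μ t (Metric.closedBall 0 R)).toReal) (Icc 0 b) :=
  integrable_toReal_of_lintegral_ne_top
    (((Measure.measurable_coe measurableSet_closedBall).comp_aemeasurable hμ.measurable).mono_set
      (Icc_subset_timeSet hb)) (hμ.mass b hb R).ne

theorem ae_norm_le (hF : IsLocalIntegrand F C b R) (hμ : IsAdmissibleCurve T u μ) :
    ∀ᵐ t ∂(volume.restrict (timeSet T)), ‖∫ x, F (t, x) ∂(μ t)‖ ≤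
      (Icc 0 b).indicator (fun t => C * (μ t (Metric.closedBall 0 R)).toReal) t := by
  filter_upwards [hμ.ae_closedBall_lt_top, ae_restrict_mem (measurableSet_timeSet T)] with t ht htT
  by_cases htb : t ≤ b
  · rw [indicator_of_mem (show t ∈ Icc 0 b from ⟨htT.1, htb⟩)]
    exact hF.norm_integral_le t (ht R)
  · rw [indicator_of_notMem (fun h => htb h.2)]
    simp_rw [hF.support t _ (Or.inl (not_le.1 htb))]
    simp

theorem integrableOn_integral (hF : IsLocalIntegrand F C b R) (hμ : IsAdmissibleCurve T u μ)
    (hb : b ∈ timeSet T) : IntegrableOn (fun t => ∫ x, F (t, x) ∂(μ t)) (timeSet T) :=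
  (((integrable_indicator_iff measurableSet_Icc).2
    ((integrable_mass hμ hb R).const_mul C)).integrableOn).mono'
    (hF.aestronglyMeasurable_integral hμ) (hF.ae_norm_le hμ)

theorem abs_setIntegral_le (hF : IsLocalIntegrand F C b R) (hμ : IsAdmissibleCurve T u μ)
    (hb : b ∈ timeSet T) : |∫ t in timeSet T, ∫ x, F (t, x) ∂(μ t)| ≤
      C * ∫ t in Icc 0 b, (μ t (Metric.closedBall 0 R)).toReal := by
  rw [← Real.norm_eq_abs]
  refine (norm_integral_le_of_norm_le (((integrable_indicator_iff measurableSet_Icc).2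
    ((integrable_mass hμ hb R).const_mul C)).integrableOn) (hF.ae_norm_le hμ)).trans
    (le_of_eq ?_)
  rw [setIntegral_indicator measurableSet_Icc, inter_eq_self_of_subset_right
    (Icc_subset_timeSet hb), integral_const_mul]

theorem setIntegral_sub (hF : IsLocalIntegrand F C b R) (hG : IsLocalIntegrand G C' b R)
    (hμ : IsAdmissibleCurve T u μ) (hb : b ∈ timeSet T) :
    ∫ t in timeSet T, ∫ x, (F (t, x) - G (t, x)) ∂(μ t) =
      (∫ t in timeSet T, ∫ x, F (t, x) ∂(μ t)) - ∫ t in timeSet T, ∫ x, G (t, x) ∂(μ t) := by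
  rw [← integral_sub (hF.integrableOn_integral hμ hb) (hG.integrableOn_integral hμ hb)]
  refine integral_congr_ae ?_
  filter_upwards [hμ.ae_closedBall_lt_top] with t ht
  exact integral_sub (hF.integrable t (ht R)) (hG.integrable t (ht R))

end IsLocalIntegrand

theorem IsLipschitzBump.isLocalIntegrand {ψ : ℝ × Space N → ℝ} {L b R B : ℝ}
    (hψ : IsLipschitzBump ψ L b R) (hB : ∀ z, |ψ z| ≤ B) {R' : ℝ} (hR : R ≤ R') :
    IsLocalIntegrand ψ B b R' where
  measurable := hψ.continuous.measurable
  bound := hB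
  support t x h := by
    by_contra hne
    obtain ⟨h1, h2⟩ := hψ.support _ hne
    rcases h with h | h
    · exact absurd h1.2 (not_le.2 h)
    · exact absurd (h2.trans hR) (not_le.2 h)

/-- Two weak solutions with the same initial datum, one of them nonnegative, have the same integral
against every Lipschitz bump function. -/
theorem IsLipschitzBump.setIntegral_eq {ψ : ℝ × Space N → ℝ} {L b R : ℝ}
    (hψ : IsLipschitzBump ψ L b R) {v : ℝ → Space N → Space N} {m : ℝ → ℝ}
    (hv : IsLipschitzField v m) (hvu : ∀ᵐ t ∂(volume.restrict (timeSet T)), v t = u t)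
    (hu : ContinuousOn (fun z : ℝ × Space N => u z.1 z.2) (timeSet T ×ˢ univ))
    (hb : b ∈ timeSet T) {ρ0 : Space N → ℝ} {ν σ : ℝ → Measure (Space N)}
    (h₁ : IsWeakSolution T u ρ0 μ ν) (h₂ : IsWeakSolution T u ρ0 σ fun _ => 0) :
    (∫ t in timeSet T, ∫ x, ψ (t, x) ∂(μ t)) =
      (∫ t in timeSet T, ∫ x, ψ (t, x) ∂(ν t)) + ∫ t in timeSet T, ∫ x, ψ (t, x) ∂(σ t) := by
  set R' := R + (∫ τ, m τ) + 1 with hR'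
  have hA0 : 0 ≤ ∫ τ, m τ := integral_nonneg fun τ => hv.nonneg τ
  have hRR : R ≤ R' := by linarith
  obtain ⟨B, hB⟩ := hψ.hasCompactSupport.exists_bound_of_continuous hψ.continuous
  have hψI := hψ.isLocalIntegrand hB hRR
  have hTm := measurableSet_timeSet T
  let mass := fun θ : ℝ → Measure (Space N) =>
    ∫ t in Icc 0 b, (θ t (Metric.closedBall 0 R')).toReal
  have hmass : ∀ θ : ℝ → Measure (Space N), 0 ≤ mass θ := fun θ =>
    integral_nonneg fun _ => ENNReal.toReal_nonneg
  have hkey : ∀ κ > 0, |(∫ t in timeSet T, ∫ x, ψ (t, x) ∂(μ t)) -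
      (∫ t in timeSet T, ∫ x, ψ (t, x) ∂(ν t)) - ∫ t in timeSet T, ∫ x, ψ (t, x) ∂(σ t)| ≤
      κ * (mass μ + mass ν + mass σ) := by
    intro κ hκ
    obtain ⟨φ, hφ, hφ0, hφψ⟩ := hψ.exists_testFunction hv hvu hu hb hκ
    classical
    -- the derivative of the test function along `(1, u)`, made measurable off `[0, T)`
    set G : ℝ × Space N → ℝ := (timeSet T ×ˢ univ).piecewise
      (fun z => fderiv ℝ φ z (1, u z.1 z.2)) fun _ => 0 with hG
    have hGT : ∀ t ∈ timeSet T, ∀ x, G (t, x) = fderiv ℝ φ (t, x) (1, u t x) := fun t ht x =>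
      piecewise_eq_of_mem _ _ _ ⟨ht, mem_univ _⟩
    have hGm : Measurable G := by
      refine ContinuousOn.measurable_piecewise ?_ continuousOn_const (hTm.prod MeasurableSet.univ)
      exact (hφ.contDiff.continuous_fderiv one_ne_zero).continuousOn.clm_apply
        (continuousOn_const.prodMk hu)
    have hsub : ∀ z, |ψ z - G z| ≤ κ ∧ (b < z.1 ∨ R' < ‖z.2‖ → G z = 0) := by
      rintro ⟨t, x⟩
      by_cases ht : t ∈ timeSet T
      · rw [hGT t ht]
        have h0 : b < t ∨ R' < ‖x‖ → fderiv ℝ φ (t, x) (1, u t x) = 0 := fun h => by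
          rw [hφ0 t x h, zero_apply]
        refine ⟨?_, h0⟩
        by_cases htb : t ≤ b
        · rw [abs_sub_comm]
          exact hφψ t ⟨ht.1, htb⟩ x
        · rw [h0 (Or.inl (not_le.1 htb)), hψI.support t x (Or.inl (not_le.1 htb))]
          simpa using hκ.le
      · have h0 : G (t, x) = 0 := piecewise_eq_of_notMem _ _ _ fun h => ht h.1
        refine ⟨?_, fun _ => h0⟩
        have : ψ (t, x) = 0 := by
          by_contra h
          exact ht (Icc_subset_timeSet hb (hψ.support _ h).1)
        rw [h0, this]
        simpa using hκ.le
    have hGI : IsLocalIntegrand G (B + κ) b R' := ⟨hGm, fun z => by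
      have h1 := abs_sub_abs_le_abs_sub (G z) (ψ z)
      rw [abs_sub_comm] at h1
      have h2 := (hsub z).1
      have h3 : |ψ z| ≤ B := hB z
      linarith, fun t x h => (hsub (t, x)).2 h⟩
    have hDI := hψI.sub hGI fun z => (hsub z).1
    have hcongr : ∀ θ : ℝ → Measure (Space N), ∀ t ∈ timeSet T,
        ∫ x, fderiv ℝ φ (t, x) (1, u t x) ∂(θ t) = ∫ x, G (t, x) ∂(θ t) := fun θ t ht => by
      simp_rw [hGT t ht]
    have e1 : (∫ t in timeSet T, ∫ x, G (t, x) ∂(μ t)) -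
        (∫ t in timeSet T, ∫ x, G (t, x) ∂(ν t)) = -∫ x, ρ0 x * φ (0, x) := by
      rw [← integral_sub (hGI.integrableOn_integral h₁.pos hb)
        (hGI.integrableOn_integral h₁.neg hb), ← h₁.weak_eq φ hφ]
      exact setIntegral_congr_fun hTm fun t ht => by simp only [hcongr _ t ht]
    have e2 : (∫ t in timeSet T, ∫ x, G (t, x) ∂(σ t)) = -∫ x, ρ0 x * φ (0, x) := by
      rw [← h₂.weak_eq φ hφ]
      exact setIntegral_congr_fun hTm fun t ht => by
        simp only [hcongr _ t ht, integral_zero_measure, sub_zero]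
    have d1 := hDI.abs_setIntegral_le h₁.pos hb
    have d2 := hDI.abs_setIntegral_le h₁.neg hb
    have d3 := hDI.abs_setIntegral_le h₂.pos hb
    rw [hψI.setIntegral_sub hGI h₁.pos hb] at d1
    rw [hψI.setIntegral_sub hGI h₁.neg hb] at d2
    rw [hψI.setIntegral_sub hGI h₂.pos hb] at d3
    change _ ≤ κ * mass μ at d1
    change _ ≤ κ * mass ν at d2
    change _ ≤ κ * mass σ at d3
    rw [abs_le] at d1 d2 d3 ⊢
    constructor <;> linarith [d1.1, d1.2, d2.1, d2.2, d3.1, d3.2]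
  -- the masses do not depend on `κ`, which is now sent to zero
  have hzero := le_of_forall_gt_imp_ge_of_dense fun a (ha : 0 < a) => (hkey
    (a / (mass μ + mass ν + mass σ + 1)) (by
      have := hmass μ; have := hmass ν; have := hmass σ
      positivity)).trans (by
    have h1 := hmass μ
    have h2 := hmass ν
    have h3 := hmass σ
    rw [div_mul_eq_mul_div, div_le_iff₀ (by positivity)]
    nlinarith : _ ≤ a)
  have := abs_eq_zero.1 (le_antisymm hzero (abs_nonneg _))
  linarith

end ContinuityEq

/-! ### Uniqueness -/

namespace ContinuityEq

open scoped ContDiff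

variable {N : ℕ}

/-- The bounded open sets `⋂ i ∈ F, i ∩ B(0, n)`, for finite subfamilies `F` of a countable basis of
the topology. They form a countable `π`-system that generates the Borel sets. -/
def basicOpen (q : Finset (TopologicalSpace.countableBasis (Space N)) × ℕ) : Set (Space N) :=
  (⋂ i ∈ q.1, (i : Set (Space N))) ∩ Metric.ball 0 q.2

theorem isOpen_basicOpen (q : Finset (TopologicalSpace.countableBasis (Space N)) × ℕ) :
    IsOpen (basicOpen q) :=
  (isOpen_biInter_finset fun i _ => (TopologicalSpace.isBasis_countableBasis _).isOpen
    i.2).inter Metric.isOpen_ball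

theorem isPiSystem_basicOpen : IsPiSystem (range (basicOpen (N := N))) := by
  classical
  rintro _ ⟨⟨F, n⟩, rfl⟩ _ ⟨⟨G, k⟩, rfl⟩ -
  refine ⟨(F ∪ G, min n k), ?_⟩
  ext x
  simp only [basicOpen, Finset.mem_union, mem_inter_iff, mem_iInter, Metric.mem_ball, Nat.cast_min,
    lt_min_iff, or_imp, forall_and]
  tauto

theorem generateFrom_basicOpen :
    (inferInstance : MeasurableSpace (Space N)) =
      MeasurableSpace.generateFrom (range (basicOpen (N := N))) := by
  refine le_antisymm ?_ (MeasurableSpace.generateFrom_le ?_)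
  · rw [BorelSpace.measurable_eq (α := Space N),
      (TopologicalSpace.isBasis_countableBasis (Space N)).borel_eq_generateFrom]
    refine MeasurableSpace.generateFrom_le fun s hs => ?_
    have : s = ⋃ n : ℕ, basicOpen ({⟨s, hs⟩}, n) := by
      simp only [basicOpen, Finset.mem_singleton, iInter_iInter_eq_left]
      rw [← inter_iUnion, Metric.iUnion_ball_nat, inter_univ]
    rw [this]
    exact MeasurableSet.iUnion fun n => MeasurableSpace.measurableSet_generateFrom ⟨_, rfl⟩
  · rintro _ ⟨q, rfl⟩
    exact (isOpen_basicOpen q).measurableSet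

/-- Countably many Lipschitz functions of bounded support determine a locally finite measure. -/
theorem measure_eq_of_integral_plateau_eq (hN : 0 < N) {μ ν : Measure (Space N)}
    (hμ : ∀ R : ℝ, μ (Metric.closedBall 0 R) < ⊤) (hν : ∀ R : ℝ, ν (Metric.closedBall 0 R) < ⊤)
    (h : ∀ (q : Finset (TopologicalSpace.countableBasis (Space N)) × ℕ) (k : ℕ),
      ∫ x, plateau (basicOpen q) k x ∂μ = ∫ x, plateau (basicOpen q) k x ∂ν) : μ = ν := by
  have hlt : ∀ {θ : Measure (Space N)}, (∀ R : ℝ, θ (Metric.closedBall 0 R) < ⊤) →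
      ∀ q : Finset (TopologicalSpace.countableBasis (Space N)) × ℕ, θ (basicOpen q) < ⊤ :=
    fun hθ q => (measure_mono (inter_subset_right.trans Metric.ball_subset_closedBall)).trans_lt
      (hθ q.2)
  have hlim : ∀ {θ : Measure (Space N)}, (∀ R : ℝ, θ (Metric.closedBall 0 R) < ⊤) →
      ∀ q : Finset (TopologicalSpace.countableBasis (Space N)) × ℕ,
      Filter.Tendsto (fun k => ∫ x, plateau (basicOpen q) k x ∂θ) Filter.atTop
        (nhds (θ (basicOpen q)).toReal) := by
    intro θ hθ q
    have h1 : ∫ x, (basicOpen q).indicator (fun _ => (1 : ℝ)) x ∂θ = (θ (basicOpen q)).toReal := by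
      rw [integral_indicator (isOpen_basicOpen q).measurableSet, setIntegral_const, smul_eq_mul,
        mul_one, measureReal_def]
    rw [← h1]
    refine tendsto_integral_of_dominated_convergence
      ((basicOpen q).indicator fun _ => (1 : ℝ))
      (fun k => (continuous_plateau _ k).aestronglyMeasurable)
      ((integrable_indicator_iff (isOpen_basicOpen q).measurableSet).2
        (integrableOn_const (hlt hθ q).ne))
      (fun k => Filter.Eventually.of_forall fun x => ?_)
      (Filter.Eventually.of_forall fun x => tendsto_plateau (isOpen_basicOpen q)
        (nonempty_compl_of_subset_ball hN inter_subset_right) x)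
    rw [Real.norm_of_nonneg (plateau_nonneg _ k x)]
    exact plateau_le_indicator _ k x
  refine Measure.ext_of_generateFrom_of_iUnion (range basicOpen) (fun n : ℕ => basicOpen (∅, n))
    generateFrom_basicOpen isPiSystem_basicOpen ?_ (fun n => ⟨_, rfl⟩) (fun n => (hlt hμ _).ne) ?_
  · simp only [basicOpen, Finset.notMem_empty, iInter_of_empty, iInter_univ, univ_inter]
    exact Metric.iUnion_ball_nat 0
  · rintro _ ⟨q, rfl⟩
    have h1 := hlim hμ q
    simp_rw [h q] at h1
    exact (ENNReal.toReal_eq_toReal_iff' (hlt hμ q).ne (hlt hν q).ne).1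
      (tendsto_nhds_unique h1 (hlim hν q))

/-- The product of a smooth function of time and a plateau function. -/
theorem isLipschitzBump_mul_plateau {T : EReal} (hT : 0 < T) {α : ℝ → ℝ} (hα : ContDiff ℝ ∞ α)
    (hαc : HasCompactSupport α) (hαT : tsupport α ⊆ timeSet T) {O : Set (Space N)} {R : ℝ}
    (hO : O ⊆ Metric.ball 0 R) (k : ℕ) :
    ∃ L, ∃ b ∈ timeSet T, IsLipschitzBump (fun z => α z.1 * plateau O k z.2) L b R := by
  obtain ⟨A, hA⟩ := hαc.exists_bound_of_continuous hα.continuous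
  have hA0 : 0 ≤ A := (norm_nonneg _).trans (hA 0)
  obtain ⟨K, hK⟩ := hα.lipschitzWith_of_hasCompactSupport hαc (by simp)
  obtain ⟨b, hb, hbα⟩ : ∃ b ∈ timeSet T, ∀ t ∈ tsupport α, t ≤ b := by
    rcases (tsupport α).eq_empty_or_nonempty with h | h
    · exact ⟨0, ⟨le_rfl, by simpa using hT⟩, by simp [h]⟩
    · obtain ⟨b, hb⟩ := hαc.isCompact.exists_isGreatest h
      exact ⟨b, hαT hb.1, fun t ht => hb.2 ht⟩
  refine ⟨K + A * k, b, hb, by positivity, hb.1, fun z z' => ?_, fun z hz => ⟨?_, ?_⟩⟩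
  · have h1 : |α z.1 - α z'.1| ≤ K * ‖z - z'‖ := by
      have := hK.dist_le_mul z.1 z'.1
      rw [Real.dist_eq, dist_eq_norm] at this
      exact this.trans (mul_le_mul_of_nonneg_left (norm_fst_le (z - z')) K.2)
    have h2 : |plateau O k z.2 - plateau O k z'.2| ≤ k * ‖z - z'‖ := by
      refine (abs_plateau_sub_le O k _ _).trans ?_
      rw [dist_eq_norm]
      exact mul_le_mul_of_nonneg_left (norm_snd_le (z - z')) k.cast_nonneg
    have h3 : |plateau O k z'.2| ≤ 1 := by
      rw [abs_of_nonneg (plateau_nonneg O k _)]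
      exact plateau_le_one O k _
    calc |α z.1 * plateau O k z.2 - α z'.1 * plateau O k z'.2|
        = |α z.1 * (plateau O k z.2 - plateau O k z'.2) +
            (α z.1 - α z'.1) * plateau O k z'.2| := by congr 1; ring
      _ ≤ A * (k * ‖z - z'‖) + K * ‖z - z'‖ * 1 := by
        refine (abs_add_le _ _).trans ?_
        rw [abs_mul, abs_mul]
        exact add_le_add (mul_le_mul (hA _) h2 (abs_nonneg _) hA0)
          (mul_le_mul h1 h3 (abs_nonneg _) (by positivity))
      _ = (K + A * k) * ‖z - z'‖ := by ring
  · have h1 : z.1 ∈ tsupport α := subset_tsupport _ fun h => hz (by simp [h])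
    exact ⟨(hαT h1).1, hbα _ h1⟩
  · by_contra h
    refine hz ?_
    rw [plateau_of_notMem fun h' => h (mem_ball_zero_iff.1 (hO h')).le, mul_zero]

theorem isLocalIntegrand_plateau {O : Set (Space N)} {R : ℝ} (hO : O ⊆ Metric.ball 0 R) (k : ℕ)
    (b : ℝ) : IsLocalIntegrand (fun z => (Iic b).indicator 1 z.1 * plateau O k z.2) 1 b R where
  measurable := ((measurable_one.indicator measurableSet_Iic).comp measurable_fst).mul
    ((continuous_plateau O k).measurable.comp measurable_snd)
  bound z := by
    rw [abs_mul, abs_of_nonneg (plateau_nonneg O k _)]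
    refine mul_le_one₀ ?_ (plateau_nonneg O k _) (plateau_le_one O k _)
    by_cases h : z.1 ∈ Iic b <;> simp [h]
  support t x h := by
    rcases h with h | h
    · simp [h]
    · simp only
      rw [plateau_of_notMem fun h' => absurd (mem_ball_zero_iff.1 (hO h')) h.le.not_gt, mul_zero]

/-- Testing with products `α(t) β(x)`, for all smooth `α`, localises the equality of integrals to almost
every time. -/
theorem ae_integral_plateau_eq {v : ℝ → Space N → Space N} {m : ℝ → ℝ}
    (hv : IsLipschitzField v m) {T : EReal} (hT : 0 < T) {u : ℝ → Space N → Space N}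
    (hvu : ∀ᵐ t ∂(volume.restrict (timeSet T)), v t = u t)
    (hu : ContinuousOn (fun z : ℝ × Space N => u z.1 z.2) (timeSet T ×ˢ univ))
    {ρ0 : Space N → ℝ} {μ ν σ : ℝ → Measure (Space N)}
    (h₁ : IsWeakSolution T u ρ0 μ ν) (h₂ : IsWeakSolution T u ρ0 σ fun _ => 0)
    {O : Set (Space N)} {R : ℝ} (hO : O ⊆ Metric.ball 0 R) (k : ℕ) :
    ∀ᵐ t ∂(volume.restrict (timeSet T)), ∫ x, plateau O k x ∂(μ t) =
      (∫ x, plateau O k x ∂(ν t)) + ∫ x, plateau O k x ∂(σ t) := by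
  set f : ℝ → ℝ := fun t => (∫ x, plateau O k x ∂(μ t)) -
    ((∫ x, plateau O k x ∂(ν t)) + ∫ x, plateau O k x ∂(σ t)) with hf
  set U : Set ℝ := {t | 0 < t ∧ (t : EReal) < T} with hU
  have hUo : IsOpen U := (isOpen_lt continuous_const continuous_id).inter
    (isOpen_lt continuous_coe_real_ereal continuous_const)
  have hUT : U ⊆ timeSet T := fun t ht => ⟨ht.1.le, ht.2⟩
  have hTm := measurableSet_timeSet T
  have hloc : ∀ {θ : ℝ → Measure (Space N)}, IsAdmissibleCurve T u θ → ∀ b ∈ timeSet T,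
      IntegrableOn (fun t => ∫ x, plateau O k x ∂(θ t)) (Icc 0 b) := by
    intro θ hθ b hb
    refine (((isLocalIntegrand_plateau hO k b).integrableOn_integral hθ hb).mono_set
      (Icc_subset_timeSet hb)).congr_fun (fun t ht => ?_) measurableSet_Icc
    simp [ht.2]
  have hfb : ∀ b ∈ timeSet T, IntegrableOn f (Icc 0 b) := fun b hb =>
    (hloc h₁.pos b hb).sub ((hloc h₁.neg b hb).add (hloc h₂.pos b hb))
  have hfl : LocallyIntegrableOn f U (volume.restrict (timeSet T)) := by
    intro t ht
    obtain ⟨b, hb1, hb2⟩ := EReal.lt_iff_exists_real_btwn.1 ht.2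
    have htb : t < b := EReal.coe_lt_coe_iff.1 hb1
    exact ⟨Icc 0 b, mem_nhdsWithin_of_mem_nhds (Icc_mem_nhds ht.1 htb),
      (hfb b ⟨ht.1.le.trans htb.le, hb2⟩).mono_measure
        Measure.restrict_le_self⟩
  have hzero : ∀ α : ℝ → ℝ, ContDiff ℝ ∞ α → HasCompactSupport α → tsupport α ⊆ U →
      ∫ t in timeSet T, α t • f t = 0 := by
    intro α hα hαc hαU
    obtain ⟨L, b, hb, hψ⟩ := isLipschitzBump_mul_plateau hT hα hαc (hαU.trans hUT) hO k
    have h3 := hψ.setIntegral_eq hv hvu hu hb h₁ h₂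
    obtain ⟨B, hB⟩ := hψ.hasCompactSupport.exists_bound_of_continuous hψ.continuous
    have hI := hψ.isLocalIntegrand hB le_rfl
    have i1 := hI.integrableOn_integral h₁.pos hb
    have i2 := hI.integrableOn_integral h₁.neg hb
    have i3 := hI.integrableOn_integral h₂.pos hb
    simp only [integral_const_mul] at h3 i1 i2 i3
    simp only [hf, smul_eq_mul, mul_sub, mul_add]
    have i4 : IntegrableOn (fun t => α t * (∫ x, plateau O k x ∂(ν t)) +
        α t * ∫ x, plateau O k x ∂(σ t)) (timeSet T) := i2.add i3
    rw [integral_sub i1 i4, integral_add i2 i3, h3, sub_self]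
  have h4 := hUo.ae_eq_zero_of_integral_contDiff_smul_eq_zero hfl hzero
  filter_upwards [h4, ae_restrict_of_ae (Measure.ae_ne volume 0),
    ae_restrict_mem hTm] with t ht ht0 htT
  exact sub_eq_zero.1 (ht ⟨lt_of_le_of_ne htT.1 (Ne.symm ht0), htT.2⟩)

/-- Uniqueness among signed measure valued solutions, for a continuous velocity field. -/
theorem IsWeakSolution.ae_eq_add {v : ℝ → Space N → Space N} {m : ℝ → ℝ}
    (hv : IsLipschitzField v m) (hN : 0 < N) {T : EReal} (hT : 0 < T)
    {u : ℝ → Space N → Space N} (hvu : ∀ᵐ t ∂(volume.restrict (timeSet T)), v t = u t)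
    (hu : ContinuousOn (fun z : ℝ × Space N => u z.1 z.2) (timeSet T ×ˢ univ))
    {ρ0 : Space N → ℝ} {μ ν σ : ℝ → Measure (Space N)}
    (h₁ : IsWeakSolution T u ρ0 μ ν) (h₂ : IsWeakSolution T u ρ0 σ fun _ => 0) :
    ∀ᵐ t ∂(volume.restrict (timeSet T)), μ t = ν t + σ t := by
  have h3 : ∀ᵐ t ∂(volume.restrict (timeSet T)),
      ∀ (q : Finset (TopologicalSpace.countableBasis (Space N)) × ℕ) (k : ℕ),
        ∫ x, plateau (basicOpen q) k x ∂(μ t) =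
          (∫ x, plateau (basicOpen q) k x ∂(ν t)) + ∫ x, plateau (basicOpen q) k x ∂(σ t) :=
    ae_all_iff.2 fun q => ae_all_iff.2 fun k =>
      ae_integral_plateau_eq hv hT hvu hu h₁ h₂ inter_subset_right k
  filter_upwards [h3, h₁.pos.ae_closedBall_lt_top, h₁.neg.ae_closedBall_lt_top,
    h₂.pos.ae_closedBall_lt_top] with t ht hμ hν hσ
  refine measure_eq_of_integral_plateau_eq hN hμ (fun R => ?_) fun q k => ?_
  · rw [Measure.add_apply]
    exact ENNReal.add_lt_top.2 ⟨hν R, hσ R⟩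
  · have hint : ∀ {θ : Measure (Space N)}, (∀ R : ℝ, θ (Metric.closedBall 0 R) < ⊤) →
        Integrable (fun x => plateau (basicOpen q) k x) θ := fun hθ => by
      have := (isLocalIntegrand_plateau (O := basicOpen q) inter_subset_right k 0).integrable 0
        (hθ q.2)
      simpa using this
    rw [integral_add_measure (hint hν) (hint hσ)]
    exact ht q k

end ContinuityEq

open ContinuityEq in
theorem theorem4p1 (N : ℕ) (hN : 0 < N) (T : EReal) (hT : 0 < T)
    (u : ℝ → Space N → Space N) (hu : MemL1W1inf T u)
    (p : ℝ≥0∞) (hp : 1 ≤ p)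
    (ρ0 : Space N → ℝ) (hρ0 : MemLp ρ0 p volume) (hpos : ∀ᵐ x, 0 ≤ ρ0 x) :
    ∃ (X : ℝ → Space N → Space N) (ρ : ℝ → Space N → ℝ),
      -- `X` is the flow of `u`, it is unique, and each map `X t` is continuous
      IsFlow T u X ∧
      (∀ Y, IsFlow T u Y → ∀ t ∈ timeSet T, Y t = X t) ∧
      (∀ t ∈ timeSet T, Continuous (X t)) ∧
      -- `ρ` is nonnegative, lies in `L^∞(0, T; L^p)`, and is the push-forward of `ρ0`
      (∀ t ∈ timeSet T, MemLp (ρ t) p volume ∧ ∀ᵐ x, 0 ≤ ρ t x) ∧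
      MemLinfLp T p ρ ∧
      (∀ t ∈ timeSet T, densityMeasure (ρ t) = (densityMeasure ρ0).map (X t)) ∧
      -- `ρ` is a weak solution
      IsWeakSolution T u ρ0 (fun t => densityMeasure (ρ t)) (fun _ => 0) ∧
      -- `L^p` bound, with `1 - 1/p = 1/p'`, and conservation of mass
      (∀ t ∈ timeSet T, eLpNorm (ρ t) p volume ≤
        ENNReal.ofReal (Real.exp ((1 - p⁻¹).toReal * (l1w1infNorm T u).toReal)) *
          eLpNorm ρ0 p volume) ∧
      (∀ t ∈ timeSet T, eLpNorm (ρ t) 1 volume = eLpNorm ρ0 1 volume) ∧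
      -- if `u` is `C^1`, every (signed measure valued) weak solution `μ t - ν t` equals `ρ t dx`
      (ContDiffOn ℝ 1 (fun z : ℝ × Space N => u z.1 z.2) (timeSet T ×ˢ univ) →
        ∀ μ ν : ℝ → Measure (Space N), IsWeakSolution T u ρ0 μ ν →
          ∀ᵐ t ∂(volume.restrict (timeSet T)), μ t = ν t + densityMeasure (ρ t)) := by
  obtain ⟨v, m, hv, hvu, hm, hdiv⟩ := hu.exists_isLipschitzField
  obtain ⟨ρ, hρm, hρ, hmap, hLp⟩ := hv.exists_transported_density hN hdiv hp hρ0 hpos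
  rw [hm] at hLp
  have hfin : ENNReal.ofReal (Real.exp ((1 - p⁻¹).toReal * (l1w1infNorm T u).toReal)) *
      eLpNorm ρ0 p volume < ⊤ := ENNReal.mul_lt_top ENNReal.ofReal_lt_top hρ0.2
  have hsol : IsWeakSolution T u ρ0 (fun t => densityMeasure (ρ t)) fun _ => 0 :=
    hv.isWeakSolution hT hvu hp hρ0 hpos hmap
  refine ⟨hv.flow 0, ρ, hv.isFlow hvu, fun Y hY t ht => hv.eq_flow_of_isFlow hvu hY ht,
    fun t _ => hv.continuous_flow_space 0 t, fun t ht => ⟨⟨?_, (hLp t ht.1).trans_lt hfin⟩,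
      Filter.Eventually.of_forall (hρ t)⟩, ⟨hρm.aestronglyMeasurable, ?_⟩,
    fun t ht => hmap t ht.1, hsol, fun t ht => hLp t ht.1, fun t ht => ?_,
    fun hC1 μ ν hμν => hμν.ae_eq_add hv hN hT hvu hC1.continuousOn hsol⟩
  · exact (hρm.comp measurable_prodMk_left).aestronglyMeasurable
  · refine ⟨(ENNReal.ofReal (Real.exp ((1 - p⁻¹).toReal * (l1w1infNorm T u).toReal)) *
      eLpNorm ρ0 p volume).toNNReal, ?_⟩
    filter_upwards [ae_restrict_mem (measurableSet_timeSet T)] with t ht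
    rw [ENNReal.coe_toNNReal hfin.ne]
    exact hLp t ht.1
  · rw [eLpNorm_one_eq_densityMeasure (Filter.Eventually.of_forall (hρ t)),
      eLpNorm_one_eq_densityMeasure hpos, hmap t ht.1,
      Measure.map_apply (hv.continuous_flow_space 0 t).measurable MeasurableSet.univ,
      preimage_univ]
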